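/- Bandits with bounded rewards and unknown variances. An instance $\nu=(\nu_1,\dots,\nu_K)$, $K\ge 2$, consists of distributions on $[0,1]$ with means $\mu_i$, variances $\sigma_i^2$ and a unique optimal arm, which we call arm $1$ (the learner knows neither which arm this is, nor the means, nor the variances). Put $\Delta_i=\mu_1-\mu_i$ for $i\ne 1$ and $\Delta_1:=\Delta_2:=\min_{i\neq 1}\Delta_i$ (arms being relabelled so that $\mu_1>\mu_2\ge\dots\ge\mu_K$). A fixed-confidence (FC) algorithm with input $\delta\in(0,1)$ pulls arms adaptively, sees independent rewards from the arms pulled, stops after $\tau\le\infty$ pulls, and then recommends an arm $\hat J$. VD-BESTARMID is an FC algorithm with the following guarantee: for a universal constant $c$, for all such instances and all $\delta\in(0,1)$, $$P(\hat J\ne 1,\ \tau<\infty)\le\delta,\qquad P\Big(\tau>c\sum_{i=1}^K\Big(\frac{\sigma_i^2}{\Delta_i^2}+\frac1{\Delta_i}\Big)\Big(1+\ln\frac1\delta+\ln\big(1+\ln\tfrac1{\Delta_i}\big)\Big)\Big)\le\delta. \qquad (\ast)$$ FC2FB with budget $B\in\mathbb N$, base failure rate $\delta_0$, parameter $Q$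 and an FC algorithm $\mathcal A$: let $R=\lfloor\log_2(B/Q)\rfloor$ and $B'=\lfloor B/R\rfloor$; for $r=1,\dots,R$ run $\mathcal A(\delta_0^{2^{R-r}})$ from scratch on fresh samples with a budget limit of $B'$ pulls; the first time that such a run stops by itself, output the arm $\hat J$ that it recommends; if no run stops by itself, output an arbitrary arm $\hat J$. Claim. (i) There is a constant $c>0$ such that for every $K\ge2$ there is an FC algorithm on $K$ arms with the guarantee $(\ast)$. (ii) For every $c>0$ there is a constant $C>0$, depending only on $c$, such that for every $K\ge 2$, every FC algorithm $\mathcal A$ on $K$ arms with the guarantee $(\ast)$, and every instance $\nu$ as above, with $$A=C\sum_{i=1}^K\Big(\frac{\sigma_i^2}{\Delta_i^2}+\frac1{\Delta_i}\Big)\Big(1+\ln\big(1+\ln\tfrac1{\Delta_i}\big)\Big),$$ for every budget $B\ge 2A\ln(4A)$, FC2FB run on $\mathcal A$ with $\delta_0=1/e$ and $Q=1$ satisfies $$P(\hat J\neq 1)\le 3\exp\Big(-\frac{B}{4+4A\ln B}\Big).$$ -/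

import Mathlib

open MeasureTheory ProbabilityTheory
open scoped ENNReal

noncomputable section

namespace BAI

/-! ### Learners and the bandit protocol -/

/-- What a fixed-confidence learner does next: pull an arm, or stop and recommend an arm. -/
inductive Decision (K : ℕ) where
  | pull (i : Fin K) : Decision K
  | recommend (j : Fin K) : Decision K

instance (K : ℕ) : MeasurableSpace (Decision K) := ⊤

/-- The recommended arm, if the decision is to stop. -/
def Decision.recommended {K : ℕ} : Decision K → Option (Fin K)
  | .pull _ => none
  | .recommend j => some j

/-- A fixed-confidence learner on `K` arms (its confidence level already being fixed): after `n`
pulls it decides from the `n` pairs (arm pulled, reward received) seen so far, and from nothing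
else. -/
structure FCAlgorithm (K : ℕ) where
  next : (n : ℕ) → (Fin n → Fin K × ℝ) → Decision K
  measurable_next : ∀ n, Measurable (next n)

variable {K : ℕ}

namespace FCAlgorithm

/-- The history after `n` pulls. The reward of time step `t` is `ω t i` if arm `i` is the arm
pulled in that step. (What is recorded after the learner has stopped is never used.) -/
def history (𝒜 : FCAlgorithm K) (ω : ℕ → Fin K → ℝ) : (n : ℕ) → Fin n → Fin K × ℝ
  | 0 => Fin.elim0
  | n + 1 =>
    Fin.snoc (α := fun _ => Fin K × ℝ) (history 𝒜 ω n)
      (match 𝒜.next n (history 𝒜 ω n) with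
        | .pull i => (i, ω n i)
        | .recommend j => (j, ω n j))

/-- The result of running the learner with a budget limit of `n` pulls: the arm it recommended, or
`none` if it did not stop by itself after at most `n` pulls. -/
def outcome (𝒜 : FCAlgorithm K) (ω : ℕ → Fin K → ℝ) : ℕ → Option (Fin K)
  | 0 => (𝒜.next 0 (𝒜.history ω 0)).recommended
  | n + 1 =>
    match outcome 𝒜 ω n with
    | some j => some j
    | none => (𝒜.next (n + 1) (𝒜.history ω (n + 1))).recommended

/-- The stopping time `τ`: the number of pulls after which the learner stops by itself
(`⊤` if it never does). -/
def stoppingTime (𝒜 : FCAlgorithm K) (ω : ℕ → Fin K → ℝ) : ℕ∞ :=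
  ⨅ (n : ℕ) (_ : 𝒜.outcome ω n ≠ none), (n : ℕ∞)

/-- The arm recommended at the stopping time (meaningful only if the learner stops). -/
def output (𝒜 : FCAlgorithm K) (ω : ℕ → Fin K → ℝ) : Option (Fin K) :=
  𝒜.outcome ω (𝒜.stoppingTime ω).toNat

end FCAlgorithm

/-! ### Bandit instances with bounded rewards -/

/-- A bandit instance with `K` arms, rewards in `[0, 1]`, and a unique optimal arm, which may be any
of the arms. -/
structure BoundedInstance (K : ℕ) where
  law : Fin K → Measure ℝ
  isProb : ∀ i, IsProbabilityMeasure (law i)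
  bounded : ∀ i, ∀ᵐ x ∂(law i), x ∈ Set.Icc (0 : ℝ) 1
  best : Fin K
  best_unique : ∀ i, i ≠ best → ∫ x, x ∂(law i) < ∫ x, x ∂(law best)

attribute [instance] BoundedInstance.isProb

namespace BoundedInstance

/-- The mean `μ_i`. -/
def mean (ν : BoundedInstance K) (i : Fin K) : ℝ := ∫ x, x ∂(ν.law i)

/-- The variance `σ_i²`. -/
def var (ν : BoundedInstance K) (i : Fin K) : ℝ := Var[fun x => x; ν.law i]

/-- The gap `Δ_i` of arm `i` to the optimal arm; the gap of the optimal arm itself is by convention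
the smallest gap of the other arms. -/
def gap (ν : BoundedInstance K) (i : Fin K) : ℝ :=
  if i = ν.best then ⨅ j : {j : Fin K // j ≠ ν.best}, (ν.mean ν.best - ν.mean j)
  else ν.mean ν.best - ν.mean i

/-- The joint law of the rewards `ω t i`: independent over time steps and arms, with `ω t i`
distributed as arm `i`. As only `ω t i` for the arm `i` pulled at time `t` is revealed, each reward
is, given the past, a fresh sample of the arm pulled. -/
def rewardLaw (ν : BoundedInstance K) : Measure (ℕ → Fin K → ℝ) :=
  Measure.infinitePi fun _ : ℕ => Measure.pi ν.law

end BoundedInstance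

/-! ### Guarantees of fixed-confidence learners -/

/-- `δ`-correctness on the instance `ν`: `P(Ĵ ≠ best, τ < ∞) ≤ δ`. -/
def IsCorrect (ν : BoundedInstance K) (𝒜 : FCAlgorithm K) (δ : ℝ) : Prop :=
  ν.rewardLaw.real {ω | 𝒜.output ω ≠ some ν.best ∧ 𝒜.stoppingTime ω < ⊤} ≤ δ

/-- High probability sample complexity `T` at level `δ` on the instance `ν`: `P(τ > T) ≤ δ`. -/
def HasSampleComplexity (ν : BoundedInstance K) (𝒜 : FCAlgorithm K) (T δ : ℝ) : Prop :=
  ν.rewardLaw.real {ω | ENNReal.ofReal T < ((𝒜.stoppingTime ω : ℕ∞) : ℝ≥0∞)} ≤ δ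

/-- `𝒜`, a learner for each confidence level, is a variance-dependent best-arm identification
algorithm for bounded rewards with constant `c`: knowing neither the gaps nor the variances, it is
`δ`-correct and has the high probability sample complexity
`c ∑ᵢ (σᵢ²/Δᵢ² + 1/Δᵢ) (ln (1/δ) + ln ln (1/Δᵢ))`, at every level `δ ∈ (0,1)` and on every instance.
(The terms `1` only keep the logarithmic factors meaningful for `δ` or `Δᵢ` close to `1`.) -/
def IsVDBestArmID (c : ℝ) (𝒜 : ℝ → FCAlgorithm K) : Prop :=
  ∀ ν : BoundedInstance K, ∀ δ ∈ Set.Ioo (0 : ℝ) 1,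
    IsCorrect ν (𝒜 δ) δ ∧
    HasSampleComplexity ν (𝒜 δ)
      (c * ∑ i, (ν.var i / ν.gap i ^ 2 + 1 / ν.gap i) *
        (1 + Real.log (1 / δ) + Real.log (1 + Real.log (1 / ν.gap i)))) δ

/-! ### The meta-algorithm FC2FB -/

/-- The number of stages `R = ⌊log₂ (B/Q)⌋`. -/
def numStages (B : ℕ) (Q : ℝ) : ℕ := ⌊Real.logb 2 (B / Q)⌋₊

/-- The budget per stage `B' = ⌊B/R⌋`. -/
def stageBudget (B : ℕ) (Q : ℝ) : ℕ := B / numStages B Q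

/-- The result of stage `r ∈ {1, …, R}`: the learner of level `δ₀ ^ L_r`, `L_r = 2^(R-r)`, is run
from scratch with the budget limit `B'`. As each earlier stage has used up `B'` pulls (otherwise
the loop has been left), stage `r` starts at time step `(r - 1) B'`. -/
def stageOutcome (𝒜 : ℝ → FCAlgorithm K) (B : ℕ) (δ₀ Q : ℝ) (ω : ℕ → Fin K → ℝ) (r : ℕ) :
    Option (Fin K) :=
  (𝒜 (δ₀ ^ 2 ^ (numStages B Q - r))).outcome
    (fun t => ω ((r - 1) * stageBudget B Q + t)) (stageBudget B Q)

/-- FC2FB with base learner `𝒜`, budget `B` and parameters `δ₀`, `Q`: the arm output by the first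
stage `r = 1, …, R` that stops by itself, and the arbitrary arm `j₀` if there is none. -/
def fc2fb (𝒜 : ℝ → FCAlgorithm K) (B : ℕ) (δ₀ Q : ℝ) (j₀ : Fin K) (ω : ℕ → Fin K → ℝ) : Fin K :=
  ((List.range' 1 (numStages B Q)).findSome? (stageOutcome 𝒜 B δ₀ Q ω)).getD j₀

/-- `∑ᵢ (σᵢ²/Δᵢ² + 1/Δᵢ)`, each term with its doubly logarithmic factor in `1/Δᵢ`. -/
def BoundedInstance.complexity (ν : BoundedInstance K) : ℝ :=
  ∑ i, (ν.var i / ν.gap i ^ 2 + 1 / ν.gap i) * (1 + Real.log (1 + Real.log (1 / ν.gap i)))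

end BAI

end

/-!
The second part is a union bound over the stages of FC2FB. Let `r` be the first stage whose budget
exceeds the sample complexity that the learner has at the confidence level of this stage. A wrong
arm is output only if stage `r` does not end within its budget, or if some stage up to `r` recommends
a wrong arm. The failure rates `exp (-2 ^ (R - s))` of the stages `s ≤ r` increase with `s` at least
geometrically, so all these probabilities add up to at most three times the rate of stage `r`
(`measureReal_fc2fb_ne_le`); that such a stage exists, with `2 ^ (R - r)` at least
`B / (4 + 4 A ln B)`, is arithmetic (`exists_stage`).

The first part needs an algorithm whose sample complexity has no factor `ln K`, so no union bound
over the arms is possible. In round `r` the accuracy is `2 ^ (-r)`. Estimating the mean of arm `i`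
to this accuracy costs about its weight `σᵢ² 4 ^ r + 2 ^ r` times the confidence exponent, by
Bernstein's inequality; the weight itself is estimated from squared differences of pairs of samples
(pilot block), before the mean is estimated (main block). Each estimate may be wrong, but by Markov's
inequality (`measureReal_weighted_markov`) the arms with a wrong estimate carry only a small fraction
of the total weight, except with a probability that does not depend on the number of arms. This is
enough for two phases per round:

* search: pass to the arms above a weighted quantile of the estimates, and repeat until none is
  left. The weight is halved each time, so that the confidence can be increased from level to level
  at no cost, and the largest quantile `θ` seen is close to the largest mean. The heaviest arm on or
  above this quantile is the candidate; it is the best arm once all gaps are resolved, since the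
  other arms there are misjudged, hence light.
* verification: eliminate the arms that are clearly below `θ`, and repeat, on the arms other than
  the candidate, as long as the weight of these decreases enough. If only the candidate is left, it
  is recommended, which is right, as the best arm is never eliminated in a typical run. Otherwise
  the next round begins, with a small part of the weight of the resolved arms only.

A deterministic analysis (`goodNext_next`) shows that a typical level keeps the invariant `CtxInv`
of the run and decreases two potentials, a bound for the number of pulls to come and a bound for the
probability that an atypical level is to come. An algorithm that proceeds in blocks of fresh samples
then succeeds within the time potential, up to the failure potential
(`BlockMachine.measureReal_not_succeeds_le`). The time potential at the start is a sum over rounds in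
which arm `i` contributes geometrically decaying amounts around the round `r` that resolves its gap,
where `2 ^ r` is about `1 / Δᵢ` (`roundsCost_confExponent_le`).
-/

noncomputable section

namespace BAI

variable {K : ℕ}

/-! ### Stopping times and the outcome of a learner -/

namespace FCAlgorithm

theorem outcome_eq_some_of_le (𝒜 : FCAlgorithm K) (ω : ℕ → Fin K → ℝ) {n m : ℕ} (h : n ≤ m)
    {j : Fin K} (hn : 𝒜.outcome ω n = some j) : 𝒜.outcome ω m = some j := by
  induction m, h using Nat.le_induction with
  | base => exact hn
  | succ m _ ih => simp [outcome, ih]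

theorem lt_stoppingTime_of_outcome_eq_none (𝒜 : FCAlgorithm K) (ω : ℕ → Fin K → ℝ) {n : ℕ}
    (hn : 𝒜.outcome ω n = none) : (n : ℕ∞) < 𝒜.stoppingTime ω := by
  have : ((n + 1 : ℕ) : ℕ∞) ≤ 𝒜.stoppingTime ω := by
    refine le_iInf₂ fun m hm => ?_
    obtain ⟨j, hj⟩ := Option.ne_none_iff_exists'.1 hm
    by_contra hlt
    have hmn : m ≤ n := by
      have := not_le.1 hlt
      have := Nat.cast_lt.1 this
      omega
    have := 𝒜.outcome_eq_some_of_le ω hmn hj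
    simp_all
  exact lt_of_lt_of_le (by exact_mod_cast Nat.lt_succ_self n) this

theorem stoppingTime_le (𝒜 : FCAlgorithm K) (ω : ℕ → Fin K → ℝ) {n : ℕ}
    (hn : 𝒜.outcome ω n ≠ none) : 𝒜.stoppingTime ω ≤ n :=
  iInf₂_le n hn

theorem output_of_outcome_eq_some (𝒜 : FCAlgorithm K) (ω : ℕ → Fin K → ℝ) {n : ℕ} {j : Fin K}
    (hn : 𝒜.outcome ω n = some j) : 𝒜.output ω = some j := by
  have hle := 𝒜.stoppingTime_le ω (n := n) (by simp [hn])
  obtain ⟨t, ht⟩ := ENat.ne_top_iff_exists.1 (ne_top_of_le_ne_top (ENat.natCast_ne_top n) hle)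
  have htn : t ≤ n := by rw [← ht] at hle; exact_mod_cast hle
  have hout : 𝒜.output ω = 𝒜.outcome ω t := by simp [output, ← ht]
  rw [hout]
  cases h : 𝒜.outcome ω t with
  | none =>
    have := 𝒜.lt_stoppingTime_of_outcome_eq_none ω h
    rw [← ht] at this
    exact absurd this (lt_irrefl _)
  | some i =>
    have := 𝒜.outcome_eq_some_of_le ω htn h
    rw [hn] at this
    exact this.symm

end FCAlgorithm

instance (ν : BoundedInstance K) : IsProbabilityMeasure ν.rewardLaw := by
  unfold BoundedInstance.rewardLaw; infer_instance

theorem BoundedInstance.measurePreserving_shift (ν : BoundedInstance K) (s : ℕ) :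
    MeasurePreserving (fun (ω : ℕ → Fin K → ℝ) t => ω (s + t)) ν.rewardLaw ν.rewardLaw where
  measurable := by fun_prop
  map_eq := by
    unfold BoundedInstance.rewardLaw
    exact Measure.map_infinitePi_infinitePi_of_inj (P := fun _ : ℕ => Measure.pi ν.law)
      (f := fun t => s + t) (fun a b h => by simpa using h)

/-- Stationarity, as an inequality, so that the event needs no measurability. -/
theorem BoundedInstance.measureReal_shift_le (ν : BoundedInstance K) (s : ℕ)
    (E : Set (ℕ → Fin K → ℝ)) :
    ν.rewardLaw.real {ω | (fun t => ω (s + t)) ∈ E} ≤ ν.rewardLaw.real E := by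
  have h := ν.measurePreserving_shift s
  have h1 : ν.rewardLaw ((fun (ω : ℕ → Fin K → ℝ) t => ω (s + t)) ⁻¹' E) ≤ ν.rewardLaw E := by
    conv_rhs => rw [← h.map_eq]
    exact Measure.le_map_apply h.measurable.aemeasurable E
  exact ENNReal.toReal_mono (measure_ne_top _ _) h1

/-! ### Gaps and the complexity -/

namespace BoundedInstance

theorem integrable_id (ν : BoundedInstance K) (i : Fin K) : Integrable (fun x => x) (ν.law i) :=
  Integrable.of_mem_Icc 0 1 aemeasurable_id (ν.bounded i)

theorem mean_nonneg (ν : BoundedInstance K) (i : Fin K) : 0 ≤ ν.mean i :=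
  integral_nonneg_of_ae ((ν.bounded i).mono fun _ hx => hx.1)

theorem mean_le_one (ν : BoundedInstance K) (i : Fin K) : ν.mean i ≤ 1 := by
  have := integral_mono_ae (ν.integrable_id i) (integrable_const (1 : ℝ))
    ((ν.bounded i).mono fun _ hx => hx.2)
  simpa [mean] using this

theorem mean_lt (ν : BoundedInstance K) {i : Fin K} (h : i ≠ ν.best) :
    ν.mean i < ν.mean ν.best := ν.best_unique i h

theorem mean_le (ν : BoundedInstance K) (i : Fin K) : ν.mean i ≤ ν.mean ν.best := by
  by_cases h : i = ν.best
  · rw [h]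
  · exact (ν.mean_lt h).le

theorem var_nonneg (ν : BoundedInstance K) (i : Fin K) : 0 ≤ ν.var i := variance_nonneg _ _

theorem gap_of_ne (ν : BoundedInstance K) {i : Fin K} (h : i ≠ ν.best) :
    ν.gap i = ν.mean ν.best - ν.mean i := by simp [gap, h]

theorem exists_gap_best_eq (hK : 2 ≤ K) (ν : BoundedInstance K) :
    ∃ i, i ≠ ν.best ∧ ν.gap ν.best = ν.gap i := by
  have : Nontrivial (Fin K) := Fin.nontrivial_iff_two_le.2 hK
  obtain ⟨i, hi⟩ := exists_ne ν.best
  have : Nonempty {j : Fin K // j ≠ ν.best} := ⟨⟨i, hi⟩⟩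
  obtain ⟨j, hj⟩ := exists_eq_ciInf_of_finite
    (f := fun j : {j : Fin K // j ≠ ν.best} => ν.mean ν.best - ν.mean j)
  exact ⟨j, j.2, by rw [ν.gap_of_ne j.2, hj]; simp [gap]⟩

theorem gap_best_le (ν : BoundedInstance K) (i : Fin K) : ν.gap ν.best ≤ ν.gap i := by
  by_cases h : i = ν.best
  · rw [h]
  · rw [ν.gap_of_ne h]
    simp only [gap, if_true]
    exact ciInf_le (Set.finite_range
      (fun j : {j : Fin K // j ≠ ν.best} => ν.mean ν.best - ν.mean j)).bddBelow ⟨i, h⟩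

theorem gap_pos (hK : 2 ≤ K) (ν : BoundedInstance K) (i : Fin K) : 0 < ν.gap i := by
  obtain ⟨j, hj, hb⟩ := ν.exists_gap_best_eq hK
  refine lt_of_lt_of_le ?_ (ν.gap_best_le i)
  rw [hb, ν.gap_of_ne hj]
  linarith [ν.mean_lt hj]

theorem gap_le_one (hK : 2 ≤ K) (ν : BoundedInstance K) (i : Fin K) : ν.gap i ≤ 1 := by
  have h : ∀ j, j ≠ ν.best → ν.gap j ≤ 1 := fun j hj => by
    rw [ν.gap_of_ne hj]; linarith [ν.mean_nonneg j, ν.mean_le_one ν.best]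
  by_cases hi : i = ν.best
  · obtain ⟨j, hj, hb⟩ := ν.exists_gap_best_eq hK
    rw [hi, hb]; exact h j hj
  · exact h i hi

theorem log_gap_nonneg (hK : 2 ≤ K) (ν : BoundedInstance K) (i : Fin K) :
    0 ≤ Real.log (1 / ν.gap i) :=
  Real.log_nonneg (by rw [le_div_iff₀ (ν.gap_pos hK i)]; linarith [ν.gap_le_one hK i])

theorem loglog_gap_nonneg (hK : 2 ≤ K) (ν : BoundedInstance K) (i : Fin K) :
    0 ≤ Real.log (1 + Real.log (1 / ν.gap i)) :=
  Real.log_nonneg (by linarith [ν.log_gap_nonneg hK i])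

theorem one_le_hardness (hK : 2 ≤ K) (ν : BoundedInstance K) (i : Fin K) :
    1 ≤ ν.var i / ν.gap i ^ 2 + 1 / ν.gap i := by
  have h1 : 1 ≤ 1 / ν.gap i := by
    rw [le_div_iff₀ (ν.gap_pos hK i)]; linarith [ν.gap_le_one hK i]
  have h2 : 0 ≤ ν.var i / ν.gap i ^ 2 := div_nonneg (ν.var_nonneg i) (sq_nonneg _)
  linarith

theorem two_le_complexity (hK : 2 ≤ K) (ν : BoundedInstance K) : 2 ≤ ν.complexity := by
  have h : ∑ _i : Fin K, (1 : ℝ) ≤ ν.complexity := by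
    refine Finset.sum_le_sum fun i _ => ?_
    have h1 := ν.one_le_hardness hK i
    have h2 := ν.loglog_gap_nonneg hK i
    nlinarith
  have hK' : (2 : ℝ) ≤ K := by exact_mod_cast hK
  simp at h
  linarith

end BoundedInstance

/-! ### The error probability of FC2FB -/

theorem fc2fb_ne_cases (𝒜 : ℝ → FCAlgorithm K) (B : ℕ) (δ₀ Q : ℝ) (j₀ b : Fin K)
    (ω : ℕ → Fin K → ℝ) {s : ℕ} (hs1 : 1 ≤ s) (hs : s ≤ numStages B Q)
    (h : fc2fb 𝒜 B δ₀ Q j₀ ω ≠ b) :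
    stageOutcome 𝒜 B δ₀ Q ω s = none ∨
      ∃ r, 1 ≤ r ∧ r ≤ s ∧ ∃ j, j ≠ b ∧ stageOutcome 𝒜 B δ₀ Q ω r = some j := by
  have hmem : s ∈ List.range' 1 (numStages B Q) := by
    rw [List.mem_range'_1]; omega
  unfold fc2fb at h
  cases hf : (List.range' 1 (numStages B Q)).findSome? (stageOutcome 𝒜 B δ₀ Q ω) with
  | none => exact Or.inl (List.findSome?_eq_none_iff.1 hf s hmem)
  | some j =>
    rw [hf] at h
    obtain ⟨l₁, r, l₂, hl, hr, hnone⟩ := List.findSome?_eq_some_iff.1 hf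
    by_cases hrs : r ≤ s
    · refine Or.inr ⟨r, ?_, hrs, j, h, hr⟩
      have : r ∈ List.range' 1 (numStages B Q) := by rw [hl]; simp
      rw [List.mem_range'_1] at this
      exact this.1
    · left
      have hsort : (List.range' 1 (numStages B Q)).Pairwise (· < ·) := List.pairwise_lt_range'
      rw [hl] at hmem hsort
      rcases List.mem_append.1 hmem with h1 | h1
      · exact hnone s h1
      · exfalso
        have h2 := (List.pairwise_append.1 hsort).2.1
        rw [List.pairwise_cons] at h2
        rcases List.mem_cons.1 h1 with h3 | h3
        · omega
        · have := h2.1 s h3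
          omega

theorem sum_exp_neg_two_pow_le (s N : ℕ) (hs : s ≤ N) :
    ∑ r ∈ Finset.Icc 1 s, Real.exp (-(2 : ℝ) ^ (N - r)) ≤ 2 * Real.exp (-(2 : ℝ) ^ (N - s)) := by
  induction s with
  | zero => simp; positivity
  | succ s ih =>
    rw [Finset.sum_Icc_succ_top (by omega)]
    have h1 := ih (by omega)
    have h2 : N - s = (N - (s + 1)) + 1 := by omega
    rw [h2, pow_succ] at h1
    set x : ℝ := 2 ^ (N - (s + 1)) with hx
    have hx1 : 1 ≤ x := one_le_pow₀ (by norm_num)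
    have h3 : Real.exp (-(x * 2)) ≤ Real.exp (-x) * (1 / 2) := by
      have : Real.exp (-(x * 2)) = Real.exp (-x) * Real.exp (-x) := by
        rw [← Real.exp_add]; ring_nf
      rw [this]
      refine mul_le_mul_of_nonneg_left ?_ (Real.exp_pos _).le
      calc Real.exp (-x) ≤ Real.exp (-1) := Real.exp_le_exp.2 (by linarith)
        _ ≤ 1 / 2 := by
          rw [Real.exp_neg, inv_eq_one_div]
          exact one_div_le_one_div_of_le (by norm_num) (by linarith [Real.add_one_le_exp 1])
    linarith

theorem log_one_div_exp_pow (n : ℕ) : Real.log (1 / Real.exp (-1) ^ 2 ^ n) = 2 ^ n := by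
  rw [one_div, Real.log_inv, Real.log_pow, Real.log_exp]
  push_cast
  ring

/-- Union bound over the stages up to a stage `s` whose budget exceeds the sample complexity of its
learner: FC2FB errs only if one of these stages stops with a wrong arm, or stage `s` does not stop.
The failure rates `exp (-2^(R-r))` decrease doubly exponentially from stage `s` backwards. -/
theorem measureReal_fc2fb_ne_le {c : ℝ} {𝒜 : ℝ → FCAlgorithm K} (h𝒜 : IsVDBestArmID c 𝒜)
    (hc : 0 < c) (hK : 2 ≤ K) (ν : BoundedInstance K) (B : ℕ) (j₀ : Fin K) {s : ℕ} (hs1 : 1 ≤ s)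
    (hs : s ≤ numStages B 1)
    (hbud : 2 * c * ν.complexity * 2 ^ (numStages B 1 - s) ≤ stageBudget B 1) :
    ν.rewardLaw.real {ω | fc2fb 𝒜 B (Real.exp (-1)) 1 j₀ ω ≠ ν.best} ≤
      3 * Real.exp (-(2 : ℝ) ^ (numStages B 1 - s)) := by
  set R := numStages B 1 with hR
  set B' := stageBudget B 1 with hB'
  set δ : ℕ → ℝ := fun r => Real.exp (-1) ^ 2 ^ (R - r) with hδ
  have hδe : ∀ r, δ r = Real.exp (-(2 : ℝ) ^ (R - r)) := fun r => by
    rw [hδ]; simp only; rw [← Real.exp_nat_mul]; congr 1; push_cast; ring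
  have hδ01 : ∀ r, δ r ∈ Set.Ioo (0 : ℝ) 1 := fun r => by
    rw [hδe]; exact ⟨Real.exp_pos _, by rw [Real.exp_lt_one_iff]; simp⟩
  set T : ℝ := c * ∑ i, (ν.var i / ν.gap i ^ 2 + 1 / ν.gap i) *
        (1 + Real.log (1 / δ s) + Real.log (1 + Real.log (1 / ν.gap i))) with hT
  have hTB : T ≤ B' := by
    refine le_trans ?_ hbud
    rw [hT, hδ, BoundedInstance.complexity]
    simp only [log_one_div_exp_pow]
    rw [show ∀ S x : ℝ, 2 * c * S * x = c * (S * (2 * x)) from fun S x => by ring, Finset.sum_mul]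
    refine mul_le_mul_of_nonneg_left (Finset.sum_le_sum fun i _ => ?_) hc.le
    have h1 := ν.one_le_hardness hK i
    have h2 := ν.loglog_gap_nonneg hK i
    have h3 : (1 : ℝ) ≤ 2 ^ (R - s) := one_le_pow₀ (by norm_num)
    rw [mul_assoc]
    refine mul_le_mul_of_nonneg_left ?_ (by linarith)
    nlinarith
  let E₀ : Set (ℕ → Fin K → ℝ) := {ω | stageOutcome 𝒜 B (Real.exp (-1)) 1 ω s = none}
  let E : ℕ → Set (ℕ → Fin K → ℝ) := fun r =>
    {ω | ∃ j, j ≠ ν.best ∧ stageOutcome 𝒜 B (Real.exp (-1)) 1 ω r = some j}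
  have hE₀ : ν.rewardLaw.real E₀ ≤ δ s := by
    refine le_trans (measureReal_mono (fun ω hω => ?_))
      ((ν.measureReal_shift_le ((s - 1) * B') _).trans (h𝒜 ν (δ s) (hδ01 s)).2)
    have h1 := (𝒜 (δ s)).lt_stoppingTime_of_outcome_eq_none _ (show _ = none from hω)
    have h2 : ENNReal.ofReal T ≤ ((B' : ℕ∞) : ℝ≥0∞) := by
      simpa using ENNReal.ofReal_le_ofReal hTB
    exact lt_of_le_of_lt h2 (by exact_mod_cast h1)
  have hE : ∀ r, ν.rewardLaw.real (E r) ≤ δ r := fun r => by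
    refine le_trans (measureReal_mono (fun ω hω => ?_))
      ((ν.measureReal_shift_le ((r - 1) * B') _).trans (h𝒜 ν (δ r) (hδ01 r)).1)
    obtain ⟨j, hj, hjr⟩ := hω
    have h1 := (𝒜 (δ r)).output_of_outcome_eq_some _ hjr
    have h2 := (𝒜 (δ r)).stoppingTime_le _ (n := B') (by
      rw [show (𝒜 (δ r)).outcome _ B' = some j from hjr]; simp)
    exact ⟨by rw [h1]; simpa using hj, lt_of_le_of_lt h2 (ENat.natCast_lt_top _)⟩
  have hsub : {ω | fc2fb 𝒜 B (Real.exp (-1)) 1 j₀ ω ≠ ν.best} ⊆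
      E₀ ∪ ⋃ r ∈ Finset.Icc 1 s, E r := by
    intro ω hω
    rcases fc2fb_ne_cases 𝒜 B _ 1 j₀ ν.best ω hs1 hs hω with h | ⟨r, h1, h2, h⟩
    · exact Or.inl h
    · exact Or.inr (Set.mem_iUnion₂.2 ⟨r, Finset.mem_Icc.2 ⟨h1, h2⟩, h⟩)
  calc ν.rewardLaw.real {ω | fc2fb 𝒜 B (Real.exp (-1)) 1 j₀ ω ≠ ν.best}
      ≤ ν.rewardLaw.real (E₀ ∪ ⋃ r ∈ Finset.Icc 1 s, E r) := measureReal_mono hsub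
    _ ≤ ν.rewardLaw.real E₀ + ν.rewardLaw.real (⋃ r ∈ Finset.Icc 1 s, E r) :=
        measureReal_union_le _ _
    _ ≤ δ s + ∑ r ∈ Finset.Icc 1 s, δ r := by
        refine add_le_add hE₀ ((measureReal_biUnion_finset_le _ _).trans ?_)
        exact Finset.sum_le_sum fun r _ => hE r
    _ ≤ _ := by
        simp only [hδe]
        have := sum_exp_neg_two_pow_le s R hs
        linarith

/-- With `A` a large multiple of the complexity and `B ≥ 2 A ln (4 A)`, some stage has enough budget
for its learner, and the first such stage `s` has a level with
`2^(R-s) ≥ B / (4 + 4 A ln B)`. -/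
theorem exists_stage {H c A : ℝ} (hc : 0 < c) (hH : 2 ≤ H) (hA : A = (4 * c + 10) * H) {B : ℕ}
    (hB : 2 * A * Real.log (4 * A) ≤ (B : ℝ)) :
    ∃ s, 1 ≤ s ∧ s ≤ numStages B 1 ∧ 2 * c * H * 2 ^ (numStages B 1 - s) ≤ stageBudget B 1 ∧
      (B : ℝ) / (4 + 4 * A * Real.log B) ≤ 2 ^ (numStages B 1 - s) := by
  have hA20 : 20 ≤ A := by rw [hA]; nlinarith
  have hcA : 2 * c * H ≤ A / 2 := by rw [hA]; nlinarith
  have hlog4A : 2 ≤ Real.log (4 * A) := by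
    rw [Real.le_log_iff_exp_le (by linarith)]
    have h1 := Real.exp_one_lt_d9
    have h2 : Real.exp 2 = Real.exp 1 * Real.exp 1 := by rw [← Real.exp_add]; norm_num
    have h3 := Real.exp_pos 1
    rw [h2]; nlinarith
  have hB80 : (80 : ℝ) ≤ B := by nlinarith
  have hB0 : (0 : ℝ) < B := by linarith
  have hlogB : 1 ≤ Real.log B := by
    rw [Real.le_log_iff_exp_le hB0]; linarith [Real.exp_one_lt_d9]
  -- `ln x ≤ x / y + ln y - 1` at `y = 2 A`
  have hkey : A * Real.log B ≤ B := by
    have h1 : Real.log (B / (2 * A)) ≤ B / (2 * A) - 1 := Real.log_le_sub_one_of_pos (by positivity)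
    rw [Real.log_div (by positivity) (by positivity)] at h1
    have h2 : Real.log (2 * A) ≤ Real.log (4 * A) := Real.log_le_log (by positivity) (by linarith)
    have h3 : Real.log (4 * A) ≤ B / (2 * A) := by
      rw [le_div_iff₀ (by positivity)]; linarith
    have h4 : Real.log B ≤ 2 * (B / (2 * A)) := by linarith
    have h5 : A * (2 * (B / (2 * A))) = B := by field_simp
    nlinarith
  set R := numStages B 1 with hR
  have hlogb0 : 0 ≤ Real.logb 2 (B / 1) := Real.logb_nonneg (by norm_num) (by linarith)
  have hRle : (R : ℝ) ≤ Real.logb 2 B := by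
    have := Nat.floor_le hlogb0; simpa [hR, numStages] using this
  have hRlt : Real.logb 2 B < R + 1 := by
    have := Nat.lt_floor_add_one (Real.logb 2 ((B : ℝ) / 1)); simpa [hR, numStages] using this
  have hlog2 := Real.log_two_gt_d9
  have hR1 : (R : ℝ) * 0.69 ≤ Real.log B := by
    rw [Real.logb, le_div_iff₀ (by linarith)] at hRle
    have : (0 : ℝ) ≤ R := Nat.cast_nonneg _
    nlinarith
  have hBpow : (B : ℝ) < 2 ^ (R + 1) := by
    have := (Real.logb_lt_iff_lt_rpow (by norm_num : (1 : ℝ) < 2) hB0).1 hRlt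
    exact_mod_cast this
  have hRone : 1 ≤ R := by
    by_contra h
    have : R = 0 := by omega
    rw [this, zero_add, pow_one] at hBpow; linarith
  have hRpos : (0 : ℝ) < R := by exact_mod_cast hRone
  have hbud : (B : ℝ) / R - 1 < stageBudget B 1 := by
    have h1 : B < R * (B / R) + R := by
      have := Nat.div_add_mod B R
      have := Nat.mod_lt B (by omega : R > 0)
      omega
    have h2 : (B : ℝ) < R * ((B / R : ℕ) : ℝ) + R := by exact_mod_cast h1
    rw [stageBudget, ← hR, sub_lt_iff_lt_add, div_lt_iff₀ hRpos]
    linarith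
  have hBR : 0.69 * (B / Real.log B) ≤ (B : ℝ) / R := by
    rw [← mul_div_assoc, div_le_div_iff₀ (by linarith) hRpos]
    nlinarith
  have hBA : A ≤ B / Real.log B := by rw [le_div_iff₀ (by linarith)]; exact hkey
  have hex : ∃ s, 1 ≤ s ∧ s ≤ R ∧ A / 2 * 2 ^ (R - s) ≤ stageBudget B 1 :=
    ⟨R, hRone, le_rfl, by simp; linarith⟩
  classical
  set s := Nat.find hex with hs
  obtain ⟨hs1, hsR, hsB⟩ := Nat.find_spec hex
  refine ⟨s, hs1, hsR, le_trans (mul_le_mul_of_nonneg_right hcA (by positivity)) hsB, ?_⟩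
  have hAl : 0 ≤ A * Real.log B := by nlinarith
  rcases Nat.eq_or_lt_of_le hs1 with h1 | h1
  · have h2 : R + 1 = (R - s) + 2 := by omega
    rw [h2, pow_add] at hBpow
    rw [div_le_iff₀ (by linarith)]
    have : (0 : ℝ) < 2 ^ (R - s) := by positivity
    nlinarith
  · have h2 := Nat.find_min hex (m := s - 1) (by omega)
    have h3 : ¬ (A / 2 * 2 ^ (R - (s - 1)) ≤ (stageBudget B 1 : ℝ)) := fun h =>
      h2 ⟨by omega, by omega, h⟩
    rw [show R - (s - 1) = (R - s) + 1 by omega, pow_succ, not_le] at h3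
    have h4 : (B : ℝ) / R - 1 < A * 2 ^ (R - s) := by linarith
    have h5 : (B : ℝ) / (4 * Real.log B) ≤ A * 2 ^ (R - s) := by
      have : (B : ℝ) / (4 * Real.log B) = B / Real.log B / 4 := by field_simp
      linarith
    calc (B : ℝ) / (4 + 4 * A * Real.log B) ≤ B / (4 * A * Real.log B) := by
          apply div_le_div_of_nonneg_left hB0.le (by nlinarith) (by linarith)
      _ = B / (4 * Real.log B) / A := by field_simp
      _ ≤ 2 ^ (R - s) := by rw [div_le_iff₀ (by linarith)]; linarith

/-! ### Learners that proceed in blocks -/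

/-- A learner described by an automaton. In a state `d` it either stops (`decision d = some j`) or
pulls the arms `arm d 0, …, arm d (len d - 1)` and then moves to a state that depends on the rewards
of this block only. -/
structure BlockMachine (K : ℕ) (D : Type*) [MeasurableSpace D] where
  decision : D → Option (Fin K)
  len : D → ℕ
  len_pos : ∀ d, 0 < len d
  arm : D → ℕ → Fin K
  trans : D → (ℕ → ℝ) → D
  measurable_trans : ∀ d, Measurable (trans d)
  trans_congr : ∀ d x y, (∀ k < len d, x k = y k) → trans d x = trans d y

namespace BlockMachine

variable {D : Type*} [MeasurableSpace D]

/-- The decision after `n` further pulls with rewards `y` of the machine started in state `d`; the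
first argument bounds the number of blocks that are replayed (`n + 1` suffices). -/
def replay (M : BlockMachine K D) : ℕ → D → ℕ → (ℕ → ℝ) → Decision K
  | 0, d, _, _ => .pull (M.arm d 0)
  | f + 1, d, n, y =>
    match M.decision d with
    | some j => .recommend j
    | none =>
      if M.len d ≤ n then replay M f (M.trans d y) (n - M.len d) (fun k => y (M.len d + k))
      else .pull (M.arm d n)

theorem measurable_replay [Countable D] [DiscreteMeasurableSpace D] (M : BlockMachine K D) (f : ℕ)
    (d : D) (n : ℕ) : Measurable (M.replay f d n) := by
  induction f generalizing d n with
  | zero => exact measurable_const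
  | succ f ih =>
    cases hd : M.decision d with
    | some j =>
      have : M.replay (f + 1) d n = fun _ => .recommend j := by funext y; simp [replay, hd]
      rw [this]; exact measurable_const
    | none =>
      by_cases h : M.len d ≤ n
      · have h0 : M.replay (f + 1) d n = fun y =>
            M.replay f (M.trans d y) (n - M.len d) (fun k => y (M.len d + k)) := by
          funext y; simp [replay, hd, h]
        rw [h0]
        have h1 : Measurable fun p : D × (ℕ → ℝ) => M.replay f p.1 (n - M.len d) p.2 :=
          measurable_from_prod_countable_right fun d' => ih d' _
        exact h1.comp ((M.measurable_trans d).prodMk (by fun_prop))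
      · have : M.replay (f + 1) d n = fun _ => .pull (M.arm d n) := by
          funext y; simp [replay, hd, h]
        rw [this]; exact measurable_const

theorem replay_congr (M : BlockMachine K D) (f : ℕ) (d : D) (n : ℕ) (x y : ℕ → ℝ)
    (h : ∀ k < n, x k = y k) : M.replay f d n x = M.replay f d n y := by
  induction f generalizing d n x y with
  | zero => rfl
  | succ f ih =>
    unfold replay
    cases M.decision d with
    | some j => rfl
    | none =>
      by_cases hn : M.len d ≤ n
      · simp only [hn, if_true]
        rw [M.trans_congr d x y fun k hk => h k (by omega)]
        exact ih _ _ _ _ fun k hk => h _ (by omega)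
      · simp only [hn, if_false]

theorem replay_fuel (M : BlockMachine K D) (f : ℕ) (d : D) (n : ℕ) (x : ℕ → ℝ) (hf : n < f) :
    M.replay f d n x = M.replay (n + 1) d n x := by
  induction f using Nat.strong_induction_on generalizing d n x with
  | _ f ih =>
    obtain ⟨f, rfl⟩ : ∃ g, f = g + 1 := ⟨f - 1, by omega⟩
    conv_lhs => unfold replay
    conv_rhs => unfold replay
    cases M.decision d with
    | some j => rfl
    | none =>
      by_cases hn : M.len d ≤ n
      · simp only [hn, if_true]
        have h1 := M.len_pos d
        rw [ih f (by omega) _ _ _ (by omega)]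
        exact (ih n (by omega) _ _ _ (by omega)).symm
      · simp only [hn, if_false]

/-- The rewards recorded in a history, padded by zeros. -/
def rewards {n : ℕ} (h : Fin n → Fin K × ℝ) (k : ℕ) : ℝ := if hk : k < n then (h ⟨k, hk⟩).2 else 0

theorem measurable_rewards {n : ℕ} : Measurable (rewards (K := K) (n := n)) := by
  refine measurable_pi_lambda _ fun k => ?_
  unfold rewards
  by_cases hk : k < n
  · simp only [hk, dite_true]; fun_prop
  · simp only [hk, dite_false]; exact measurable_const

/-- The learner that runs the machine from the state `d`. -/
def toFC [Countable D] [DiscreteMeasurableSpace D] (M : BlockMachine K D) (d : D) :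
    FCAlgorithm K where
  next n h := M.replay (n + 1) d n (rewards h)
  measurable_next _ := (M.measurable_replay _ _ _).comp measurable_rewards

/-- The rewards of a block in state `d`, as a function of the reward table. -/
def blockRewards (M : BlockMachine K D) (d : D) (ω : ℕ → Fin K → ℝ) (k : ℕ) : ℝ := ω k (M.arm d k)

/-- The recommendation of the machine started in state `d` and the number of pulls that it takes,
if it stops after at most `f` blocks. -/
def run (M : BlockMachine K D) : ℕ → D → (ℕ → Fin K → ℝ) → Option (Fin K × ℕ)
  | f, d, ω =>
    match M.decision d with
    | some j => some (j, 0)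
    | none =>
      match f with
      | 0 => none
      | f + 1 => (run M f (M.trans d (M.blockRewards d ω)) (fun t => ω (M.len d + t))).map
          fun p => (p.1, M.len d + p.2)

/-- The machine started in `d` stops within `n` pulls and recommends `b`. -/
def Succeeds (M : BlockMachine K D) (b : Fin K) (n : ℕ) (d : D) (ω : ℕ → Fin K → ℝ) : Prop :=
  ∃ f t, t ≤ n ∧ M.run f d ω = some (b, t)

theorem Succeeds.of_trans (M : BlockMachine K D) {b : Fin K} {n : ℕ} {d : D}
    {ω : ℕ → Fin K → ℝ} (hd : M.decision d = none) (hn : M.len d ≤ n)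
    (h : M.Succeeds b (n - M.len d) (M.trans d (M.blockRewards d ω)) fun t => ω (M.len d + t)) :
    M.Succeeds b n d ω := by
  obtain ⟨f, t, ht, h⟩ := h
  exact ⟨f + 1, M.len d + t, by omega, by simp [run, hd, h]⟩

/-- The state after a block is independent of the rewards after the block. -/
theorem indepFun_trans_shift (M : BlockMachine K D) (ν : BoundedInstance K) (d : D) :
    IndepFun (fun ω => M.trans d (M.blockRewards d ω))
      (fun (ω : ℕ → Fin K → ℝ) t => ω (M.len d + t)) ν.rewardLaw := by
  have hind : iIndepFun (fun (t : ℕ) (ω : ℕ → Fin K → ℝ) => ω t) ν.rewardLaw :=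
    iIndepFun_infinitePi (P := fun _ : ℕ => Measure.pi ν.law) (X := fun _ x => x) (by fun_prop)
  have hsup := indep_iSup_of_disjoint (fun t => (measurable_pi_apply t).comap_le) hind
    (S := {t | t < M.len d}) (T := {t | M.len d ≤ t})
    (Set.disjoint_left.2 fun t (h1 : t < _) (h2 : _ ≤ t) => absurd h1 (not_lt.2 h2))
  rw [IndepFun_iff_Indep]
  refine indep_of_indep_of_le_left (indep_of_indep_of_le_right hsup ?_) ?_
  · rw [← measurable_iff_comap_le]
    refine @measurable_pi_lambda _ _ _ (_) _ _ fun t => ?_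
    rw [measurable_iff_comap_le]
    exact le_iSup₂_of_le (M.len d + t) (Nat.le_add_right _ _) le_rfl
  · rw [← measurable_iff_comap_le]
    have h0 : (fun ω => M.trans d (M.blockRewards d ω)) =
        M.trans d ∘ fun ω k => if k < M.len d then ω k (M.arm d k) else 0 := by
      funext ω
      exact M.trans_congr _ _ _ fun k hk => by simp [blockRewards, hk]
    rw [h0]
    refine (M.measurable_trans d).comp ?_
    refine @measurable_pi_lambda _ _ _ (_) _ _ fun k => ?_
    by_cases hk : k < M.len d
    · simp only [hk, if_true]
      have h1 : Measurable[⨆ t ∈ {t | t < M.len d},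
          MeasurableSpace.comap (fun (ω : ℕ → Fin K → ℝ) => ω t) MeasurableSpace.pi]
          (fun ω : ℕ → Fin K → ℝ => ω k) := by
        rw [measurable_iff_comap_le]
        exact le_iSup₂_of_le k hk le_rfl
      exact (measurable_pi_apply _).comp h1
    · simp only [hk, if_false]; exact measurable_const

variable [Countable D] [DiscreteMeasurableSpace D]

/-- The reward recorded in step `t`. -/
def recorded (M : BlockMachine K D) (d₀ : D) (ω : ℕ → Fin K → ℝ) (t : ℕ) : ℝ :=
  ((M.toFC d₀).history ω (t + 1) (Fin.last t)).2

theorem rewards_history (M : BlockMachine K D) (d₀ : D) (ω : ℕ → Fin K → ℝ) (n k : ℕ)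
    (hk : k < n) : rewards ((M.toFC d₀).history ω n) k = M.recorded d₀ ω k := by
  induction n with
  | zero => omega
  | succ n ih =>
    rcases Nat.lt_succ_iff_lt_or_eq.1 hk with h | h
    · rw [← ih h]
      unfold rewards
      simp only [hk, h, dite_true, FCAlgorithm.history]
      have : (⟨k, hk⟩ : Fin (n + 1)) = Fin.castSucc ⟨k, h⟩ := rfl
      rw [this, Fin.snoc_castSucc]
    · subst h
      unfold rewards recorded
      simp only [hk, dite_true]
      rfl

theorem next_history (M : BlockMachine K D) (d₀ : D) (ω : ℕ → Fin K → ℝ) (n : ℕ) :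
    (M.toFC d₀).next n ((M.toFC d₀).history ω n) = M.replay (n + 1) d₀ n (M.recorded d₀ ω) :=
  M.replay_congr _ _ _ _ _ fun k hk => M.rewards_history d₀ ω n k hk

theorem recorded_of_pull (M : BlockMachine K D) (d₀ : D) (ω : ℕ → Fin K → ℝ) (n : ℕ) {i : Fin K}
    (h : M.replay (n + 1) d₀ n (M.recorded d₀ ω) = .pull i) : M.recorded d₀ ω n = ω n i := by
  rw [← next_history] at h
  unfold recorded
  simp only [FCAlgorithm.history, Fin.snoc_last, h]

/-- If, from time `s` on, the learner acts as the machine does in state `d`, then it follows the run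
of the machine on the rewards from time `s` on. -/
theorem replay_of_run (M : BlockMachine K D) (d₀ : D) (ω : ℕ → Fin K → ℝ) (f : ℕ) (d : D) (s : ℕ)
    (hs : ∀ n, M.replay (s + n + 1) d₀ (s + n) (M.recorded d₀ ω) =
      M.replay (n + 1) d n (fun k => M.recorded d₀ ω (s + k)))
    {j : Fin K} {t : ℕ} (h : M.run f d (fun k => ω (s + k)) = some (j, t)) :
    M.replay (s + t + 1) d₀ (s + t) (M.recorded d₀ ω) = .recommend j ∧
    ∀ n < t, ∃ i, M.replay (s + n + 1) d₀ (s + n) (M.recorded d₀ ω) = .pull i := by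
  induction f generalizing d s t with
  | zero =>
    unfold run at h
    cases hd : M.decision d with
    | none => simp [hd] at h
    | some i =>
      simp only [hd, Option.some.injEq, Prod.mk.injEq] at h
      obtain ⟨rfl, rfl⟩ := h
      refine ⟨?_, fun n hn => by omega⟩
      exact (hs 0).trans (by simp [replay, hd])
  | succ f ih =>
    unfold run at h
    cases hd : M.decision d with
    | some i =>
      simp only [hd, Option.some.injEq, Prod.mk.injEq] at h
      obtain ⟨rfl, rfl⟩ := h
      refine ⟨?_, fun n hn => by omega⟩
      exact (hs 0).trans (by simp [replay, hd])
    | none =>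
      simp only [hd, Option.map_eq_some_iff] at h
      obtain ⟨⟨j', t'⟩, h, he⟩ := h
      simp only [Prod.mk.injEq] at he
      obtain ⟨rfl, rfl⟩ := he
      have hpull : ∀ n < M.len d,
          M.replay (s + n + 1) d₀ (s + n) (M.recorded d₀ ω) = .pull (M.arm d n) := fun n hn => by
        rw [hs]; unfold replay; simp only [hd, not_le.2 hn, if_false]
      have htr : M.trans d (fun k => M.recorded d₀ ω (s + k)) =
          M.trans d (M.blockRewards d fun k => ω (s + k)) :=
        M.trans_congr _ _ _ fun k hk => M.recorded_of_pull d₀ ω _ (hpull k hk)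
      have := ih (M.trans d (M.blockRewards d fun k => ω (s + k))) (s + M.len d) (t := t')
        (fun n => ?_) (by simpa only [add_assoc] using h)
      · refine ⟨by simpa only [add_assoc] using this.1, fun n hn => ?_⟩
        by_cases hnl : n < M.len d
        · exact ⟨_, hpull n hnl⟩
        · obtain ⟨i, hi⟩ := this.2 (n - M.len d) (by omega)
          refine ⟨i, ?_⟩
          rwa [show s + M.len d + (n - M.len d) = s + n by omega] at hi
      · have h1 := hs (M.len d + n)
        rw [← add_assoc] at h1
        rw [h1]
        conv_lhs => unfold replay
        have h2 := M.len_pos d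
        simp only [hd, Nat.le_add_right, if_true, Nat.add_sub_cancel_left, htr]
        rw [M.replay_fuel _ _ _ _ (by omega)]
        simp only [add_assoc]

theorem outcome_of_run (M : BlockMachine K D) (d₀ : D) (ω : ℕ → Fin K → ℝ) {f : ℕ} {j : Fin K}
    {t : ℕ} (h : M.run f d₀ ω = some (j, t)) : (M.toFC d₀).outcome ω t = some j := by
  have key := M.replay_of_run d₀ ω f d₀ 0 (fun n => by simp) (by simpa using h)
  simp only [zero_add, ← next_history] at key
  have hnone : ∀ n, (∀ m < n, ∃ i, (M.toFC d₀).next m ((M.toFC d₀).history ω m) = .pull i) →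
      (M.toFC d₀).outcome ω n = ((M.toFC d₀).next n ((M.toFC d₀).history ω n)).recommended := by
    intro n
    induction n with
    | zero => intro _; rfl
    | succ n ih =>
      intro hn
      have h1 := ih fun m hm => hn m (by omega)
      obtain ⟨i, hi⟩ := hn n (by omega)
      rw [hi] at h1
      simp [FCAlgorithm.outcome, h1, Decision.recommended]
  rw [hnone t key.2, key.1]
  rfl

/-! ### The failure probability of a machine -/

theorem measurable_run (M : BlockMachine K D) (f : ℕ) (d : D) :
    Measurable[_, ⊤] (M.run f d) := by
  let _ : MeasurableSpace (Option (Fin K × ℕ)) := ⊤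
  induction f generalizing d with
  | zero =>
    cases hd : M.decision d with
    | some j =>
      have : M.run 0 d = fun _ => some (j, 0) := by funext ω; simp [run, hd]
      rw [this]; exact measurable_const
    | none =>
      have : M.run 0 d = fun _ => none := by funext ω; simp [run, hd]
      rw [this]; exact measurable_const
  | succ f ih =>
    cases hd : M.decision d with
    | some j =>
      have : M.run (f + 1) d = fun _ => some (j, 0) := by funext ω; simp [run, hd]
      rw [this]; exact measurable_const
    | none =>
      have h0 : M.run (f + 1) d = fun ω => (M.run f (M.trans d (M.blockRewards d ω))
          (fun t => ω (M.len d + t))).map fun p => (p.1, M.len d + p.2) := by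
        funext ω; simp [run, hd]
      have h1 : Measurable fun p : D × (ℕ → Fin K → ℝ) => M.run f p.1 p.2 :=
        measurable_from_prod_countable_right fun d' => ih d'
      have h2 : Measurable fun ω => (M.trans d (M.blockRewards d ω),
          (fun t => ω (M.len d + t) : ℕ → Fin K → ℝ)) := by
        refine Measurable.prodMk ((M.measurable_trans d).comp ?_) (by fun_prop)
        exact measurable_pi_lambda _ fun k => by unfold blockRewards; fun_prop
      rw [h0]
      exact (measurable_from_top (f := Option.map fun p : Fin K × ℕ => (p.1, M.len d + p.2))).comp
        (h1.comp h2)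

theorem measurableSet_succeeds (M : BlockMachine K D) (b : Fin K) (n : ℕ) (d : D) :
    MeasurableSet {ω | M.Succeeds b n d ω} := by
  have : {ω | M.Succeeds b n d ω} =
      ⋃ (f : ℕ) (t : ℕ) (_ : t ≤ n), M.run f d ⁻¹' {some (b, t)} := by
    ext ω; simp [Succeeds]
  rw [this]
  let _ : MeasurableSpace (Option (Fin K × ℕ)) := ⊤
  exact .iUnion fun f => .iUnion fun t => .iUnion fun _ => M.measurable_run f d (by trivial)

/-- Analysis of a machine by two potentials: along transitions that keep the invariant `Inv`, the
time potential `pot` pays for the pulls; the failure potential `fail` pays for the probability that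
a transition breaks this. No further probabilistic argument about the adaptive run is needed, because
the rewards of a block are fresh. -/
theorem measureReal_not_succeeds_le (M : BlockMachine K D) (ν : BoundedInstance K) (b : Fin K)
    (Inv : D → Prop) (pot fail : D → ℝ)
    (hpot : ∀ d, Inv d → 0 ≤ pot d) (hfail : ∀ d, Inv d → 0 ≤ fail d)
    (hdecision : ∀ d, Inv d → ∀ j, M.decision d = some j → j = b)
    (hstep : ∀ d, Inv d → M.decision d = none → ∃ (G : Set D) (ε : ℝ), 0 ≤ ε ∧ ε ≤ fail d ∧
      ν.rewardLaw.real {ω | M.trans d (M.blockRewards d ω) ∉ G} ≤ ε ∧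
      ∀ d' ∈ G, Inv d' ∧ M.len d + pot d' ≤ pot d ∧ fail d' + ε ≤ fail d)
    (d : D) (hd : Inv d) :
    ν.rewardLaw.real {ω | ¬ M.Succeeds b ⌊pot d⌋₊ d ω} ≤ fail d := by
  suffices H : ∀ N d, Inv d → ⌊pot d⌋₊ ≤ N →
      ν.rewardLaw.real {ω | ¬ M.Succeeds b ⌊pot d⌋₊ d ω} ≤ fail d from H _ d hd le_rfl
  intro N
  induction N using Nat.strong_induction_on with
  | _ N ih =>
  intro d hd hN
  cases hdec : M.decision d with
  | some j =>
    have hj := hdecision d hd j hdec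
    have : {ω | ¬ M.Succeeds b ⌊pot d⌋₊ d ω} = ∅ := by
      ext ω
      simp only [Set.mem_ofPred_eq, Set.mem_empty_iff_false, iff_false, not_not]
      exact ⟨0, 0, Nat.zero_le _, by simp [run, hdec, hj]⟩
    rw [this]
    simpa using hfail d hd
  | none =>
    obtain ⟨G, ε, hε0, hεf, hGε, hG⟩ := hstep d hd hdec
    classical
    set X : (ℕ → Fin K → ℝ) → D := fun ω => M.trans d (M.blockRewards d ω) with hX
    set sh : (ℕ → Fin K → ℝ) → (ℕ → Fin K → ℝ) := fun ω t => ω (M.len d + t) with hsh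
    have hXm : Measurable X := (M.measurable_trans d).comp
      (measurable_pi_lambda _ fun k => by unfold blockRewards; fun_prop)
    let bad : D → Set (ℕ → Fin K → ℝ) := fun d' =>
      if d' ∈ G then {ω | ¬ M.Succeeds b ⌊pot d'⌋₊ d' ω} else ∅
    have hbadm : ∀ d', MeasurableSet (bad d') := fun d' => by
      by_cases h : d' ∈ G
      · simp only [bad, h, if_true]; exact (M.measurableSet_succeeds b _ d').compl
      · simp only [bad, h, if_false]; exact .empty
    have hfloor : ∀ d' ∈ G, ⌊pot d'⌋₊ + M.len d ≤ ⌊pot d⌋₊ := fun d' hd' => by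
      obtain ⟨h1, h2, -⟩ := hG d' hd'
      have h3 := hpot d' h1
      refine Nat.le_floor ?_
      push_cast
      linarith [Nat.floor_le h3]
    have hbad : ∀ d', ν.rewardLaw (bad d') ≤ ENNReal.ofReal (fail d - ε) := fun d' => by
      by_cases h : d' ∈ G
      · simp only [bad, h, if_true]
        have h1 := ih ⌊pot d'⌋₊ (by have := hfloor d' h; have := M.len_pos d; omega) d'
          (hG d' h).1 le_rfl
        rw [← ENNReal.ofReal_toReal (measure_ne_top ν.rewardLaw _)]
        refine ENNReal.ofReal_le_ofReal (le_trans h1 ?_)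
        linarith [(hG d' h).2.2]
      · simp [bad, h]
    have hsub : {ω | ¬ M.Succeeds b ⌊pot d⌋₊ d ω} ⊆
        {ω | X ω ∉ G} ∪ ⋃ d', X ⁻¹' {d'} ∩ sh ⁻¹' (bad d') := by
      intro ω hω
      by_cases hXG : X ω ∈ G
      · right
        refine Set.mem_iUnion.2 ⟨X ω, rfl, ?_⟩
        simp only [Set.mem_preimage, bad, hXG, if_true, Set.mem_ofPred_eq]
        intro hsucc
        refine hω (Succeeds.of_trans M hdec (by have := hfloor _ hXG; omega) ?_)
        obtain ⟨f, t, ht, h⟩ := hsucc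
        exact ⟨f, t, by have := hfloor _ hXG; omega, h⟩
      · exact Or.inl hXG
    have hind := M.indepFun_trans_shift ν d
    have hsum : ν.rewardLaw (⋃ d', X ⁻¹' {d'} ∩ sh ⁻¹' (bad d')) ≤ ENNReal.ofReal (fail d - ε) :=
      calc ν.rewardLaw (⋃ d', X ⁻¹' {d'} ∩ sh ⁻¹' (bad d'))
          ≤ ∑' d', ν.rewardLaw (X ⁻¹' {d'} ∩ sh ⁻¹' (bad d')) := measure_iUnion_le _
        _ = ∑' d', ν.rewardLaw (X ⁻¹' {d'}) * ν.rewardLaw (bad d') := by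
            refine tsum_congr fun d' => ?_
            rw [hind.measure_inter_preimage_eq_mul _ _ (measurableSet_singleton d') (hbadm d'),
              (ν.measurePreserving_shift (M.len d)).measure_preimage (hbadm d').nullMeasurableSet]
        _ ≤ ∑' d', ν.rewardLaw (X ⁻¹' {d'}) * ENNReal.ofReal (fail d - ε) :=
            ENNReal.tsum_le_tsum fun d' => by gcongr; exact hbad d'
        _ = (∑' d', ν.rewardLaw (X ⁻¹' {d'})) * ENNReal.ofReal (fail d - ε) :=
            ENNReal.tsum_mul_right
        _ ≤ 1 * ENNReal.ofReal (fail d - ε) := by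
            gcongr
            refine (tsum_meas_le_meas_iUnion_of_disjoint ν.rewardLaw
              (fun d' => hXm (measurableSet_singleton d')) fun a b hab => ?_).trans prob_le_one
            exact Set.disjoint_left.2 fun ω h1 h2 => hab (h1.symm.trans h2)
        _ = _ := one_mul _
    have hsum' : ν.rewardLaw.real (⋃ d', X ⁻¹' {d'} ∩ sh ⁻¹' (bad d')) ≤ fail d - ε :=
      ENNReal.toReal_le_of_le_ofReal (by linarith) hsum
    calc ν.rewardLaw.real {ω | ¬ M.Succeeds b ⌊pot d⌋₊ d ω}
        ≤ _ := measureReal_mono hsub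
      _ ≤ _ := measureReal_union_le _ _
      _ ≤ ε + (fail d - ε) := add_le_add hGε hsum'
      _ = fail d := by ring

/-- A successful run makes the learner correct and fast. -/
theorem guarantees (M : BlockMachine K D) (ν : BoundedInstance K) (d : D) {T δ : ℝ} {n : ℕ}
    (hn : (n : ℝ) ≤ T) (h : ν.rewardLaw.real {ω | ¬ M.Succeeds ν.best n d ω} ≤ δ) :
    IsCorrect ν (M.toFC d) δ ∧ HasSampleComplexity ν (M.toFC d) T δ := by
  constructor
  · refine le_trans (measureReal_mono fun ω hω => ?_) h
    rintro ⟨f, t, -, hr⟩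
    exact hω.1 ((M.toFC d).output_of_outcome_eq_some ω (M.outcome_of_run d ω hr))
  · refine le_trans (measureReal_mono fun ω hω => ?_) h
    rintro ⟨f, t, ht, hr⟩
    have h1 := (M.toFC d).stoppingTime_le ω (n := t) (by rw [M.outcome_of_run d ω hr]; simp)
    have h2 : (((M.toFC d).stoppingTime ω : ℕ∞) : ℝ≥0∞) ≤ ((t : ℕ∞) : ℝ≥0∞) := by
      exact_mod_cast h1
    have h3 : ((t : ℕ∞) : ℝ≥0∞) ≤ ENNReal.ofReal T := by
      have : (t : ℝ) ≤ T := le_trans (by exact_mod_cast ht) hn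
      simpa using ENNReal.ofReal_le_ofReal this
    exact absurd (lt_of_lt_of_le hω (h2.trans h3)) (lt_irrefl _)

end BlockMachine

/-! ### Concentration inequalities -/

section Concentration

variable {Ω ι : Type*} [MeasurableSpace Ω] {P : Measure Ω}

theorem ae_sum_mem_Icc {Y : ι → Ω → ℝ} (h01 : ∀ k, ∀ᵐ ω ∂P, Y k ω ∈ Set.Icc (0 : ℝ) 1)
    (I : Finset ι) : ∀ᵐ ω ∂P, (∑ k ∈ I, Y k) ω ∈ Set.Icc (0 : ℝ) I.card := by
  have : ∀ᵐ ω ∂P, ∀ k ∈ I, Y k ω ∈ Set.Icc (0 : ℝ) 1 :=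
    (Filter.eventually_all_finset I).2 fun k _ => h01 k
  filter_upwards [this] with ω hω
  rw [Finset.sum_apply]
  refine ⟨Finset.sum_nonneg fun k hk => (hω k hk).1, ?_⟩
  simpa using Finset.sum_le_card_nsmul I (fun k => Y k ω) 1 fun k hk => (hω k hk).2

variable [IsProbabilityMeasure P]

theorem mgf_le_of_mem_Icc {Y : Ω → ℝ} (hY : Measurable Y) (h01 : ∀ᵐ ω ∂P, Y ω ∈ Set.Icc (0 : ℝ) 1)
    (t : ℝ) : mgf Y P t ≤ Real.exp ((Real.exp t - 1) * ∫ ω, Y ω ∂P) := by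
  have hint : Integrable Y P := Integrable.of_mem_Icc 0 1 hY.aemeasurable h01
  have hconv : ∀ᵐ ω ∂P, Real.exp (t * Y ω) ≤ 1 + (Real.exp t - 1) * Y ω := by
    filter_upwards [h01] with ω hω
    have := convexOn_exp.2 (Set.mem_univ t) (Set.mem_univ 0) hω.1 (sub_nonneg.2 hω.2) (by ring)
    simp only [smul_eq_mul, mul_zero, add_zero, Real.exp_zero, mul_one] at this
    rw [mul_comm t]
    linarith
  calc mgf Y P t ≤ ∫ ω, (1 + (Real.exp t - 1) * Y ω) ∂P := by
        refine integral_mono_of_nonneg (ae_of_all _ fun ω => (Real.exp_pos _).le) ?_ hconv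
        exact (integrable_const _).add (hint.const_mul _)
    _ = 1 + (Real.exp t - 1) * ∫ ω, Y ω ∂P := by
        rw [integral_add (integrable_const _) (hint.const_mul _), integral_const_mul]; simp
    _ ≤ _ := by linarith [Real.add_one_le_exp ((Real.exp t - 1) * ∫ ω, Y ω ∂P)]

theorem integrable_exp_mul_of_mem_Icc {Y : Ω → ℝ} {a b : ℝ} (hY : Measurable Y)
    (h : ∀ᵐ ω ∂P, Y ω ∈ Set.Icc a b) (t : ℝ) : Integrable (fun ω => Real.exp (t * Y ω)) P := by
  have hm : AEMeasurable (fun ω => Real.exp (t * Y ω)) P := by fun_prop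
  refine Integrable.of_mem_Icc 0 (Real.exp (|t| * (|a| + |b|))) hm ?_
  filter_upwards [h] with ω hω
  refine ⟨(Real.exp_pos _).le, Real.exp_le_exp.2 ?_⟩
  calc t * Y ω ≤ |t * Y ω| := le_abs_self _
    _ = |t| * |Y ω| := abs_mul _ _
    _ ≤ _ := by
      refine mul_le_mul_of_nonneg_left ?_ (abs_nonneg t)
      rw [abs_le]
      constructor
      · linarith [neg_abs_le a, hω.1, abs_nonneg b]
      · linarith [le_abs_self b, hω.2, abs_nonneg a]

theorem mgf_sum_le_of_mem_Icc {Y : ι → Ω → ℝ} (hind : iIndepFun Y P) (hY : ∀ k, Measurable (Y k))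
    (h01 : ∀ k, ∀ᵐ ω ∂P, Y k ω ∈ Set.Icc (0 : ℝ) 1) (I : Finset ι) {m : ℝ}
    (hm : ∀ k ∈ I, ∫ ω, Y k ω ∂P = m) (t : ℝ) :
    mgf (∑ k ∈ I, Y k) P t ≤ Real.exp ((Real.exp t - 1) * (I.card * m)) := by
  rw [hind.mgf_sum hY]
  calc ∏ k ∈ I, mgf (Y k) P t ≤ ∏ _k ∈ I, Real.exp ((Real.exp t - 1) * m) := by
        refine Finset.prod_le_prod (fun k _ => mgf_nonneg) fun k hk => ?_
        rw [← hm k hk]; exact mgf_le_of_mem_Icc (hY k) (h01 k) t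
    _ = _ := by
        rw [Finset.prod_const, ← Real.exp_nat_mul]; congr 1; ring

theorem exp_two_sub_one_le : Real.exp 2 - 1 ≤ 8 := by
  have h1 := Real.exp_one_lt_d9
  have h2 : Real.exp 2 = Real.exp 1 * Real.exp 1 := by rw [← Real.exp_add]; norm_num
  have h3 := Real.exp_pos 1
  rw [h2]; nlinarith

theorem exp_neg_one_sub_one_le : Real.exp (-1) - 1 ≤ -(1 / 2) := by
  have h1 := Real.exp_one_gt_d9
  have : Real.exp (-1) ≤ 1 / 2 := by
    rw [Real.exp_neg, inv_eq_one_div]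
    exact one_div_le_one_div_of_le (by norm_num) (by linarith)
  linarith

/-- Multiplicative Chernoff bound for the lower tail. -/
theorem measureReal_sum_le_le {Y : ι → Ω → ℝ} (hind : iIndepFun Y P) (hY : ∀ k, Measurable (Y k))
    (h01 : ∀ k, ∀ᵐ ω ∂P, Y k ω ∈ Set.Icc (0 : ℝ) 1) (I : Finset ι) {m : ℝ} (hm0 : 0 ≤ m)
    (hm : ∀ k ∈ I, ∫ ω, Y k ω ∂P = m) (a : ℝ) :
    P.real {ω | ∑ k ∈ I, Y k ω ≤ a} ≤ Real.exp (a - I.card * m / 2) := by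
  have hYs : Measurable (∑ k ∈ I, Y k) := by
    rw [show ∑ k ∈ I, Y k = fun ω => ∑ k ∈ I, Y k ω from funext fun ω => Finset.sum_apply _ _ _]
    exact Finset.measurable_sum _ fun k _ => hY k
  have h1 := measure_le_le_exp_mul_mgf (μ := P) (X := ∑ k ∈ I, Y k) (t := -1) a (by norm_num)
    (integrable_exp_mul_of_mem_Icc hYs (ae_sum_mem_Icc h01 I) _)
  simp only [Finset.sum_apply] at h1
  refine h1.trans ?_
  have h2 := mgf_sum_le_of_mem_Icc hind hY h01 I hm (-1)
  calc _ ≤ Real.exp (- -1 * a) * Real.exp ((Real.exp (-1) - 1) * (I.card * m)) := by gcongr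
    _ = Real.exp (a + (Real.exp (-1) - 1) * (I.card * m)) := by rw [← Real.exp_add]; congr 1; ring
    _ ≤ _ := by
        refine Real.exp_le_exp.2 ?_
        have : (0 : ℝ) ≤ I.card * m := by positivity
        nlinarith [exp_neg_one_sub_one_le]

/-- Bound on the Laplace transform of a centred `[0, 1]`-valued variable by its variance. -/
theorem mgf_centered_le {X : Ω → ℝ} (hX : Measurable X) (h01 : ∀ᵐ ω ∂P, X ω ∈ Set.Icc (0 : ℝ) 1)
    {t : ℝ} (ht : |t| ≤ 1) :
    mgf (fun ω => X ω - ∫ ω, X ω ∂P) P t ≤ Real.exp (t ^ 2 * Var[X; P]) := by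
  set m := ∫ ω, X ω ∂P with hm
  have hint : Integrable X P := Integrable.of_mem_Icc 0 1 hX.aemeasurable h01
  have hm0 : 0 ≤ m := integral_nonneg_of_ae (h01.mono fun _ h => h.1)
  have hm1 : m ≤ 1 := by
    have := integral_mono_ae hint (integrable_const (1 : ℝ)) (h01.mono fun _ h => h.2)
    simpa using this
  have hc : ∀ᵐ ω ∂P, |X ω - m| ≤ 1 := h01.mono fun ω h => by
    rw [abs_le]; constructor <;> linarith [h.1, h.2]
  have hint1 : Integrable (fun ω => X ω - m) P := hint.sub (integrable_const _)
  have hint2 : Integrable (fun ω => (X ω - m) ^ 2) P := by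
    refine Integrable.of_mem_Icc 0 1 (by fun_prop) (hc.mono fun ω h => ⟨sq_nonneg _, ?_⟩)
    rw [← sq_abs]; exact pow_le_one₀ (abs_nonneg _) h
  have hexp : ∀ᵐ ω ∂P, Real.exp (t * (X ω - m)) ≤
      1 + t * (X ω - m) + t ^ 2 * (X ω - m) ^ 2 := by
    filter_upwards [hc] with ω h
    have habs : |t * (X ω - m)| ≤ 1 := by
      rw [abs_mul]; exact mul_le_one₀ ht (abs_nonneg _) h
    have := (abs_le.1 (Real.abs_exp_sub_one_sub_id_le habs)).2
    nlinarith
  calc mgf (fun ω => X ω - m) P t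
      ≤ ∫ ω, (1 + t * (X ω - m) + t ^ 2 * (X ω - m) ^ 2) ∂P := by
        refine integral_mono_of_nonneg (ae_of_all _ fun ω => (Real.exp_pos _).le) ?_ hexp
        exact ((integrable_const _).add (hint1.const_mul _)).add (hint2.const_mul _)
    _ = 1 + t ^ 2 * Var[X; P] := by
        have hint3 : Integrable (fun ω => 1 + t * (X ω - m)) P :=
          (integrable_const _).add (hint1.const_mul _)
        rw [integral_add hint3 (hint2.const_mul _),
          integral_add (integrable_const _) (hint1.const_mul _), integral_const_mul,
          integral_const_mul, integral_sub hint (integrable_const _),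
          variance_eq_integral hX.aemeasurable]
        simp [← hm]
    _ ≤ _ := by linarith [Real.add_one_le_exp (t ^ 2 * Var[X; P])]

/-- One-sided Bernstein inequality; `s = 1` gives the upper and `s = -1` the lower tail. -/
theorem measureReal_bernstein_aux {X : ι → Ω → ℝ} (hind : iIndepFun X P)
    (hX : ∀ k, Measurable (X k)) (h01 : ∀ k, ∀ᵐ ω ∂P, X k ω ∈ Set.Icc (0 : ℝ) 1) (I : Finset ι)
    {m v : ℝ} (hm : ∀ k ∈ I, ∫ ω, X k ω ∂P = m) (hv : ∀ k ∈ I, Var[X k; P] = v) (hv0 : 0 ≤ v)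
    {ε : ℝ} (hε : 0 < ε) {s : ℝ} (hs : |s| = 1) :
    P.real {ω | I.card * ε ≤ s * (∑ k ∈ I, X k ω - I.card * m)} ≤
      Real.exp (-(I.card * ε ^ 2 / (4 * (v + ε)))) := by
  classical
  set l : ℝ := ε / (2 * (v + ε)) with hl
  have hve : 0 < v + ε := by linarith
  have hl0 : 0 ≤ l := by positivity
  have hl1 : l ≤ 1 := by rw [hl, div_le_one (by positivity)]; linarith
  have hs2 : s ^ 2 = 1 := by rw [← sq_abs, hs]; norm_num
  let Z : ι → Ω → ℝ := fun k ω => X k ω - ∫ ω, X k ω ∂P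
  have hZm : ∀ k, Measurable (Z k) := fun k => (hX k).sub_const _
  have hZind : iIndepFun Z P :=
    hind.comp (fun k x => x - ∫ ω, X k ω ∂P) fun k => measurable_id.sub_const _
  have hsum : ∀ ω, (∑ k ∈ I, Z k) ω = ∑ k ∈ I, X k ω - I.card * m := fun ω => by
    simp only [Z, Finset.sum_apply, Finset.sum_sub_distrib, Finset.sum_congr rfl hm,
      Finset.sum_const, nsmul_eq_mul]
  have hZs : Measurable (∑ k ∈ I, Z k) := by
    rw [show ∑ k ∈ I, Z k = fun ω => ∑ k ∈ I, Z k ω from funext fun ω => Finset.sum_apply _ _ _]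
    exact Finset.measurable_sum _ fun k _ => hZm k
  have hbdd : ∀ᵐ ω ∂P, (s * (∑ k ∈ I, Z k) ω) ∈
      Set.Icc (-(I.card + |(I.card : ℝ) * m|)) (I.card + |(I.card : ℝ) * m|) := by
    filter_upwards [ae_sum_mem_Icc h01 I] with ω hω
    rw [Finset.sum_apply] at hω
    rw [hsum ω, Set.mem_Icc, ← abs_le, abs_mul, hs, one_mul]
    refine (abs_sub _ _).trans ?_
    gcongr
    rw [abs_of_nonneg hω.1]; exact hω.2
  have h1 := measure_ge_le_exp_mul_mgf (μ := P) (X := fun ω => s * (∑ k ∈ I, Z k) ω) (t := l)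
    (I.card * ε) hl0 (integrable_exp_mul_of_mem_Icc (hZs.const_mul s) hbdd l)
  have h2 : mgf (fun ω => s * (∑ k ∈ I, Z k) ω) P l ≤ Real.exp (I.card * (l ^ 2 * v)) := by
    rw [mgf_const_mul, hZind.mgf_sum hZm]
    calc ∏ k ∈ I, mgf (Z k) P (s * l) ≤ ∏ _k ∈ I, Real.exp (l ^ 2 * v) := by
          refine Finset.prod_le_prod (fun k _ => mgf_nonneg) fun k hk => ?_
          have := mgf_centered_le (hX k) (h01 k) (t := s * l)
            (by rw [abs_mul, hs, one_mul, abs_of_nonneg hl0]; exact hl1)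
          rwa [hv k hk, mul_pow, hs2, one_mul] at this
      _ = _ := by rw [Finset.prod_const, ← Real.exp_nat_mul]
  simp only [hsum] at h1 h2
  refine h1.trans ?_
  calc _ ≤ Real.exp (-l * (I.card * ε)) * Real.exp (I.card * (l ^ 2 * v)) := by gcongr
    _ = Real.exp (-l * (I.card * ε) + I.card * (l ^ 2 * v)) := (Real.exp_add _ _).symm
    _ ≤ _ := by
        refine Real.exp_le_exp.2 ?_
        have h3 : l * v ≤ ε / 2 := by
          rw [hl, div_mul_eq_mul_div, div_le_div_iff₀ (by positivity) (by norm_num)]; nlinarith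
        have h4 : (I.card : ℝ) * ε ^ 2 / (4 * (v + ε)) = I.card * (l * ε / 2) := by
          rw [hl]; field_simp; ring
        rw [h4]
        have h5 : l * (l * v) ≤ l * (ε / 2) := mul_le_mul_of_nonneg_left h3 hl0
        have h6 : (0 : ℝ) ≤ I.card := Nat.cast_nonneg _
        nlinarith [mul_le_mul_of_nonneg_left h5 h6]

/-- Bernstein's inequality for the empirical mean of `[0, 1]`-valued variables. -/
theorem measureReal_bernstein {X : ι → Ω → ℝ} (hind : iIndepFun X P)
    (hX : ∀ k, Measurable (X k)) (h01 : ∀ k, ∀ᵐ ω ∂P, X k ω ∈ Set.Icc (0 : ℝ) 1) (I : Finset ι)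
    {m v : ℝ} (hm : ∀ k ∈ I, ∫ ω, X k ω ∂P = m) (hv : ∀ k ∈ I, Var[X k; P] = v) (hv0 : 0 ≤ v)
    {ε : ℝ} (hε : 0 < ε) :
    P.real {ω | I.card * ε < |∑ k ∈ I, X k ω - I.card * m|} ≤
      2 * Real.exp (-(I.card * ε ^ 2 / (4 * (v + ε)))) := by
  have h1 := measureReal_bernstein_aux hind hX h01 I hm hv hv0 hε (s := 1) (by simp)
  have h2 := measureReal_bernstein_aux hind hX h01 I hm hv hv0 hε (s := -1) (by simp)
  rw [two_mul]
  refine le_trans (measureReal_mono ?_) ((measureReal_union_le _ _).trans (add_le_add h1 h2))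
  intro ω hω
  simp only [Set.mem_union, Set.mem_ofPred_eq] at hω ⊢
  rcases lt_abs.1 hω with h | h
  · left; linarith
  · right; linarith

/-- Markov's inequality for a weighted family: if each `g i` has mean at most a fraction `p` of the
weight `w i`, then `∑ g i` exceeds a fraction `η` of the total weight with probability at most
`p / η`, whatever the number of terms. -/
theorem measureReal_weighted_markov {T : Finset ι} {g : ι → Ω → ℝ} {w : ι → ℝ}
    (hg0 : ∀ i ∈ T, ∀ ω, 0 ≤ g i ω) (hgi : ∀ i ∈ T, Integrable (g i) P)
    (hw : ∀ i ∈ T, 0 < w i) {p η : ℝ} (hη : 0 < η) (hp : 0 ≤ p)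
    (hgp : ∀ i ∈ T, ∫ ω, g i ω ∂P ≤ p * w i) :
    P.real {ω | η * ∑ i ∈ T, w i < ∑ i ∈ T, g i ω} ≤ p / η := by
  rcases T.eq_empty_or_nonempty with rfl | hT
  · simp; positivity
  have hW : 0 < ∑ i ∈ T, w i := Finset.sum_pos hw hT
  have h1 := mul_meas_ge_le_integral_of_nonneg (μ := P) (f := fun ω => ∑ i ∈ T, g i ω)
    (ae_of_all _ fun ω => Finset.sum_nonneg fun i hi => hg0 i hi ω)
    (integrable_finsetSum _ hgi) (η * ∑ i ∈ T, w i)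
  rw [integral_finsetSum _ hgi] at h1
  have h2 : ∑ i ∈ T, ∫ ω, g i ω ∂P ≤ p * ∑ i ∈ T, w i := by
    rw [Finset.mul_sum]; exact Finset.sum_le_sum hgp
  have h3 : P.real {ω | η * ∑ i ∈ T, w i < ∑ i ∈ T, g i ω} ≤
      P.real {ω | η * ∑ i ∈ T, w i ≤ ∑ i ∈ T, g i ω} :=
    measureReal_mono fun ω hω => by
      simp only [Set.mem_ofPred_eq] at hω ⊢
      exact hω.le
  refine h3.trans ?_
  rw [le_div_iff₀ hη]
  have h4 := h1.trans h2
  have : (P.real {ω | η * ∑ i ∈ T, w i ≤ ∑ i ∈ T, g i ω} * η) * ∑ i ∈ T, w i ≤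
      p * ∑ i ∈ T, w i := by linarith
  exact le_of_mul_le_mul_right this hW

/-- Markov's inequality for the total weight of the indices `i` at which a rare event occurs. -/
theorem measureReal_weighted_markov_filter {T : Finset ι} {E : ι → Set Ω} {w : ι → ℝ}
    [∀ ω, DecidablePred fun i => ω ∈ E i] (hE : ∀ i ∈ T, MeasurableSet (E i))
    (hw : ∀ i ∈ T, 0 < w i) {p η : ℝ} (hη : 0 < η) (hp : 0 ≤ p)
    (hEp : ∀ i ∈ T, P.real (E i) ≤ p) :
    P.real {ω | η * ∑ i ∈ T, w i < ∑ i ∈ T with ω ∈ E i, w i} ≤ p / η := by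
  have h := measureReal_weighted_markov (P := P) (T := T)
    (g := fun i => (E i).indicator fun _ => w i) (w := w)
    (fun i hi ω => Set.indicator_nonneg (fun _ _ => (hw i hi).le) ω)
    (fun i hi => (integrable_const _).indicator (hE i hi)) hw hη hp
    (fun i hi => by
      rw [integral_indicator_const _ (hE i hi), smul_eq_mul]
      exact mul_le_mul_of_nonneg_right (hEp i hi) (hw i hi).le)
  have h0 : ∀ ω, ∑ i ∈ T with ω ∈ E i, w i = ∑ i ∈ T, (E i).indicator (fun _ => w i) ω := fun ω => by
    rw [Finset.sum_filter]
    exact Finset.sum_congr rfl fun i _ => by rw [Set.indicator_apply]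
  simpa only [h0] using h

end Concentration

/-! ### Sampling schedules -/

/-- A sequence of arms in whose first `∑ i, a i` entries each arm `i` occurs `a i` times; the later
entries are `j`. -/
def schedule (a : Fin K → ℕ) (j : Fin K) (k : ℕ) : Fin K :=
  if h : k < ∑ i, a i then (finSigmaFinEquiv.symm ⟨k, h⟩).1 else j

/-- The positions of arm `i` among the first `∑ i, a i` entries of the schedule. -/
def slots (a : Fin K → ℕ) (j i : Fin K) : Finset ℕ :=
  {k ∈ Finset.range (∑ i, a i) | schedule a j k = i}

theorem schedule_of_mem_slots {a : Fin K → ℕ} {j i : Fin K} {k : ℕ} (hk : k ∈ slots a j i) :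
    schedule a j k = i := (Finset.mem_filter.1 hk).2

theorem lt_of_mem_slots {a : Fin K → ℕ} {j i : Fin K} {k : ℕ} (hk : k ∈ slots a j i) :
    k < ∑ i, a i := Finset.mem_range.1 (Finset.mem_filter.1 hk).1

theorem card_slots (a : Fin K → ℕ) (j i : Fin K) : (slots a j i).card = a i := by
  rw [← Fintype.card_fin (a i), ← Finset.card_univ]
  symm
  refine Finset.card_bij (fun s _ => (finSigmaFinEquiv ⟨i, s⟩ : Fin (∑ i, a i)).1) ?_ ?_ ?_
  · intro s _
    refine Finset.mem_filter.2 ⟨Finset.mem_range.2 (Fin.is_lt _), ?_⟩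
    simp only [schedule, Fin.is_lt, dite_true, Fin.eta, Equiv.symm_apply_apply]
  · intro s _ s' _ h
    have := finSigmaFinEquiv.injective (Fin.ext h)
    simpa using this
  · intro k hk
    have hk1 := lt_of_mem_slots hk
    have hk2 := schedule_of_mem_slots hk
    simp only [schedule, hk1, dite_true] at hk2
    subst hk2
    exact ⟨(finSigmaFinEquiv.symm ⟨k, hk1⟩).2, Finset.mem_univ _, by simp⟩

namespace BoundedInstance

theorem iIndepFun_rewards (ν : BoundedInstance K) (s : ℕ → Fin K) :
    iIndepFun (fun (k : ℕ) (ω : ℕ → Fin K → ℝ) => ω k (s k)) ν.rewardLaw :=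
  iIndepFun_infinitePi (P := fun _ : ℕ => Measure.pi ν.law) (X := fun k x => x (s k))
    (fun _ => by fun_prop)

theorem measurePreserving_reward (ν : BoundedInstance K) (k : ℕ) (i : Fin K) :
    MeasurePreserving (fun (ω : ℕ → Fin K → ℝ) => ω k i) ν.rewardLaw (ν.law i) :=
  (measurePreserving_eval ν.law i).comp
    (measurePreserving_eval_infinitePi (fun _ : ℕ => Measure.pi ν.law) k)

theorem ae_reward_mem (ν : BoundedInstance K) (k : ℕ) (i : Fin K) :
    ∀ᵐ ω ∂ν.rewardLaw, ω k i ∈ Set.Icc (0 : ℝ) 1 :=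
  (ν.measurePreserving_reward k i).quasiMeasurePreserving.ae (ν.bounded i)

theorem integral_reward (ν : BoundedInstance K) (k : ℕ) (i : Fin K) :
    ∫ ω, ω k i ∂ν.rewardLaw = ν.mean i := by
  have h := ν.measurePreserving_reward k i
  rw [mean, ← h.map_eq, integral_map h.measurable.aemeasurable (by fun_prop)]

theorem variance_reward (ν : BoundedInstance K) (k : ℕ) (i : Fin K) :
    Var[fun ω => ω k i; ν.rewardLaw] = ν.var i := by
  have h := ν.measurePreserving_reward k i
  rw [var, ← h.map_eq, variance_map (by fun_prop) h.measurable.aemeasurable]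
  rfl

/-- The squared difference of two consecutive rewards, both of arm `s k`. -/
def pairSq (s : ℕ → Fin K) (k : ℕ) (ω : ℕ → Fin K → ℝ) : ℝ :=
  (ω (2 * k) (s k) - ω (2 * k + 1) (s k)) ^ 2

theorem measurable_pairSq (s : ℕ → Fin K) (k : ℕ) : Measurable (pairSq s k) := by
  unfold pairSq; fun_prop

theorem iIndepFun_pairSq (ν : BoundedInstance K) (s : ℕ → Fin K) :
    iIndepFun (pairSq s) ν.rewardLaw := by
  let e : ℕ × Fin 2 → ℕ := fun p => 2 * p.1 + p.2
  have he : Function.Injective e := fun p q h => by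
    have h1 := p.2.2; have h2 := q.2.2
    simp only [e] at h
    exact Prod.ext (by omega) (Fin.ext (by omega))
  let Q := Measure.pi ν.law
  have h1 : (ν.rewardLaw).map (fun ω p => ω (e p)) = Measure.infinitePi fun _ : ℕ × Fin 2 => Q :=
    Measure.map_infinitePi_infinitePi_of_inj (P := fun _ : ℕ => Q) he
  have h2 := Measure.infinitePi_map_curry (fun (_ : ℕ) (_ : Fin 2) => Q)
  have hm : Measurable fun (ω : ℕ → Fin K → ℝ) (k : ℕ) (b : Fin 2) => ω (e (k, b)) := by fun_prop
  have h3 : (ν.rewardLaw).map (fun (ω : ℕ → Fin K → ℝ) (k : ℕ) (b : Fin 2) => ω (e (k, b))) =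
      Measure.infinitePi fun _ : ℕ => Measure.infinitePi fun _ : Fin 2 => Q := by
    rw [← h2, ← h1, Measure.map_map (by fun_prop) (by fun_prop)]
    rfl
  have h4 : iIndepFun (fun (k : ℕ) (z : ℕ → Fin 2 → Fin K → ℝ) =>
      (z k 0 (s k) - z k 1 (s k)) ^ 2)
      (Measure.infinitePi fun _ : ℕ => Measure.infinitePi fun _ : Fin 2 => Q) :=
    iIndepFun_infinitePi (X := fun k (x : Fin 2 → Fin K → ℝ) => (x 0 (s k) - x 1 (s k)) ^ 2)
      (fun _ => by fun_prop)
  have : IsProbabilityMeasure (ν.rewardLaw.map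
      fun (ω : ℕ → Fin K → ℝ) (k : ℕ) (b : Fin 2) => ω (e (k, b))) :=
    Measure.isProbabilityMeasure_map hm.aemeasurable
  rw [← h3, iIndepFun_iff_map_fun_eq_infinitePi_map (fun _ => by fun_prop),
    Measure.map_map (by fun_prop) hm] at h4
  rw [iIndepFun_iff_map_fun_eq_infinitePi_map (measurable_pairSq s)]
  refine Eq.trans h4 ?_
  congr 1
  funext k
  rw [Measure.map_map (by fun_prop) hm]
  rfl

theorem ae_pairSq_mem (ν : BoundedInstance K) (s : ℕ → Fin K) (k : ℕ) :
    ∀ᵐ ω ∂ν.rewardLaw, pairSq s k ω ∈ Set.Icc (0 : ℝ) 1 := by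
  filter_upwards [ν.ae_reward_mem (2 * k) (s k), ν.ae_reward_mem (2 * k + 1) (s k)] with ω h1 h2
  refine ⟨sq_nonneg _, ?_⟩
  unfold pairSq
  rw [← sq_abs]
  refine pow_le_one₀ (abs_nonneg _) ?_
  rw [abs_le]; constructor <;> linarith [h1.1, h1.2, h2.1, h2.2]

theorem integral_pairSq (ν : BoundedInstance K) (s : ℕ → Fin K) (k : ℕ) :
    ∫ ω, pairSq s k ω ∂ν.rewardLaw = 2 * ν.var (s k) := by
  have hL : ∀ t, MemLp (fun ω : ℕ → Fin K → ℝ => ω t (s k)) 2 ν.rewardLaw := fun t =>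
    memLp_of_bounded (ν.ae_reward_mem t (s k)) (Measurable.aestronglyMeasurable (by fun_prop)) 2
  have hind : IndepFun (fun ω : ℕ → Fin K → ℝ => ω (2 * k) (s k))
      (fun ω => ω (2 * k + 1) (s k)) ν.rewardLaw :=
    (ν.iIndepFun_rewards fun _ => s k).indepFun (by omega)
  have h1 := variance_sub (hL (2 * k)) (hL (2 * k + 1))
  rw [hind.covariance_eq_zero (hL _) (hL _), mul_zero, sub_zero] at h1
  have h2 := variance_eq_sub ((hL (2 * k)).sub (hL (2 * k + 1)))
  have h3 : ∫ ω : ℕ → Fin K → ℝ, (ω (2 * k) (s k) - ω (2 * k + 1) (s k)) ∂ν.rewardLaw = 0 := by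
    rw [integral_sub ((hL _).integrable (by norm_num)) ((hL _).integrable (by norm_num)),
      integral_reward, integral_reward, sub_self]
  rw [h1, variance_reward, variance_reward] at h2
  simp only [Pi.pow_apply, Pi.sub_apply, h3] at h2
  unfold pairSq
  linarith

/-- The effective sample size `σᵢ² / ε² + 1 / ε` of arm `i` at accuracy `ε = 2^(-r)`. -/
def weight (ν : BoundedInstance K) (r : ℕ) (i : Fin K) : ℝ := ν.var i * 4 ^ r + 2 ^ r

theorem two_pow_le_weight (ν : BoundedInstance K) (r : ℕ) (i : Fin K) : 2 ^ r ≤ ν.weight r i := by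
  have := ν.var_nonneg i
  unfold weight
  have : 0 ≤ ν.var i * 4 ^ r := by positivity
  linarith

theorem weight_pos (ν : BoundedInstance K) (r : ℕ) (i : Fin K) : 0 < ν.weight r i :=
  lt_of_lt_of_le (by positivity) (ν.two_pow_le_weight r i)

end BoundedInstance

/-! ### Estimating a weight and a mean -/

/-- The sum of the squared differences of the pairs of rewards of arm `i`. -/
def pairSum (a : Fin K → ℕ) (j i : Fin K) (x : ℕ → ℝ) : ℝ :=
  ∑ k ∈ slots a j i, (x (2 * k) - x (2 * k + 1)) ^ 2

/-- The estimate `2^r + ⌊2^r V / Λ⌋` of the weight of an arm at accuracy `2^(-r)`, computed from the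
sum `V` of the squared differences of `2^r Λ` pairs of rewards. -/
def weightEst (r Λ : ℕ) (V : ℝ) : ℕ := 2 ^ r + ⌊V * 2 ^ r / Λ⌋₊

/-- The empirical mean of arm `i`, rounded down to a multiple of `2^(-(r+1))` and expressed in this
unit. -/
def meanEst (r : ℕ) (a : Fin K → ℕ) (j i : Fin K) (x : ℕ → ℝ) : ℤ :=
  ⌊(∑ k ∈ slots a j i, x k) / a i * 2 ^ (r + 1)⌋

/-- The rewards of a block of pairs. -/
def pairRewards (s : ℕ → Fin K) (ω : ℕ → Fin K → ℝ) (k : ℕ) : ℝ := ω k (s (k / 2))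

theorem pairSum_pairRewards (a : Fin K → ℕ) (j i : Fin K) (ω : ℕ → Fin K → ℝ) :
    pairSum a j i (pairRewards (schedule a j) ω) =
      ∑ k ∈ slots a j i, BoundedInstance.pairSq (schedule a j) k ω := by
  refine Finset.sum_congr rfl fun k _ => ?_
  have h1 : 2 * k / 2 = k := by omega
  have h2 : (2 * k + 1) / 2 = k := by omega
  simp only [pairRewards, BoundedInstance.pairSq, h1, h2]

section Pilot

variable (ν : BoundedInstance K) {a : Fin K → ℕ} {i : Fin K} {r Λ : ℕ}

/-- An underestimate of the weight by a factor `4` is unlikely. -/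
theorem measureReal_weightEst_lt_le (j : Fin K) (ha : a i = 2 ^ r * Λ) (hΛ : 1 ≤ Λ) :
    ν.rewardLaw.real {ω | 4 * (weightEst r Λ (pairSum a j i (pairRewards (schedule a j) ω)) : ℝ) <
      ν.weight r i} ≤ Real.exp (-Λ) := by
  have hΛ' : (1 : ℝ) ≤ Λ := by exact_mod_cast hΛ
  have hv := ν.var_nonneg i
  have h2r : (1 : ℝ) ≤ 2 ^ r := one_le_pow₀ (by norm_num)
  have h4r : (4 : ℝ) ^ r = 2 ^ r * 2 ^ r := by rw [← mul_pow]; norm_num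
  set u : ℝ := 2 ^ r * Λ * (2 * ν.var i) with hu
  have hcard : ((slots a j i).card : ℝ) * (2 * ν.var i) = u := by
    rw [card_slots, ha]; push_cast; ring
  have key := measureReal_sum_le_le (ν.iIndepFun_pairSq (schedule a j))
    (BoundedInstance.measurable_pairSq _) (ν.ae_pairSq_mem _) (slots a j i) (m := 2 * ν.var i)
    (by linarith) (fun k hk => by rw [ν.integral_pairSq, schedule_of_mem_slots hk]) (u / 6)
  rw [hcard] at key
  by_cases hsmall : u ≤ 6 * Λ
  · -- the estimate is at least `2 ^ r`, which is not too small if the variance is small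
    have hemp : {ω | 4 * (weightEst r Λ (pairSum a j i (pairRewards (schedule a j) ω)) : ℝ) <
        ν.weight r i} = ∅ := by
      ext ω
      simp only [Set.mem_ofPred_eq, Set.mem_empty_iff_false, iff_false, not_lt]
      have h1 : (2 : ℝ) ^ r ≤ weightEst r Λ (pairSum a j i (pairRewards (schedule a j) ω)) := by
        unfold weightEst; push_cast; linarith [Nat.cast_nonneg (α := ℝ)
          ⌊pairSum a j i (pairRewards (schedule a j) ω) * 2 ^ r / Λ⌋₊]
      have h2 : ν.var i * 2 ^ r ≤ 3 := by
        by_contra h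
        rw [not_le] at h
        rw [hu] at hsmall
        nlinarith
      unfold BoundedInstance.weight
      rw [h4r]
      nlinarith
    rw [hemp]; simp; positivity
  · rw [not_le] at hsmall
    refine le_trans (measureReal_mono fun ω hω => ?_) (key.trans (Real.exp_le_exp.2 (by linarith)))
    simp only [Set.mem_ofPred_eq] at hω ⊢
    rw [pairSum_pairRewards] at hω
    set V := ∑ k ∈ slots a j i, BoundedInstance.pairSq (schedule a j) k ω
    have h1 : V * 2 ^ r / Λ < ⌊V * 2 ^ r / Λ⌋₊ + 1 := Nat.lt_floor_add_one _
    unfold weightEst BoundedInstance.weight at hω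
    push_cast at hω
    have h3 : 4 * (V * 2 ^ r / Λ) < ν.var i * 4 ^ r + 2 ^ r := by linarith
    rw [h4r, ← mul_div_assoc, div_lt_iff₀ (by linarith)] at h3
    have h4 : (4 * V) * 2 ^ r < (u / 2 + Λ) * 2 ^ r := by rw [hu]; linarith
    have h5 := lt_of_mul_lt_mul_right h4 (by linarith)
    linarith

/-- The expected weight estimate is small on the event that it exceeds the weight by a factor
`16`. -/
theorem integral_weightEst_le (j : Fin K) (ha : a i = 2 ^ r * Λ) (hΛ : 1 ≤ Λ) :
    let N : (ℕ → Fin K → ℝ) → ℝ := fun ω =>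
      weightEst r Λ (pairSum a j i (pairRewards (schedule a j) ω))
    let E := {ω | 16 * ν.weight r i < N ω}
    Integrable (E.indicator N) ν.rewardLaw ∧
    ∫ ω, E.indicator N ω ∂ν.rewardLaw ≤ Real.exp (-Λ) * ν.weight r i := by
  intro N E
  have hΛ' : (1 : ℝ) ≤ Λ := by exact_mod_cast hΛ
  have hv := ν.var_nonneg i
  have h2r : (1 : ℝ) ≤ 2 ^ r := one_le_pow₀ (by norm_num)
  have h4r : (4 : ℝ) ^ r = 2 ^ r * 2 ^ r := by rw [← mul_pow]; norm_num
  set u : ℝ := 2 ^ r * Λ * (2 * ν.var i) with hu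
  have hu0 : 0 ≤ u := by positivity
  have hcard : ((slots a j i).card : ℝ) * (2 * ν.var i) = u := by
    rw [card_slots, ha]; push_cast; ring
  set V : (ℕ → Fin K → ℝ) → ℝ :=
    ∑ k ∈ slots a j i, BoundedInstance.pairSq (schedule a j) k with hV
  have hVω : ∀ ω, pairSum a j i (pairRewards (schedule a j) ω) = V ω := fun ω => by
    rw [pairSum_pairRewards, hV, Finset.sum_apply]
  have hV0 : ∀ ω, 0 ≤ V ω := fun ω => by
    rw [hV, Finset.sum_apply]; exact Finset.sum_nonneg fun k _ => sq_nonneg _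
  have hVm : Measurable V := by
    rw [hV, show ∑ k ∈ slots a j i, BoundedInstance.pairSq (schedule a j) k = fun ω => _ from
      funext fun ω => Finset.sum_apply _ _ _]
    exact Finset.measurable_sum _ fun k _ => BoundedInstance.measurable_pairSq _ k
  have hNm : Measurable N := by
    have : N = fun ω => ((2 ^ r + ⌊V ω * 2 ^ r / Λ⌋₊ : ℕ) : ℝ) := by
      funext ω; simp only [N, weightEst, hVω]
    rw [this]
    refine measurable_from_top.comp (measurable_from_top (f := fun n : ℕ => 2 ^ r + n) |>.comp ?_)
    exact Nat.measurable_floor.comp (by fun_prop)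
  have hEm : MeasurableSet E := measurableSet_lt measurable_const hNm
  have hmgf := mgf_sum_le_of_mem_Icc (ν.iIndepFun_pairSq (schedule a j))
    (BoundedInstance.measurable_pairSq _) (ν.ae_pairSq_mem _) (slots a j i) (m := 2 * ν.var i)
    (fun k hk => by rw [ν.integral_pairSq, schedule_of_mem_slots hk]) 2
  rw [hcard, ← hV] at hmgf
  have hexpint : Integrable (fun ω => Real.exp (2 * V ω)) ν.rewardLaw :=
    integrable_exp_mul_of_mem_Icc hVm (ae_sum_mem_Icc (ν.ae_pairSq_mem _) _) 2
  -- on `E`, the sum `V` exceeds `8 u + 15 Λ`, and `N ≤ 2 ^ r exp V`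
  have hpt : ∀ ω, E.indicator N ω ≤ 2 ^ r * Real.exp (-(8 * u + 15 * Λ)) * Real.exp (2 * V ω) := by
    intro ω
    by_cases hω : ω ∈ E
    · rw [Set.indicator_of_mem hω]
      have h1 : N ω ≤ 2 ^ r * (1 + V ω / Λ) := by
        simp only [N, weightEst, hVω]
        push_cast
        have := Nat.floor_le (show 0 ≤ V ω * 2 ^ r / Λ from by have := hV0 ω; positivity)
        calc _ ≤ 2 ^ r + V ω * 2 ^ r / Λ := by linarith
          _ = _ := by ring
      have h2 : 8 * u + 15 * Λ ≤ V ω := by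
        have h3 : 16 * ν.weight r i < 2 ^ r * (1 + V ω / Λ) := lt_of_lt_of_le hω h1
        unfold BoundedInstance.weight at h3
        rw [h4r, show 16 * (ν.var i * (2 ^ r * 2 ^ r) + 2 ^ r) =
          2 ^ r * (16 * (ν.var i * 2 ^ r + 1)) by ring] at h3
        have h4 := lt_of_mul_lt_mul_left h3 (by linarith)
        have h5 : (16 * (ν.var i * 2 ^ r + 1) - 1) * Λ < V ω := by
          rw [← lt_div_iff₀ (by linarith)]; linarith
        have h6 : (16 * (ν.var i * 2 ^ r + 1) - 1) * Λ = 8 * u + 15 * Λ := by rw [hu]; ring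
        linarith
      have h7 : 1 + V ω / Λ ≤ Real.exp (V ω) := by
        have : V ω / Λ ≤ V ω := div_le_self (hV0 ω) hΛ'
        linarith [Real.add_one_le_exp (V ω)]
      calc N ω ≤ 2 ^ r * Real.exp (V ω) := h1.trans (by gcongr)
        _ ≤ 2 ^ r * Real.exp (-(8 * u + 15 * Λ) + 2 * V ω) := by gcongr; linarith
        _ = _ := by rw [Real.exp_add]; ring
    · rw [Set.indicator_of_notMem hω]; positivity
  have hN0 : ∀ ω, 0 ≤ E.indicator N ω :=
    fun ω => Set.indicator_nonneg (fun _ _ => Nat.cast_nonneg _) ω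
  refine ⟨(hexpint.const_mul (2 ^ r * Real.exp (-(8 * u + 15 * Λ)))).mono' (hNm.indicator hEm).aestronglyMeasurable
    (ae_of_all _ fun ω => ?_), ?_⟩
  · rw [Real.norm_of_nonneg (hN0 ω)]; exact hpt ω
  · calc ∫ ω, E.indicator N ω ∂ν.rewardLaw
        ≤ ∫ ω, 2 ^ r * Real.exp (-(8 * u + 15 * Λ)) * Real.exp (2 * V ω) ∂ν.rewardLaw :=
          integral_mono_of_nonneg (ae_of_all _ hN0) (hexpint.const_mul _) (ae_of_all _ hpt)
      _ = 2 ^ r * Real.exp (-(8 * u + 15 * Λ)) * mgf V ν.rewardLaw 2 := integral_const_mul _ _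
      _ ≤ 2 ^ r * Real.exp (-(8 * u + 15 * Λ)) * Real.exp (8 * u) := by
          gcongr
          exact hmgf.trans (Real.exp_le_exp.2 (by nlinarith [exp_two_sub_one_le]))
      _ = 2 ^ r * Real.exp (-(15 * Λ)) := by rw [mul_assoc, ← Real.exp_add]; ring_nf
      _ ≤ ν.weight r i * Real.exp (-Λ) := by
          gcongr
          · exact (ν.weight_pos r i).le
          · exact ν.two_pow_le_weight r i
          · linarith
      _ = _ := mul_comm _ _

/-- An overestimate of the weight by a factor `16` is unlikely. -/
theorem measureReal_lt_weightEst_le (j : Fin K) (ha : a i = 2 ^ r * Λ) (hΛ : 1 ≤ Λ) :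
    ν.rewardLaw.real {ω | 16 * ν.weight r i <
      (weightEst r Λ (pairSum a j i (pairRewards (schedule a j) ω)) : ℝ)} ≤ Real.exp (-Λ) := by
  obtain ⟨h1, h2⟩ := integral_weightEst_le ν j ha hΛ
  have hw := ν.weight_pos r i
  have h3 := mul_meas_ge_le_integral_of_nonneg
    (ae_of_all _ fun ω => Set.indicator_nonneg (fun _ _ => Nat.cast_nonneg _) ω) h1 (ν.weight r i)
  have h4 : ν.rewardLaw.real {ω | 16 * ν.weight r i <
      (weightEst r Λ (pairSum a j i (pairRewards (schedule a j) ω)) : ℝ)} ≤ ν.rewardLaw.real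
      {ω | ν.weight r i ≤ Set.indicator {ω | 16 * ν.weight r i <
      (weightEst r Λ (pairSum a j i (pairRewards (schedule a j) ω)) : ℝ)} (fun ω =>
      (weightEst r Λ (pairSum a j i (pairRewards (schedule a j) ω)) : ℝ)) ω} := by
    refine measureReal_mono fun ω hω => ?_
    simp only [Set.mem_ofPred_eq]
    rw [Set.indicator_of_mem hω]
    simp only [Set.mem_ofPred_eq] at hω
    linarith
  have h5 := h3.trans h2
  rw [mul_comm] at h5
  exact h4.trans (le_of_mul_le_mul_right h5 hw)

end Pilot

/-- With `64 L` times as many samples as the weight asks for (up to the factor `4`), the empirical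
mean is accurate to `2^(-r)`. -/
theorem measureReal_meanEst_le (ν : BoundedInstance K) {a : Fin K → ℕ} {i : Fin K} {r L N : ℕ}
    (j : Fin K) (ha : a i = N * (64 * L)) (hL : 1 ≤ L) (hN : ν.weight r i ≤ 4 * N) :
    ν.rewardLaw.real {ω | 2 < |(meanEst r a j i (fun k => ω k (schedule a j k)) : ℝ) -
      ν.mean i * 2 ^ (r + 1)|} ≤ 2 * Real.exp (-L) := by
  have hL' : (1 : ℝ) ≤ L := by exact_mod_cast hL
  have hw := ν.weight_pos r i
  have hN0 : (0 : ℝ) < N := by linarith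
  have hv := ν.var_nonneg i
  have h2r : (0 : ℝ) < 2 ^ (r + 1) := by positivity
  have han : (a i : ℝ) = N * (64 * L) := by rw [ha]; push_cast; ring
  have ha0 : (0 : ℝ) < a i := by rw [han]; positivity
  set ε : ℝ := 1 / 2 ^ (r + 1) with hε
  have hε0 : 0 < ε := by positivity
  have key := measureReal_bernstein (ν.iIndepFun_rewards (schedule a j)) (fun _ => by fun_prop)
    (fun k => ν.ae_reward_mem k _) (slots a j i) (m := ν.mean i) (v := ν.var i)
    (fun k hk => by rw [schedule_of_mem_slots hk, ν.integral_reward])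
    (fun k hk => by rw [schedule_of_mem_slots hk, ν.variance_reward]) hv hε0
  rw [card_slots] at key
  refine le_trans (measureReal_mono fun ω hω => ?_) (key.trans ?_)
  · simp only [Set.mem_ofPred_eq] at hω ⊢
    set S := ∑ k ∈ slots a j i, ω k (schedule a j k) with hS
    have h1 : (meanEst r a j i (fun k => ω k (schedule a j k)) : ℝ) ≤ S / a i * 2 ^ (r + 1) :=
      Int.floor_le _
    have h2 : S / a i * 2 ^ (r + 1) < meanEst r a j i (fun k => ω k (schedule a j k)) + 1 :=
      Int.lt_floor_add_one _
    have h3 : 1 < |S / a i * 2 ^ (r + 1) - ν.mean i * 2 ^ (r + 1)| := by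
      rcases lt_abs.1 hω with h | h
      · exact lt_abs.2 (Or.inl (by linarith))
      · exact lt_abs.2 (Or.inr (by linarith))
    have h4 : S / a i * 2 ^ (r + 1) - ν.mean i * 2 ^ (r + 1) =
        (S - a i * ν.mean i) * (2 ^ (r + 1) / a i) := by field_simp
    rw [h4, abs_mul, abs_of_pos (by positivity : (0 : ℝ) < 2 ^ (r + 1) / a i), ← mul_div_assoc,
      lt_div_iff₀ ha0, one_mul] at h3
    rw [hε, mul_one_div, div_lt_iff₀ h2r]
    exact h3
  · have hexp : (L : ℝ) ≤ a i * ε ^ 2 / (4 * (ν.var i + ε)) := by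
      rw [le_div_iff₀ (by positivity), han]
      have h1 : ε ^ 2 * (4 * ν.weight r i) = ν.var i + 2 * ε := by
        have h4r : (4 : ℝ) ^ r = 2 ^ r * 2 ^ r := by rw [← mul_pow]; norm_num
        rw [hε, BoundedInstance.weight, h4r, pow_succ]; field_simp
        ring
      have h2 : ν.var i + 2 * ε ≤ ε ^ 2 * (16 * N) := by
        rw [← h1]; nlinarith [sq_nonneg ε]
      nlinarith
    gcongr

/-! ### The algorithm -/

/-- The variables of the algorithm: the phase (`verify = false`: search for the value of the best
arm, `verify = true`: verification of the candidate), the round `r` (accuracy `2^(-r)`), the level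
`ℓ` within the phase, the set `S` of surviving arms, the set `T` of arms sampled at this level, the
estimate `θ` of the largest mean in units of `2^(-(r+1))`, and the candidate `j`. -/
structure Ctx (K : ℕ) where
  verify : Bool
  r : ℕ
  ℓ : ℕ
  S : Finset (Fin K)
  T : Finset (Fin K)
  θ : ℤ
  j : Fin K

/-- The states of the algorithm: `done j` after the recommendation of `j`; before a block of pairs of
samples that estimates the weights of the arms in `T` (`pilot`); and, once these are estimated by
`N`, before the block of samples that estimates their means (`main`). -/
inductive State (K : ℕ) where
  | done (j : Fin K) : State K
  | pilot (c : Ctx K) : State K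
  | main (c : Ctx K) (N : Fin K → ℕ) : State K

instance : Countable (Ctx K) :=
  Function.Injective.countable
    (f := fun c : Ctx K => (c.verify, c.r, c.ℓ, c.S, c.T, c.θ, c.j)) fun c d h => by
      cases c; cases d; simp_all

instance : Countable (State K) :=
  Function.Injective.countable
    (f := fun s : State K => match s with
      | .done j => (Sum.inl j : Fin K ⊕ (Ctx K ⊕ (Ctx K × (Fin K → ℕ))))
      | .pilot c => Sum.inr (Sum.inl c)
      | .main c N => Sum.inr (Sum.inr (c, N))) fun s t h => by
      cases s <;> cases t <;> simp_all

instance : MeasurableSpace (State K) := ⊤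

instance : DiscreteMeasurableSpace (State K) := ⟨fun _ => trivial⟩

/-- The part of the confidence exponent that does not depend on the level; `A` is about
`ln (1 / δ)`. -/
def roundConf (A r : ℕ) : ℕ := A + Nat.clog 2 ((r + 1) * (r + 2))

/-- The confidence exponent: estimates at level `ℓ` of round `r` fail with probability about
`exp (-(roundConf A r + ℓ))`. -/
def Ctx.conf (A : ℕ) (c : Ctx K) : ℕ := roundConf A c.r + c.ℓ

/-- The numbers of pairs of samples in a pilot block. -/
def Ctx.pilotAlloc (A : ℕ) (c : Ctx K) (i : Fin K) : ℕ :=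
  if i ∈ c.T then 2 ^ c.r * (64 * c.conf A) else 0

/-- The numbers of samples in a main block. -/
def Ctx.mainAlloc (A : ℕ) (c : Ctx K) (N : Fin K → ℕ) (i : Fin K) : ℕ :=
  if i ∈ c.T then N i * (64 * c.conf A) else 0

/-- `q` is the cutoff for the weights `N` and the values `m` on `T`: the arms with `m i ≥ q` carry
more than a fraction `1 / 512` of the weight, those with `m i > q` do not. -/
def IsCutoff (T : Finset (Fin K)) (N : Fin K → ℕ) (m : Fin K → ℤ) (q : ℤ) : Prop :=
  ∑ i ∈ T, N i < 512 * ∑ i ∈ T with q ≤ m i, N i ∧ 512 * ∑ i ∈ T with q < m i, N i ≤ ∑ i ∈ T, N i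

theorem exists_isCutoff (T : Finset (Fin K)) (N : Fin K → ℕ) (m : Fin K → ℤ)
    (hN : 0 < ∑ i ∈ T, N i) : ∃ q, IsCutoff T N m q := by
  have hT : T.Nonempty := by
    rcases T.eq_empty_or_nonempty with rfl | h
    · simp at hN
    · exact h
  obtain ⟨lo, -, hlo⟩ := T.exists_min_image m hT
  obtain ⟨hi, -, hhi⟩ := T.exists_max_image m hT
  obtain ⟨q, hq, hmax⟩ := Int.exists_greatest_of_bdd
    (P := fun q => ∑ i ∈ T, N i < 512 * ∑ i ∈ T with q ≤ m i, N i)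
    ⟨m hi, fun z hz => by
      by_contra h
      rw [Finset.filter_false_of_mem (fun i hi' => by have := hhi i hi'; omega)] at hz
      simp at hz⟩
    ⟨m lo, by
      rw [Finset.filter_true_of_mem hlo]; omega⟩
  refine ⟨q, hq, ?_⟩
  by_contra h
  have := hmax (q + 1) (by simpa [Int.add_one_le_iff] using h)
  omega

open Classical in
/-- The cutoff, if there is one. -/
def cutoff (T : Finset (Fin K)) (N : Fin K → ℕ) (m : Fin K → ℤ) : ℤ :=
  if h : ∃ q, IsCutoff T N m q then h.choose else 0

theorem isCutoff_cutoff (T : Finset (Fin K)) (N : Fin K → ℕ) (m : Fin K → ℤ)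
    (hN : 0 < ∑ i ∈ T, N i) : IsCutoff T N m (cutoff T N m) := by
  have h := exists_isCutoff T N m hN
  rw [cutoff, dif_pos h]
  exact h.choose_spec

open Classical in
/-- An arm of `U` with the largest weight (`j` if `U` is empty). -/
def heaviest (U : Finset (Fin K)) (N : Fin K → ℕ) (j : Fin K) : Fin K :=
  if h : U.Nonempty then (U.exists_max_image N h).choose else j

theorem heaviest_spec {U : Finset (Fin K)} (N : Fin K → ℕ) (j : Fin K) (h : U.Nonempty) :
    heaviest U N j ∈ U ∧ ∀ i ∈ U, N i ≤ N (heaviest U N j) := by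
  rw [heaviest, dif_pos h]
  exact (U.exists_max_image N h).choose_spec

/-- A level of the search phase: the cutoff becomes the new `θ` if it is larger, with the heaviest arm
on or above it as the new candidate; only the arms strictly above the cutoff are kept. When no arm
is left, the verification of the candidate against all surviving arms begins. -/
def Ctx.search (c : Ctx K) (N : Fin K → ℕ) (m : Fin K → ℤ) : State K :=
  let q := cutoff c.T N m
  let T' := {i ∈ c.T | q < m i}
  let θ' := if c.θ < q then q else c.θ
  let j' := if c.θ < q then heaviest {i ∈ c.T | q ≤ m i} N c.j else c.j
  if T' = ∅ then .pilot ⟨true, c.r, 0, c.S, c.S, θ', j'⟩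
  else .pilot ⟨false, c.r, c.ℓ + 1, c.S, T', θ', j'⟩

/-- A level of the verification phase: arms with an estimate below `θ` by more than `4` units are
eliminated. If the candidate is the only arm left, it is recommended; if the weight of the other arms
has decreased enough, they are sampled again at the next level; otherwise the next round begins. -/
def Ctx.check (c : Ctx K) (N : Fin K → ℕ) (m : Fin K → ℤ) : State K :=
  let E := {i ∈ c.T | m i + 4 < c.θ}
  let T' := (c.T \ E).erase c.j
  if T' = ∅ then .done c.j
  else if 512 * ∑ i ∈ T', N i ≤ ∑ i ∈ c.T, N i then
    .pilot ⟨true, c.r, c.ℓ + 1, c.S \ E, T', c.θ, c.j⟩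
  else .pilot ⟨false, c.r + 1, 0, c.S \ E, c.S \ E, -3, c.j⟩

/-- The state after the main block, given the estimates `m` of the means. -/
def Ctx.next (c : Ctx K) (N : Fin K → ℕ) (m : Fin K → ℤ) : State K :=
  if c.verify then c.check N m else c.search N m

/-- The weights estimated in a pilot block. -/
def Ctx.pilotStat (A : ℕ) (c : Ctx K) (x : ℕ → ℝ) (i : Fin K) : ℕ :=
  weightEst c.r (64 * c.conf A) (pairSum (c.pilotAlloc A) c.j i x)

/-- The means estimated in a main block. -/
def Ctx.mainStat (A : ℕ) (c : Ctx K) (N : Fin K → ℕ) (x : ℕ → ℝ) (i : Fin K) : ℤ :=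
  meanEst c.r (c.mainAlloc A N) c.j i x

theorem Ctx.measurable_pilotStat (A : ℕ) (c : Ctx K) : Measurable (c.pilotStat A) := by
  refine measurable_pi_lambda _ fun i => ?_
  unfold pilotStat weightEst pairSum
  refine (measurable_from_top (f := fun n : ℕ => 2 ^ c.r + n)).comp (Nat.measurable_floor.comp ?_)
  fun_prop

theorem Ctx.measurable_mainStat (A : ℕ) (c : Ctx K) (N : Fin K → ℕ) :
    Measurable (c.mainStat A N) := by
  refine measurable_pi_lambda _ fun i => ?_
  unfold mainStat meanEst
  refine Int.measurable_floor.comp ?_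
  fun_prop

/-- Variance-dependent best-arm identification by blocks. The lengths are padded to be positive. -/
def machine (A : ℕ) : BlockMachine K (State K) where
  decision
    | .done j => some j
    | _ => none
  len
    | .done _ => 1
    | .pilot c => max 1 (2 * ∑ i, c.pilotAlloc A i)
    | .main c N => max 1 (∑ i, c.mainAlloc A N i)
  len_pos s := by cases s <;> simp
  arm
    | .done j => fun _ => j
    | .pilot c => fun k => schedule (c.pilotAlloc A) c.j (k / 2)
    | .main c N => schedule (c.mainAlloc A N) c.j
  trans
    | .done j => fun _ => .done j
    | .pilot c => fun x => .main c (c.pilotStat A x)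
    | .main c N => fun x => c.next N (c.mainStat A N x)
  measurable_trans s := by
    cases s with
    | done j => exact measurable_const
    | pilot c =>
      exact (Measurable.of_discrete (f := State.main c)).comp (c.measurable_pilotStat A)
    | main c N =>
      exact (Measurable.of_discrete (f := c.next N)).comp (c.measurable_mainStat A N)
  trans_congr s x y h := by
    cases s with
    | done j => rfl
    | pilot c =>
      simp only at h ⊢
      congr 1
      funext i
      unfold Ctx.pilotStat pairSum
      congr 1
      refine Finset.sum_congr rfl fun k hk => ?_
      have := lt_of_mem_slots hk
      rw [h (2 * k) (lt_max_of_lt_right (by omega)), h (2 * k + 1) (lt_max_of_lt_right (by omega))]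
    | main c N =>
      simp only at h ⊢
      congr 1
      funext i
      unfold Ctx.mainStat meanEst
      congr 3
      exact Finset.sum_congr rfl fun k hk => h k (lt_max_of_lt_right (lt_of_mem_slots hk))

/-! ### Good levels -/

namespace BoundedInstance

/-- The mean in units of `2^(-(r+1))`. -/
def scaledMean (ν : BoundedInstance K) (r : ℕ) (i : Fin K) : ℝ := ν.mean i * 2 ^ (r + 1)

/-- The first round whose accuracy resolves the gap of arm `i`. -/
def hardRound (ν : BoundedInstance K) (i : Fin K) : ℕ := sInf {r : ℕ | 5 ≤ ν.gap i * 2 ^ r}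

/-- The suboptimal arms whose gap is resolved in round `r`. -/
def resolved (ν : BoundedInstance K) (r : ℕ) : Finset (Fin K) :=
  {i | i ≠ ν.best ∧ ν.hardRound i ≤ r}

theorem exists_le_gap_mul (hK : 2 ≤ K) (ν : BoundedInstance K) (i : Fin K) :
    {r : ℕ | 5 ≤ ν.gap i * 2 ^ r}.Nonempty := by
  obtain ⟨r, hr⟩ := pow_unbounded_of_one_lt (5 / ν.gap i) (by norm_num : (1 : ℝ) < 2)
  rw [div_lt_iff₀ (ν.gap_pos hK i)] at hr
  exact ⟨r, by simp only [Set.mem_ofPred_eq]; linarith⟩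

theorem hardRound_le_iff (hK : 2 ≤ K) (ν : BoundedInstance K) (i : Fin K) (r : ℕ) :
    ν.hardRound i ≤ r ↔ 5 ≤ ν.gap i * 2 ^ r := by
  constructor
  · intro h
    have h1 : 5 ≤ ν.gap i * 2 ^ ν.hardRound i := Nat.sInf_mem (ν.exists_le_gap_mul hK i)
    refine h1.trans (mul_le_mul_of_nonneg_left ?_ (ν.gap_pos hK i).le)
    exact pow_le_pow_right₀ (by norm_num) h
  · intro h; exact Nat.sInf_le h

theorem hardRound_le_hardRound_best (hK : 2 ≤ K) (ν : BoundedInstance K) (i : Fin K) :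
    ν.hardRound i ≤ ν.hardRound ν.best := by
  rw [hardRound_le_iff hK]
  refine ((ν.hardRound_le_iff hK ν.best _).1 le_rfl).trans ?_
  exact mul_le_mul_of_nonneg_right (ν.gap_best_le i) (by positivity)

theorem mem_resolved {ν : BoundedInstance K} {r : ℕ} {i : Fin K} :
    i ∈ ν.resolved r ↔ i ≠ ν.best ∧ ν.hardRound i ≤ r := by simp [resolved]

theorem scaledMean_le_of_resolved (hK : 2 ≤ K) (ν : BoundedInstance K) {r : ℕ} {i : Fin K}
    (h : i ∈ ν.resolved r) : ν.scaledMean r i + 10 ≤ ν.scaledMean r ν.best := by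
  obtain ⟨h1, h2⟩ := mem_resolved.1 h
  rw [ν.hardRound_le_iff hK, ν.gap_of_ne h1] at h2
  unfold scaledMean
  rw [pow_succ]
  nlinarith

theorem scaledMean_le (ν : BoundedInstance K) (r : ℕ) (i : Fin K) :
    ν.scaledMean r i ≤ ν.scaledMean r ν.best :=
  mul_le_mul_of_nonneg_right (ν.mean_le i) (by positivity)

theorem scaledMean_nonneg (ν : BoundedInstance K) (r : ℕ) (i : Fin K) : 0 ≤ ν.scaledMean r i :=
  mul_nonneg (ν.mean_nonneg i) (by positivity)

end BoundedInstance

/-- The fraction of the weight that atypical estimates may carry. -/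
def atypicalFrac : ℝ := 1 / 2 ^ 20

open BoundedInstance

/-- A typical outcome of a pilot block: the weight of the best arm is not underestimated, and the arms
with a bad weight estimate carry little weight, both in `T` and among the resolved arms of `T`. -/
structure PilotGood (ν : BoundedInstance K) (r : ℕ) (T : Finset (Fin K)) (N : Fin K → ℕ) :
    Prop where
  best : ν.best ∈ T → ν.weight r ν.best ≤ 4 * N ν.best
  under : ∑ i ∈ T with 4 * (N i : ℝ) < ν.weight r i, ν.weight r i ≤
    atypicalFrac * ∑ i ∈ T, ν.weight r i
  excess : ∑ i ∈ T with 16 * ν.weight r i < N i, ν.weight r i ≤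
    atypicalFrac * ∑ i ∈ T, ν.weight r i
  under_resolved : ∑ i ∈ T ∩ ν.resolved r with 4 * (N i : ℝ) < ν.weight r i, ν.weight r i ≤
    atypicalFrac * ∑ i ∈ T ∩ ν.resolved r, ν.weight r i
  excess_resolved : ∑ i ∈ T ∩ ν.resolved r with 16 * ν.weight r i < N i, ν.weight r i ≤
    atypicalFrac * ∑ i ∈ T ∩ ν.resolved r, ν.weight r i
  excess_mass : ∑ i ∈ T with 16 * ν.weight r i < N i, (N i : ℝ) ≤
    atypicalFrac * ∑ i ∈ T, ν.weight r i

/-- A typical outcome of a main block. Arms whose weight was badly estimated are not considered. -/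
structure MainGood (ν : BoundedInstance K) (r : ℕ) (T : Finset (Fin K)) (N : Fin K → ℕ)
    (m : Fin K → ℤ) : Prop where
  best : ν.best ∈ T → |m ν.best - ν.scaledMean r ν.best| ≤ 2
  dev : ∑ i ∈ T with ν.weight r i ≤ 4 * N i ∧ 2 < |m i - ν.scaledMean r i|, ν.weight r i ≤
    atypicalFrac * ∑ i ∈ T, ν.weight r i
  dev_resolved : ∑ i ∈ T ∩ ν.resolved r with
      ν.weight r i ≤ 4 * N i ∧ 2 < |m i - ν.scaledMean r i|, ν.weight r i ≤
    atypicalFrac * ∑ i ∈ T ∩ ν.resolved r, ν.weight r i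

/-- A typical outcome of a level: there is a set `Z` of misjudged arms, of small weight, outside of
which all estimates are accurate. -/
structure LevelGood (ν : BoundedInstance K) (r : ℕ) (T : Finset (Fin K)) (N : Fin K → ℕ)
    (m : Fin K → ℤ) (Z : Finset (Fin K)) : Prop where
  sub : Z ⊆ T
  weight_le : ∑ i ∈ Z, ν.weight r i ≤ (∑ i ∈ T, ν.weight r i) / 16
  mass_le : ∑ i ∈ Z, (N i : ℝ) ≤ (∑ i ∈ T, ν.weight r i) / 8192
  resolved_le : ∑ i ∈ Z ∩ ν.resolved r, ν.weight r i ≤ (∑ i ∈ T ∩ ν.resolved r, ν.weight r i) / 64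
  good : ∀ i ∈ T, i ∉ Z → ν.weight r i ≤ 4 * N i ∧ N i ≤ 16 * ν.weight r i ∧
    |m i - ν.scaledMean r i| ≤ 2
  best : ν.best ∈ T → |m ν.best - ν.scaledMean r ν.best| ≤ 2

variable {ν : BoundedInstance K} {r : ℕ} {T : Finset (Fin K)} {N : Fin K → ℕ} {m : Fin K → ℤ}

theorem PilotGood.mass_le (h : PilotGood ν r T N) :
    ∑ i ∈ T, (N i : ℝ) ≤ 17 * ∑ i ∈ T, ν.weight r i := by
  rw [← Finset.sum_filter_add_sum_filter_not T (fun i => 16 * ν.weight r i < N i)]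
  have h1 : ∑ i ∈ T with ¬ 16 * ν.weight r i < N i, (N i : ℝ) ≤ 16 * ∑ i ∈ T, ν.weight r i := by
    rw [Finset.mul_sum]
    calc _ ≤ ∑ i ∈ T with ¬ 16 * ν.weight r i < N i, 16 * ν.weight r i :=
          Finset.sum_le_sum fun i hi => not_lt.1 (Finset.mem_filter.1 hi).2
      _ ≤ _ := Finset.sum_le_sum_of_subset_of_nonneg (Finset.filter_subset _ _)
          fun i _ _ => by linarith [ν.weight_pos r i]
  have h2 := h.excess_mass
  have h3 : 0 ≤ ∑ i ∈ T, ν.weight r i := Finset.sum_nonneg fun i _ => (ν.weight_pos r i).le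
  unfold atypicalFrac at h2
  norm_num at h2
  linarith

theorem sum_filter_or_le {U : Finset (Fin K)} {w : Fin K → ℝ} (hw : ∀ i, 0 ≤ w i)
    (p q : Fin K → Prop) [DecidablePred p] [DecidablePred q] :
    ∑ i ∈ U with p i ∨ q i, w i ≤ ∑ i ∈ U with p i, w i + ∑ i ∈ U with q i, w i := by
  rw [Finset.filter_or]
  have := Finset.sum_union_inter (s₁ := U.filter p) (s₂ := U.filter q) (f := w)
  have h : 0 ≤ ∑ i ∈ U.filter p ∩ U.filter q, w i := Finset.sum_nonneg fun i _ => hw i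
  linarith

theorem exists_levelGood (hP : PilotGood ν r T N) (hM : MainGood ν r T N m) :
    ∃ Z, LevelGood ν r T N m Z := by
  have hw : ∀ i, 0 ≤ ν.weight r i := fun i => (ν.weight_pos r i).le
  have hW : 0 ≤ ∑ i ∈ T, ν.weight r i := Finset.sum_nonneg fun i _ => hw i
  have hWr : 0 ≤ ∑ i ∈ T ∩ ν.resolved r, ν.weight r i := Finset.sum_nonneg fun i _ => hw i
  let atyp : Fin K → Prop := fun i => 4 * (N i : ℝ) < ν.weight r i ∨ 16 * ν.weight r i < N i ∨
    (ν.weight r i ≤ 4 * N i ∧ 2 < |m i - ν.scaledMean r i|)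
  classical
  have hsum : ∀ U : Finset (Fin K), ∀ w : Fin K → ℝ, (∀ i, 0 ≤ w i) →
      ∑ i ∈ U with atyp i, w i ≤ ∑ i ∈ U with 4 * (N i : ℝ) < ν.weight r i, w i +
        (∑ i ∈ U with 16 * ν.weight r i < N i, w i +
        ∑ i ∈ U with ν.weight r i ≤ 4 * N i ∧ 2 < |m i - ν.scaledMean r i|, w i) := by
    intro U w hw
    refine (sum_filter_or_le hw _ _).trans (add_le_add ?_ (sum_filter_or_le hw _ _))
    exact le_of_eq (Finset.sum_congr (Finset.filter_congr fun _ _ => Iff.rfl) fun _ _ => rfl)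
  refine ⟨{i ∈ T | atyp i}, Finset.filter_subset _ _, ?_, ?_, ?_, ?_, hM.best⟩
  · have h1 := hsum T _ hw
    have h2 := hP.under
    have h3 := hP.excess
    have h4 := hM.dev
    unfold atypicalFrac at h2 h3 h4
    norm_num at h2 h3 h4
    linarith
  · -- a main deviation counts only where `N i` is not an overestimate
    have h0 : ∑ i ∈ T with atyp i, (N i : ℝ) ≤ ∑ i ∈ T with 16 * ν.weight r i < N i, (N i : ℝ) +
        16 * ∑ i ∈ T with atyp i, ν.weight r i := by
      rw [← Finset.sum_filter_add_sum_filter_not ({i ∈ T | atyp i})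
        (fun i => 16 * ν.weight r i < N i)]
      refine add_le_add ?_ ?_
      · refine Finset.sum_le_sum_of_subset_of_nonneg ?_ fun i _ _ => Nat.cast_nonneg _
        exact Finset.filter_subset_filter _ (Finset.filter_subset _ _)
      · rw [Finset.mul_sum]
        refine (Finset.sum_le_sum fun i hi => not_lt.1 (Finset.mem_filter.1 hi).2).trans ?_
        exact Finset.sum_le_sum_of_subset_of_nonneg (Finset.filter_subset _ _)
          fun i _ _ => by linarith [ν.weight_pos r i]
    have h1 := hsum T _ hw
    have h2 := hP.under
    have h3 := hP.excess
    have h4 := hM.dev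
    have h5 := hP.excess_mass
    unfold atypicalFrac at h2 h3 h4 h5
    norm_num at h2 h3 h4 h5
    linarith
  · have h0 : {i ∈ T | atyp i} ∩ ν.resolved r = {i ∈ T ∩ ν.resolved r | atyp i} := by
      ext i; simp only [Finset.mem_inter, Finset.mem_filter]; tauto
    rw [h0]
    have h1 := hsum (T ∩ ν.resolved r) _ hw
    have h2 := hP.under_resolved
    have h3 := hP.excess_resolved
    have h4 := hM.dev_resolved
    unfold atypicalFrac at h2 h3 h4
    norm_num at h2 h3 h4
    linarith
  · intro i hi hiZ
    have h : ¬ atyp i := fun h => hiZ (Finset.mem_filter.2 ⟨hi, h⟩)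
    simp only [atyp, not_or, not_and, not_lt] at h
    exact ⟨h.1, h.2.1, h.2.2 h.1⟩

namespace LevelGood

variable {Z : Finset (Fin K)}

theorem le_mass (h : LevelGood ν r T N m Z) :
    15 / 64 * ∑ i ∈ T, ν.weight r i ≤ ∑ i ∈ T, (N i : ℝ) := by
  have h1 : ∑ i ∈ T \ Z, ν.weight r i ≤ 4 * ∑ i ∈ T \ Z, (N i : ℝ) := by
    rw [Finset.mul_sum]
    exact Finset.sum_le_sum fun i hi =>
      (h.good i (Finset.mem_sdiff.1 hi).1 (Finset.mem_sdiff.1 hi).2).1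
  have h2 := Finset.sum_sdiff h.sub (f := ν.weight r)
  have h3 := Finset.sum_sdiff h.sub (f := fun i => (N i : ℝ))
  have h4 : 0 ≤ ∑ i ∈ Z, (N i : ℝ) := Finset.sum_nonneg fun i _ => Nat.cast_nonneg _
  linarith [h.weight_le]

theorem mass_le' (h : LevelGood ν r T N m Z) :
    ∑ i ∈ T, (N i : ℝ) ≤ 17 * ∑ i ∈ T, ν.weight r i := by
  have h1 : ∑ i ∈ T \ Z, (N i : ℝ) ≤ 16 * ∑ i ∈ T \ Z, ν.weight r i := by
    rw [Finset.mul_sum]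
    exact Finset.sum_le_sum fun i hi =>
      (h.good i (Finset.mem_sdiff.1 hi).1 (Finset.mem_sdiff.1 hi).2).2.1
  have h2 := Finset.sum_sdiff h.sub (f := ν.weight r)
  have h3 := Finset.sum_sdiff h.sub (f := fun i => (N i : ℝ))
  have h4 : 0 ≤ ∑ i ∈ Z, ν.weight r i := Finset.sum_nonneg fun i _ => (ν.weight_pos r i).le
  have h5 : 0 ≤ ∑ i ∈ T, ν.weight r i := Finset.sum_nonneg fun i _ => (ν.weight_pos r i).le
  linarith [h.mass_le]

/-- A small fraction of the estimated weight is at most half of the weight. -/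
theorem halve (h : LevelGood ν r T N m Z) {U : Finset (Fin K)} (hU : U ⊆ T)
    (hN : 512 * ∑ i ∈ U, N i ≤ ∑ i ∈ T, N i) :
    ∑ i ∈ U, ν.weight r i ≤ (∑ i ∈ T, ν.weight r i) / 2 := by
  have hN' : 512 * ∑ i ∈ U, (N i : ℝ) ≤ ∑ i ∈ T, (N i : ℝ) := by exact_mod_cast hN
  have h1 : ∑ i ∈ U \ Z, ν.weight r i ≤ 4 * ∑ i ∈ U \ Z, (N i : ℝ) := by
    rw [Finset.mul_sum]
    exact Finset.sum_le_sum fun i hi =>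
      (h.good i (hU (Finset.mem_sdiff.1 hi).1) (Finset.mem_sdiff.1 hi).2).1
  have h2 : ∑ i ∈ U \ Z, (N i : ℝ) ≤ ∑ i ∈ U, (N i : ℝ) :=
    Finset.sum_le_sum_of_subset_of_nonneg Finset.sdiff_subset fun i _ _ => Nat.cast_nonneg _
  have h3 : ∑ i ∈ U ∩ Z, ν.weight r i ≤ ∑ i ∈ Z, ν.weight r i :=
    Finset.sum_le_sum_of_subset_of_nonneg Finset.inter_subset_right
      fun i _ _ => (ν.weight_pos r i).le
  have h4 : ∑ i ∈ U \ Z, ν.weight r i + ∑ i ∈ U ∩ Z, ν.weight r i = ∑ i ∈ U, ν.weight r i := by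
    rw [add_comm]; exact Finset.sum_inter_add_sum_sdiff U Z (ν.weight r)
  have h5 : 0 ≤ ∑ i ∈ T, ν.weight r i := Finset.sum_nonneg fun i _ => (ν.weight_pos r i).le
  linarith [h.mass_le', h.weight_le]

theorem misjudged_lt (h : LevelGood ν r T N m Z) (hT : T.Nonempty) :
    1024 * ∑ i ∈ Z, N i < ∑ i ∈ T, N i := by
  have h1 : 0 < ∑ i ∈ T, ν.weight r i := Finset.sum_pos (fun i _ => ν.weight_pos r i) hT
  have : 1024 * ∑ i ∈ Z, (N i : ℝ) < ∑ i ∈ T, (N i : ℝ) := by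
    linarith [h.mass_le, h.le_mass]
  exact_mod_cast this

theorem mass_pos (h : LevelGood ν r T N m Z) (hT : T.Nonempty) : 0 < ∑ i ∈ T, N i :=
  lt_of_le_of_lt (Nat.zero_le _) (h.misjudged_lt hT)

theorem sum_mass_mono {U V : Finset (Fin K)} (h : U ⊆ V) : ∑ i ∈ U, N i ≤ ∑ i ∈ V, N i :=
  Finset.sum_le_sum_of_subset h

/-- The cutoff does not overestimate the largest mean: the arms on or above it are not all
misjudged. -/
theorem cutoff_le (h : LevelGood ν r T N m Z) (hT : T.Nonempty) :
    (cutoff T N m : ℝ) ≤ ν.scaledMean r ν.best + 2 := by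
  obtain ⟨h1, -⟩ := isCutoff_cutoff T N m (h.mass_pos hT)
  by_contra hlt
  rw [not_le] at hlt
  have hsub : {i ∈ T | cutoff T N m ≤ m i} ⊆ Z := by
    intro i hi
    obtain ⟨hiT, hi⟩ := Finset.mem_filter.1 hi
    by_contra hiZ
    have h2 := (abs_le.1 (h.good i hiT hiZ).2.2).2
    have h3 := ν.scaledMean_le r i
    have h4 : (cutoff T N m : ℝ) ≤ m i := by exact_mod_cast hi
    linarith
  have h5 := sum_mass_mono (N := N) hsub
  have h6 := h.misjudged_lt hT
  omega

/-- If all gaps are resolved and the cutoff is not too low, then the best arm is the heaviest arm on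
or above the cutoff, since all other arms there are misjudged. -/
theorem heaviest_eq (hK : 2 ≤ K) (h : LevelGood ν r T N m Z) (hT : T.Nonempty)
    (hr : ν.hardRound ν.best ≤ r) (hq : ν.scaledMean r ν.best - 2 ≤ cutoff T N m) (j : Fin K) :
    heaviest {i ∈ T | cutoff T N m ≤ m i} N j = ν.best := by
  obtain ⟨h1, -⟩ := isCutoff_cutoff T N m (h.mass_pos hT)
  set U := {i ∈ T | cutoff T N m ≤ m i} with hU
  have hsub : ∀ i ∈ U, i ≠ ν.best → i ∈ Z := by
    intro i hi hib
    obtain ⟨hiT, hi⟩ := Finset.mem_filter.1 hi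
    by_contra hiZ
    have h2 := (abs_le.1 (h.good i hiT hiZ).2.2).2
    have h3 := ν.scaledMean_le_of_resolved hK (mem_resolved.2
      ⟨hib, (ν.hardRound_le_hardRound_best hK i).trans hr⟩)
    have h4 : (cutoff T N m : ℝ) ≤ m i := by exact_mod_cast hi
    linarith
  have h6 := h.misjudged_lt hT
  have hle : ∑ i ∈ U, N i ≤ N ν.best + ∑ i ∈ Z, N i := by
    have h7 : U ⊆ insert ν.best Z := fun i hi => by
      by_cases hib : i = ν.best
      · simp [hib]
      · exact Finset.mem_insert_of_mem (hsub i hi hib)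
    refine (sum_mass_mono h7).trans ?_
    by_cases hb : ν.best ∈ Z
    · rw [Finset.insert_eq_of_mem hb]; omega
    · rw [Finset.sum_insert hb]
  have hbU : ν.best ∈ U := by
    by_contra hb
    have := sum_mass_mono (N := N) (U := U) (V := Z) fun i hi =>
      hsub i hi fun hib => hb (hib ▸ hi)
    omega
  obtain ⟨h8, h9⟩ := heaviest_spec N j ⟨_, hbU⟩
  by_contra hne
  have h10 := hsub _ h8 hne
  have h11 : N (heaviest U N j) ≤ ∑ i ∈ Z, N i :=
    Finset.single_le_sum (f := N) (fun _ _ => Nat.zero_le _) h10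
  have h12 := h9 _ hbU
  omega

end LevelGood

/-! ### The invariant and the potentials -/

namespace BoundedInstance

/-- A bound for the weight that arm `i` contributes to round `r` in a typical run: its weight, as long
as its gap is not resolved; from then on the contributions of the resolved arms decrease
geometrically, as these arms survive only if they are misjudged. -/
def share (ν : BoundedInstance K) (r : ℕ) (i : Fin K) : ℝ :=
  ν.weight (min r (ν.hardRound i)) i * (1 / 4) ^ (r - ν.hardRound i)

/-- A bound for the weight of the arms that survive to round `r` in a typical run. -/
def roundWeight (ν : BoundedInstance K) (r : ℕ) : ℝ := ∑ i, ν.share r i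

theorem share_pos (ν : BoundedInstance K) (r : ℕ) (i : Fin K) : 0 < ν.share r i :=
  mul_pos (ν.weight_pos _ i) (by positivity)

theorem roundWeight_nonneg (ν : BoundedInstance K) (r : ℕ) : 0 ≤ ν.roundWeight r :=
  Finset.sum_nonneg fun i _ => (ν.share_pos r i).le

theorem share_of_le (ν : BoundedInstance K) {r : ℕ} {i : Fin K} (h : r ≤ ν.hardRound i) :
    ν.share r i = ν.weight r i := by
  unfold share; rw [min_eq_left h, Nat.sub_eq_zero_of_le h]; simp

theorem share_succ (ν : BoundedInstance K) {r : ℕ} {i : Fin K} (h : ν.hardRound i ≤ r) :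
    ν.share (r + 1) i = ν.share r i / 4 := by
  unfold share
  rw [min_eq_right h, min_eq_right (by omega), Nat.succ_sub h, pow_succ]
  ring

theorem weight_succ_le (ν : BoundedInstance K) (r : ℕ) (i : Fin K) :
    ν.weight (r + 1) i ≤ 4 * ν.weight r i := by
  unfold weight
  rw [pow_succ, pow_succ]
  have : (0 : ℝ) < 2 ^ r := by positivity
  linarith

theorem two_mul_weight_le (ν : BoundedInstance K) (r : ℕ) (i : Fin K) :
    2 * ν.weight r i ≤ ν.weight (r + 1) i := by
  unfold weight
  rw [pow_succ, pow_succ]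
  have : (0 : ℝ) ≤ ν.var i * 4 ^ r := mul_nonneg (ν.var_nonneg i) (by positivity)
  linarith

theorem sum_weight_le_roundWeight (ν : BoundedInstance K) {r : ℕ}
    (hr : r ≤ ν.hardRound ν.best) {S : Finset (Fin K)}
    (hS : ∑ i ∈ S ∩ ν.resolved r, ν.weight r i ≤ ∑ i ∈ ν.resolved r, ν.share r i) :
    ∑ i ∈ S, ν.weight r i ≤ ν.roundWeight r := by
  rw [← Finset.sum_inter_add_sum_sdiff S (ν.resolved r), roundWeight,
    ← Finset.sum_inter_add_sum_sdiff Finset.univ (ν.resolved r), Finset.univ_inter]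
  refine add_le_add hS ?_
  calc ∑ i ∈ S \ ν.resolved r, ν.weight r i = ∑ i ∈ S \ ν.resolved r, ν.share r i := by
        refine Finset.sum_congr rfl fun i hi => (ν.share_of_le ?_).symm
        have h := (Finset.mem_sdiff.1 hi).2
        by_cases hib : i = ν.best
        · rw [hib]; exact hr
        · by_contra hlt
          exact h (mem_resolved.2 ⟨hib, (not_le.1 hlt).le⟩)
    _ ≤ _ := Finset.sum_le_sum_of_subset_of_nonneg
        (Finset.sdiff_subset_sdiff (Finset.subset_univ _) le_rfl) fun i _ _ => (ν.share_pos r i).le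

/-- The surviving resolved weight in the next round, if resolved arms survive only with a small part
of their weight. -/
theorem sum_weight_succ_le (ν : BoundedInstance K) {r : ℕ} {S : Finset (Fin K)}
    (hS : ∑ i ∈ S ∩ ν.resolved r, ν.weight r i ≤ (∑ i ∈ ν.resolved r, ν.share r i) / 64) :
    ∑ i ∈ S ∩ ν.resolved (r + 1), ν.weight (r + 1) i ≤
      ∑ i ∈ ν.resolved (r + 1), ν.share (r + 1) i := by
  have hsub : ν.resolved r ⊆ ν.resolved (r + 1) := fun i hi => by
    rw [mem_resolved] at hi ⊢; exact ⟨hi.1, by omega⟩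
  rw [← Finset.sum_inter_add_sum_sdiff (S ∩ ν.resolved (r + 1)) (ν.resolved r),
    ← Finset.sum_inter_add_sum_sdiff (ν.resolved (r + 1)) (ν.resolved r),
    Finset.inter_assoc, Finset.inter_eq_right.2 hsub]
  refine add_le_add ?_ ?_
  · have h1 : ∑ i ∈ S ∩ ν.resolved r, ν.weight (r + 1) i ≤
        4 * ∑ i ∈ S ∩ ν.resolved r, ν.weight r i := by
      rw [Finset.mul_sum]; exact Finset.sum_le_sum fun i _ => ν.weight_succ_le r i
    have h2 : ∑ i ∈ ν.resolved r, ν.share (r + 1) i = (∑ i ∈ ν.resolved r, ν.share r i) / 4 := by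
      rw [Finset.sum_div]
      exact Finset.sum_congr rfl fun i hi => ν.share_succ (mem_resolved.1 hi).2
    have h3 : 0 ≤ ∑ i ∈ ν.resolved r, ν.share r i :=
      Finset.sum_nonneg fun i _ => (ν.share_pos r i).le
    linarith
  · calc ∑ i ∈ (S ∩ ν.resolved (r + 1)) \ ν.resolved r, ν.weight (r + 1) i
        = ∑ i ∈ (S ∩ ν.resolved (r + 1)) \ ν.resolved r, ν.share (r + 1) i := by
          refine Finset.sum_congr rfl fun i hi => (ν.share_of_le ?_).symm
          obtain ⟨h1, h2⟩ := Finset.mem_sdiff.1 hi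
          have h3 := mem_resolved.1 (Finset.mem_inter.1 h1).2
          by_contra hlt
          exact h2 (mem_resolved.2 ⟨h3.1, by omega⟩)
      _ ≤ _ := Finset.sum_le_sum_of_subset_of_nonneg
          (Finset.sdiff_subset_sdiff Finset.inter_subset_right le_rfl)
          fun i _ _ => (ν.share_pos _ i).le

end BoundedInstance

open BoundedInstance

/-- The invariant of a typical run before a pilot block. Lengths are in units of `2^(-(r+1))`, so that
the accuracy is `2`. -/
structure CtxInv (ν : BoundedInstance K) (c : Ctx K) : Prop where
  best_mem : ν.best ∈ c.S
  sub : c.T ⊆ c.S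
  nonempty : c.T.Nonempty
  round_le : c.r ≤ ν.hardRound ν.best
  weight_le : ∑ i ∈ c.T, ν.weight c.r i ≤ (1 / 2) ^ c.ℓ * ν.roundWeight c.r
  resolved_le : ∑ i ∈ c.S ∩ ν.resolved c.r, ν.weight c.r i ≤ ∑ i ∈ ν.resolved c.r, ν.share c.r i
  θ_le : (c.θ : ℝ) ≤ ν.scaledMean c.r ν.best + 2
  candidate : ν.hardRound ν.best ≤ c.r → ν.scaledMean c.r ν.best - 2 ≤ c.θ → c.j = ν.best
  search : c.verify = false → ν.best ∈ c.T ∨ ν.scaledMean c.r ν.best - 2 ≤ c.θ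
  le_θ : c.verify = true → ν.scaledMean c.r ν.best - 2 ≤ c.θ
  best_sampled : c.verify = true → c.j ≠ ν.best → ν.best ∈ c.T
  first_level : c.verify = true → c.ℓ = 0 → c.T = c.S
  later_level : c.verify = true → c.ℓ ≠ 0 → ∑ i ∈ c.S ∩ ν.resolved c.r, ν.weight c.r i ≤
    (∑ i ∈ ν.resolved c.r, ν.share c.r i) / 64

/-- The invariant of a typical run. -/
def Inv (ν : BoundedInstance K) : State K → Prop
  | .done j => j = ν.best
  | .pilot c => CtxInv ν c
  | .main c N => CtxInv ν c ∧ PilotGood ν c.r c.T N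

/-- The cost of level `ℓ` relative to the weight of the round. -/
def levelCost (A r ℓ : ℕ) : ℝ := (1 / 2) ^ ℓ * (roundConf A r + ℓ)

/-- The relative cost `∑ k ≥ ℓ, levelCost A r k` of the levels from `ℓ` on. -/
def tailCost (A r ℓ : ℕ) : ℝ := 2 * (1 / 2) ^ ℓ * (roundConf A r + ℓ + 1)

theorem tailCost_eq (A r ℓ : ℕ) : tailCost A r ℓ = levelCost A r ℓ + tailCost A r (ℓ + 1) := by
  unfold tailCost levelCost; rw [pow_succ]; push_cast; ring

theorem tailCost_nonneg (A r ℓ : ℕ) : 0 ≤ tailCost A r ℓ := by unfold tailCost; positivity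

theorem levelCost_nonneg (A r ℓ : ℕ) : 0 ≤ levelCost A r ℓ := by unfold levelCost; positivity

/-- The cost of the rounds from `r` on. -/
def roundsCost (ν : BoundedInstance K) (A r : ℕ) : ℝ :=
  ∑ s ∈ Finset.Ico r (ν.hardRound ν.best + 1), 8192 * ν.roundWeight s * tailCost A s 0

theorem roundsCost_nonneg (ν : BoundedInstance K) (A r : ℕ) : 0 ≤ roundsCost ν A r :=
  Finset.sum_nonneg fun s _ => mul_nonneg (mul_nonneg (by norm_num) (ν.roundWeight_nonneg s))
    (tailCost_nonneg A s 0)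

theorem roundsCost_eq (ν : BoundedInstance K) (A : ℕ) {r : ℕ} (hr : r ≤ ν.hardRound ν.best) :
    roundsCost ν A r = 8192 * ν.roundWeight r * tailCost A r 0 + roundsCost ν A (r + 1) :=
  Finset.sum_eq_sum_Ico_succ_bot (by omega) _

/-- The time potential before a pilot block: a bound for the number of pulls to come. -/
def ctxPot (ν : BoundedInstance K) (A : ℕ) (c : Ctx K) : ℝ :=
  4096 * ν.roundWeight c.r *
    (tailCost A c.r c.ℓ + if c.verify then 0 else tailCost A c.r 0) + roundsCost ν A (c.r + 1)

/-- The time potential. -/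
def pot (ν : BoundedInstance K) (A : ℕ) : State K → ℝ
  | .done _ => 0
  | .pilot c => ctxPot ν A c
  | .main c _ => ctxPot ν A c - 2048 * ν.roundWeight c.r * levelCost A c.r c.ℓ

/-- A bound for the probability that level `ℓ` of round `r` is atypical. -/
def levelFail (κ : ℝ) (r ℓ : ℕ) : ℝ := κ * (1 / 2) ^ ℓ / ((r + 1) * (r + 2))

/-- The failure potential before a pilot block: a bound for the probability that an atypical level is
to come. It uses `∑ s > r, 1 / ((s + 1) (s + 2)) = 1 / (r + 2)`. -/
def ctxFail (κ : ℝ) (c : Ctx K) : ℝ :=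
  2 * levelFail κ c.r c.ℓ + (if c.verify then 0 else 2 * levelFail κ c.r 0) + 4 * κ / (c.r + 2)

/-- The failure potential. -/
def fail (κ : ℝ) : State K → ℝ
  | .done _ => 0
  | .pilot c => ctxFail κ c
  | .main c _ => ctxFail κ c - levelFail κ c.r c.ℓ / 2

theorem levelFail_nonneg {κ : ℝ} (hκ : 0 ≤ κ) (r ℓ : ℕ) : 0 ≤ levelFail κ r ℓ := by
  unfold levelFail; positivity

theorem levelFail_succ (κ : ℝ) (r ℓ : ℕ) : 2 * levelFail κ r (ℓ + 1) = levelFail κ r ℓ := by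
  unfold levelFail; rw [pow_succ]; ring

theorem le_ctxPot (ν : BoundedInstance K) (A : ℕ) (c : Ctx K) :
    4096 * ν.roundWeight c.r * levelCost A c.r c.ℓ ≤ ctxPot ν A c := by
  have h1 := ν.roundWeight_nonneg c.r
  have h2 := roundsCost_nonneg ν A (c.r + 1)
  have h3 := tailCost_eq A c.r c.ℓ
  have h4 := tailCost_nonneg A c.r (c.ℓ + 1)
  have h5 : 0 ≤ if c.verify then 0 else tailCost A c.r 0 := by
    split_ifs
    · exact le_rfl
    · exact tailCost_nonneg _ _ _
  unfold ctxPot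
  have h6 : 4096 * ν.roundWeight c.r * levelCost A c.r c.ℓ ≤ 4096 * ν.roundWeight c.r *
      (tailCost A c.r c.ℓ + if c.verify then 0 else tailCost A c.r 0) :=
    mul_le_mul_of_nonneg_left (by linarith) (by linarith)
  linarith

theorem le_ctxFail {κ : ℝ} (hκ : 0 ≤ κ) (c : Ctx K) : levelFail κ c.r c.ℓ ≤ ctxFail κ c := by
  have h1 := levelFail_nonneg hκ c.r c.ℓ
  have h2 : 0 ≤ 4 * κ / ((c.r : ℝ) + 2) := by positivity
  have h3 : 0 ≤ if c.verify then 0 else 2 * levelFail κ c.r 0 := by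
    split_ifs
    · exact le_rfl
    · linarith [levelFail_nonneg hκ c.r 0]
  unfold ctxFail
  linarith

/-- The state `s` continues a typical run from a level with variables `c`: the invariant holds, and
the potentials have decreased by the contribution of the level. -/
def GoodNext (ν : BoundedInstance K) (A : ℕ) (κ : ℝ) (c : Ctx K) (s : State K) : Prop :=
  Inv ν s ∧ pot ν A s + 4096 * ν.roundWeight c.r * levelCost A c.r c.ℓ ≤ ctxPot ν A c ∧
    fail κ s + levelFail κ c.r c.ℓ ≤ ctxFail κ c

theorem goodNext_done (ν : BoundedInstance K) (A : ℕ) {κ : ℝ} (hκ : 0 ≤ κ) (c : Ctx K) :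
    GoodNext ν A κ c (.done ν.best) :=
  ⟨rfl, by simpa [pot] using le_ctxPot ν A c, by simpa [fail] using le_ctxFail hκ c⟩

/-- The next level of the same phase. -/
theorem goodNext_level {ν : BoundedInstance K} (A : ℕ) (κ : ℝ) {c c' : Ctx K}
    (hI : CtxInv ν c') (hv : c'.verify = c.verify) (hr : c'.r = c.r) (hℓ : c'.ℓ = c.ℓ + 1) :
    GoodNext ν A κ c (.pilot c') := by
  refine ⟨hI, ?_, ?_⟩
  · simp only [pot, ctxPot, hv, hr, hℓ]
    rw [tailCost_eq A c.r c.ℓ]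
    exact le_of_eq (by ring)
  · simp only [fail, ctxFail, hv, hr, hℓ, levelFail_succ]
    exact le_of_eq (by ring)

/-- The passage to the verification phase. -/
theorem goodNext_verify {ν : BoundedInstance K} (A : ℕ) {κ : ℝ} (hκ : 0 ≤ κ) {c c' : Ctx K}
    (hI : CtxInv ν c') (hv : c.verify = false) (hv' : c'.verify = true) (hr : c'.r = c.r)
    (hℓ : c'.ℓ = 0) : GoodNext ν A κ c (.pilot c') := by
  refine ⟨hI, ?_, ?_⟩
  · simp only [pot, ctxPot, hv, hv', hr, hℓ, if_true, Bool.false_eq_true, if_false]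
    rw [tailCost_eq A c.r c.ℓ]
    have h1 := mul_nonneg (ν.roundWeight_nonneg c.r) (tailCost_nonneg A c.r (c.ℓ + 1))
    linarith
  · simp only [fail, ctxFail, hv, hv', hr, hℓ, if_true, Bool.false_eq_true, if_false]
    linarith [levelFail_nonneg hκ c.r c.ℓ]

/-- The passage to the next round. -/
theorem goodNext_round {ν : BoundedInstance K} (A : ℕ) {κ : ℝ} (hκ : 0 ≤ κ) {c c' : Ctx K}
    (hI : CtxInv ν c') (hv' : c'.verify = false)
    (hr : c'.r = c.r + 1) (hℓ : c'.ℓ = 0) : GoodNext ν A κ c (.pilot c') := by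
  have hround := hI.round_le
  rw [hr] at hround
  refine ⟨hI, ?_, ?_⟩
  · have h1 : pot ν A (.pilot c') = roundsCost ν A (c.r + 1) := by
      rw [roundsCost_eq ν A hround]
      simp only [pot, ctxPot, hv', hr, hℓ, Bool.false_eq_true, if_false]
      ring
    have h2 : ctxPot ν A c - roundsCost ν A (c.r + 1) ≥
        4096 * ν.roundWeight c.r * levelCost A c.r c.ℓ := by
      unfold ctxPot
      rw [add_sub_cancel_right]
      refine mul_le_mul_of_nonneg_left ?_ (by linarith [ν.roundWeight_nonneg c.r])
      have h3 := tailCost_eq A c.r c.ℓ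
      have h4 := tailCost_nonneg A c.r (c.ℓ + 1)
      split_ifs
      · linarith
      · linarith [tailCost_nonneg A c.r 0]
    linarith
  · have h1 : fail κ (.pilot c') = 4 * κ / ((c.r : ℝ) + 2) := by
      simp only [fail, ctxFail, levelFail, hv', hr, hℓ, Bool.false_eq_true, if_false]
      push_cast
      field_simp
      ring
    rw [h1]
    have h3 := levelFail_nonneg hκ c.r c.ℓ
    have h4 := levelFail_nonneg hκ c.r 0
    unfold ctxFail
    split_ifs <;> linarith

/-! ### Typical levels keep the invariant -/

variable {ν : BoundedInstance K} {c : Ctx K} {N : Fin K → ℕ} {m : Fin K → ℤ}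
  {Z : Finset (Fin K)}

theorem half_pow_succ_mul {W w w' : ℝ} {ℓ : ℕ} (h : w ≤ (1 / 2) ^ ℓ * W) (h' : w' ≤ w / 2) :
    w' ≤ (1 / 2) ^ (ℓ + 1) * W := by
  rw [pow_succ]; linarith

theorem goodNext_search (hK : 2 ≤ K) (A : ℕ) {κ : ℝ} (hκ : 0 ≤ κ) (hI : CtxInv ν c)
    (hv : c.verify = false) (hL : LevelGood ν c.r c.T N m Z) :
    GoodNext ν A κ c (c.search N m) := by
  have hT := hI.nonempty
  obtain ⟨-, hq2⟩ := isCutoff_cutoff c.T N m (hL.mass_pos hT)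
  have hqle := hL.cutoff_le hT
  unfold Ctx.search
  set q := cutoff c.T N m with hq
  set T' := {i ∈ c.T | q < m i} with hT'
  simp only
  set θ' := if c.θ < q then q else c.θ with hθ'
  set j' := if c.θ < q then heaviest {i ∈ c.T | q ≤ m i} N c.j else c.j with hj'
  have hsub : T' ⊆ c.T := Finset.filter_subset _ _
  have hθmax : c.θ ≤ θ' ∧ q ≤ θ' := by rw [hθ']; split_ifs <;> omega
  have hθle : (θ' : ℝ) ≤ ν.scaledMean c.r ν.best + 2 := by
    rw [hθ']; split_ifs
    · exact hqle
    · exact hI.θ_le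
  have hcand : ν.hardRound ν.best ≤ c.r → ν.scaledMean c.r ν.best - 2 ≤ θ' → j' = ν.best := by
    intro hr hθ
    rw [hθ'] at hθ
    rw [hj']
    split_ifs at hθ ⊢
    · exact hL.heaviest_eq hK hT hr hθ c.j
    · exact hI.candidate hr hθ
  have hsearch : ν.best ∈ T' ∨ ν.scaledMean c.r ν.best - 2 ≤ θ' := by
    rcases hI.search hv with hb | hθ
    · by_cases hqb : q < m ν.best
      · exact Or.inl (Finset.mem_filter.2 ⟨hb, hqb⟩)
      · right
        have h1 := (abs_le.1 (hL.best hb)).1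
        have h2 : m ν.best ≤ θ' := by omega
        have h3 : (m ν.best : ℝ) ≤ θ' := by exact_mod_cast h2
        linarith
    · right
      have : (c.θ : ℝ) ≤ θ' := by exact_mod_cast hθmax.1
      linarith
  split_ifs with hempty
  · refine goodNext_verify A hκ ?_ hv rfl rfl rfl
    have hle : ν.scaledMean c.r ν.best - 2 ≤ θ' := by
      rcases hsearch with h | h
      · exact absurd h ((Finset.eq_empty_iff_forall_notMem.1 hempty) _)
      · exact h
    exact {
      best_mem := hI.best_mem
      sub := subset_rfl
      nonempty := ⟨_, hI.best_mem⟩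
      round_le := hI.round_le
      weight_le := by
        rw [pow_zero, one_mul]; exact ν.sum_weight_le_roundWeight hI.round_le hI.resolved_le
      resolved_le := hI.resolved_le
      θ_le := hθle
      candidate := hcand
      search := fun h => by simp at h
      le_θ := fun _ => hle
      best_sampled := fun _ _ => hI.best_mem
      first_level := fun _ _ => rfl
      later_level := fun _ h => by simp at h }
  · refine goodNext_level A κ ?_ hv.symm rfl rfl
    exact {
      best_mem := hI.best_mem
      sub := hsub.trans hI.sub
      nonempty := Finset.nonempty_iff_ne_empty.2 hempty
      round_le := hI.round_le
      weight_le := half_pow_succ_mul hI.weight_le (hL.halve hsub hq2)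
      resolved_le := hI.resolved_le
      θ_le := hθle
      candidate := hcand
      search := fun _ => hsearch
      le_θ := fun h => by simp at h
      best_sampled := fun h => by simp at h
      first_level := fun h => by simp at h
      later_level := fun h => by simp at h }

theorem goodNext_check (hK : 2 ≤ K) (A : ℕ) {κ : ℝ} (hκ : 0 ≤ κ) (hI : CtxInv ν c)
    (hv : c.verify = true) (hL : LevelGood ν c.r c.T N m Z) :
    GoodNext ν A κ c (c.check N m) := by
  have hT := hI.nonempty
  have hle := hI.le_θ hv
  unfold Ctx.check
  set E := {i ∈ c.T | m i + 4 < c.θ} with hE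
  simp only
  set T' := (c.T \ E).erase c.j with hT'
  have hbE : ν.best ∉ E := by
    intro hb
    obtain ⟨hb, hlt⟩ := Finset.mem_filter.1 hb
    have h1 := (abs_le.1 (hL.best hb)).1
    have h2 := hI.θ_le
    have h3 : (m ν.best : ℝ) + 4 < c.θ := by exact_mod_cast hlt
    linarith
  have hZ : ∀ i ∈ c.T \ E, i ∈ ν.resolved c.r → i ∈ Z := by
    intro i hi hres
    obtain ⟨hiT, hiE⟩ := Finset.mem_sdiff.1 hi
    by_contra hiZ
    have h1 := (abs_le.1 (hL.good i hiT hiZ).2.2).2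
    have h2 := ν.scaledMean_le_of_resolved hK hres
    refine hiE (Finset.mem_filter.2 ⟨hiT, ?_⟩)
    have h3 : (m i : ℝ) + 4 < c.θ := by linarith
    exact_mod_cast h3
  have hsub : T' ⊆ c.T := (Finset.erase_subset _ _).trans Finset.sdiff_subset
  have hbest : c.j ≠ ν.best → ν.best ∈ T' := fun hj => Finset.mem_erase.2
    ⟨hj.symm, Finset.mem_sdiff.2 ⟨hI.best_sampled hv hj, hbE⟩⟩
  have hbS : ν.best ∈ c.S \ E := Finset.mem_sdiff.2 ⟨hI.best_mem, hbE⟩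
  have hshare : 0 ≤ ∑ i ∈ ν.resolved c.r, ν.share c.r i :=
    Finset.sum_nonneg fun i _ => (ν.share_pos _ i).le
  have hres : ∑ i ∈ (c.S \ E) ∩ ν.resolved c.r, ν.weight c.r i ≤
      (∑ i ∈ ν.resolved c.r, ν.share c.r i) / 64 := by
    by_cases hℓ : c.ℓ = 0
    · have hTS := hI.first_level hv hℓ
      calc ∑ i ∈ (c.S \ E) ∩ ν.resolved c.r, ν.weight c.r i
          ≤ ∑ i ∈ Z ∩ ν.resolved c.r, ν.weight c.r i := by
            refine Finset.sum_le_sum_of_subset_of_nonneg ?_ fun i _ _ => (ν.weight_pos _ i).le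
            intro i hi
            obtain ⟨h1, h2⟩ := Finset.mem_inter.1 hi
            rw [← hTS] at h1
            exact Finset.mem_inter.2 ⟨hZ i h1 h2, h2⟩
        _ ≤ (∑ i ∈ c.T ∩ ν.resolved c.r, ν.weight c.r i) / 64 := hL.resolved_le
        _ ≤ _ := by
            have := hI.resolved_le
            rw [← hTS] at this
            linarith
    · refine le_trans ?_ (hI.later_level hv hℓ)
      exact Finset.sum_le_sum_of_subset_of_nonneg
        (Finset.inter_subset_inter_right Finset.sdiff_subset) fun i _ _ => (ν.weight_pos _ i).le
  split_ifs with hempty hcont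
  · have hj : c.j = ν.best := by
      by_contra hj
      have := hbest hj
      rw [hempty] at this
      simp at this
    rw [hj]
    exact goodNext_done ν A hκ c
  · refine goodNext_level A κ ?_ hv.symm rfl rfl
    exact {
      best_mem := hbS
      sub := fun i hi => by
        obtain ⟨h1, h2⟩ := Finset.mem_sdiff.1 (Finset.mem_of_mem_erase hi)
        exact Finset.mem_sdiff.2 ⟨hI.sub h1, h2⟩
      nonempty := Finset.nonempty_iff_ne_empty.2 hempty
      round_le := hI.round_le
      weight_le := half_pow_succ_mul hI.weight_le (hL.halve hsub hcont)
      resolved_le := hres.trans (by linarith)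
      θ_le := hI.θ_le
      candidate := hI.candidate
      search := fun h => by simp at h
      le_θ := fun _ => hle
      best_sampled := fun _ => hbest
      first_level := fun _ h => by simp at h
      later_level := fun _ _ => hres }
  · -- with all gaps resolved, the arms left besides the candidate are misjudged, hence light
    have hround : c.r + 1 ≤ ν.hardRound ν.best := by
      by_contra hlt
      have hr : ν.hardRound ν.best ≤ c.r := by omega
      have hj := hI.candidate hr hle
      have h1 : T' ⊆ Z := fun i hi => by
        obtain ⟨h2, h3⟩ := Finset.mem_erase.1 hi
        exact hZ i h3 (mem_resolved.2 ⟨by rwa [hj] at h2,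
          (ν.hardRound_le_hardRound_best hK i).trans hr⟩)
      have h4 := LevelGood.sum_mass_mono (N := N) h1
      have h5 := hL.misjudged_lt hT
      omega
    have hresn := ν.sum_weight_succ_le hres
    refine goodNext_round A hκ ?_ rfl rfl rfl
    exact {
      best_mem := hbS
      sub := subset_rfl
      nonempty := ⟨_, hbS⟩
      round_le := hround
      weight_le := by
        rw [pow_zero, one_mul]; exact ν.sum_weight_le_roundWeight hround hresn
      resolved_le := hresn
      θ_le := by push_cast; linarith [ν.scaledMean_nonneg (c.r + 1) ν.best]
      candidate := fun _ h => by
        push_cast at h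
        linarith [ν.scaledMean_nonneg (c.r + 1) ν.best]
      search := fun _ => Or.inl hbS
      le_θ := fun h => by simp at h
      best_sampled := fun h => by simp at h
      first_level := fun h => by simp at h
      later_level := fun h => by simp at h }

theorem goodNext_next (hK : 2 ≤ K) (A : ℕ) {κ : ℝ} (hκ : 0 ≤ κ) (hI : CtxInv ν c)
    (hL : LevelGood ν c.r c.T N m Z) : GoodNext ν A κ c (c.next N m) := by
  unfold Ctx.next
  cases hv : c.verify with
  | false => simpa using goodNext_search hK A hκ hI hv hL
  | true => simpa using goodNext_check hK A hκ hI hv hL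

/-! ### Levels are typical with high probability -/

section Typical

variable {Ω : Type*} [MeasurableSpace Ω] {P : Measure Ω} [IsProbabilityMeasure P]

theorem measureReal_weighted_markov_pred {ι : Type*} {T : Finset ι} {E : ι → Ω → Prop}
    {w : ι → ℝ} [∀ ω, DecidablePred fun i => E i ω] (hE : ∀ i ∈ T, MeasurableSet {ω | E i ω})
    (hw : ∀ i ∈ T, 0 < w i) {p : ℝ} (hp : 0 ≤ p) (hEp : ∀ i ∈ T, P.real {ω | E i ω} ≤ p) :
    P.real {ω | ¬ ∑ i ∈ T with E i ω, w i ≤ atypicalFrac * ∑ i ∈ T, w i} ≤ 2 ^ 20 * p := by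
  classical
  have h := measureReal_weighted_markov_filter (E := fun i => {ω | E i ω}) hE hw
    (η := atypicalFrac) (by unfold atypicalFrac; positivity) hp hEp
  have h0 : p / atypicalFrac = 2 ^ 20 * p := by unfold atypicalFrac; ring
  rw [h0] at h
  refine le_trans (le_of_eq (congrArg _ ?_)) h
  ext ω
  simp only [Set.mem_ofPred_eq, not_le]

/-- Union bound over the conditions of `PilotGood`, with `1 + 5 * 2 ^ 20 ≤ 2 ^ 23`. -/
theorem measureReal_not_pilotGood_le (ν : BoundedInstance K) (r : ℕ) (T : Finset (Fin K))
    {N : Ω → Fin K → ℕ} (hN : ∀ i, Measurable fun ω => N ω i) {p : ℝ} (hp : 0 ≤ p)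
    (hunder : ∀ i ∈ T, P.real {ω | 4 * (N ω i : ℝ) < ν.weight r i} ≤ p)
    (hexcess : ∀ i ∈ T, P.real {ω | 16 * ν.weight r i < N ω i} ≤ p)
    (hint : ∀ i ∈ T, Integrable ({ω | 16 * ν.weight r i < N ω i}.indicator fun ω => (N ω i : ℝ)) P)
    (hmass : ∀ i ∈ T, ∫ ω, {ω | 16 * ν.weight r i < N ω i}.indicator (fun ω => (N ω i : ℝ)) ω ∂P ≤
      p * ν.weight r i) :
    P.real {ω | ¬ PilotGood ν r T (N ω)} ≤ 2 ^ 23 * p := by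
  have hw : ∀ i, 0 < ν.weight r i := ν.weight_pos r
  have hNr : ∀ i, Measurable fun ω => (N ω i : ℝ) := fun i =>
    (measurable_from_top (f := fun n : ℕ => (n : ℝ))).comp (hN i)
  have hmu : ∀ i, MeasurableSet {ω | 4 * (N ω i : ℝ) < ν.weight r i} := fun i =>
    measurableSet_lt ((hNr i).const_mul 4) measurable_const
  have hme : ∀ i, MeasurableSet {ω | 16 * ν.weight r i < N ω i} := fun i =>
    measurableSet_lt measurable_const (hNr i)
  have h1 : P.real {ω | ν.best ∈ T ∧ 4 * (N ω ν.best : ℝ) < ν.weight r ν.best} ≤ p := by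
    by_cases hb : ν.best ∈ T
    · simpa [hb] using hunder _ hb
    · simpa [hb] using hp
  have h2 := measureReal_weighted_markov_pred (P := P) (w := ν.weight r) (T := T)
    (fun i _ => hmu i) (fun i _ => hw i) hp hunder
  have h3 := measureReal_weighted_markov_pred (P := P) (w := ν.weight r) (T := T)
    (fun i _ => hme i) (fun i _ => hw i) hp hexcess
  have h4 := measureReal_weighted_markov_pred (P := P) (w := ν.weight r) (T := T ∩ ν.resolved r)
    (fun i _ => hmu i) (fun i _ => hw i) hp fun i hi => hunder i (Finset.mem_inter.1 hi).1
  have h5 := measureReal_weighted_markov_pred (P := P) (w := ν.weight r) (T := T ∩ ν.resolved r)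
    (fun i _ => hme i) (fun i _ => hw i) hp fun i hi => hexcess i (Finset.mem_inter.1 hi).1
  have h6 : P.real {ω | ¬ ∑ i ∈ T with 16 * ν.weight r i < N ω i, (N ω i : ℝ) ≤
      atypicalFrac * ∑ i ∈ T, ν.weight r i} ≤ 2 ^ 20 * p := by
    have h := measureReal_weighted_markov (P := P) (T := T) (w := ν.weight r)
      (fun i _ ω => Set.indicator_nonneg (fun ω _ => Nat.cast_nonneg (N ω i)) ω) hint
      (fun i _ => hw i) (η := atypicalFrac) (by unfold atypicalFrac; positivity) hp hmass
    have h0 : p / atypicalFrac = 2 ^ 20 * p := by unfold atypicalFrac; ring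
    rw [h0] at h
    refine le_trans (le_of_eq (congrArg _ ?_)) h
    ext ω
    simp only [Set.mem_ofPred_eq, not_le, Finset.sum_filter, Set.indicator_apply]
  have hU := (measureReal_union_le _ _).trans (add_le_add h1 ((measureReal_union_le _ _).trans
    (add_le_add h2 ((measureReal_union_le _ _).trans (add_le_add h3
    ((measureReal_union_le _ _).trans (add_le_add h4 ((measureReal_union_le _ _).trans
    (add_le_add h5 h6)))))))))
  refine (measureReal_mono (fun ω hω => ?_) (measure_ne_top _ _)).trans (hU.trans ?_)
  · simp only [Set.mem_union, Set.mem_ofPred_eq] at hω ⊢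
    by_contra h
    push Not at h
    obtain ⟨g1, g2, g3, g4, g5, g6⟩ := h
    exact hω ⟨g1, g2, g3, g4, g5, g6⟩
  · norm_num; linarith

/-- Union bound over the conditions of `MainGood`, with `2 + 2 * 2 ^ 21 ≤ 2 ^ 23`. -/
theorem measureReal_not_mainGood_le (ν : BoundedInstance K) (r : ℕ) (T : Finset (Fin K))
    {N : Fin K → ℕ} {m : Ω → Fin K → ℤ} (hm : ∀ i, Measurable fun ω => m ω i) {p : ℝ}
    (hp : 0 ≤ p) (hbest : ν.best ∈ T → ν.weight r ν.best ≤ 4 * N ν.best)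
    (hdev : ∀ i ∈ T, ν.weight r i ≤ 4 * N i →
      P.real {ω | 2 < |(m ω i : ℝ) - ν.scaledMean r i|} ≤ 2 * p) :
    P.real {ω | ¬ MainGood ν r T N (m ω)} ≤ 2 ^ 23 * p := by
  have hw : ∀ i, 0 < ν.weight r i := ν.weight_pos r
  have hmr : ∀ i, Measurable fun ω => |(m ω i : ℝ) - ν.scaledMean r i| := fun i =>
    (measurable_from_top (f := fun n : ℤ => |(n : ℝ) - ν.scaledMean r i|)).comp (hm i)
  have hme : ∀ i, MeasurableSet
      {ω | ν.weight r i ≤ 4 * N i ∧ 2 < |(m ω i : ℝ) - ν.scaledMean r i|} := fun i =>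
    (MeasurableSet.const _).inter (measurableSet_lt measurable_const (hmr i))
  have hpe : ∀ i ∈ T, P.real
      {ω | ν.weight r i ≤ 4 * N i ∧ 2 < |(m ω i : ℝ) - ν.scaledMean r i|} ≤ 2 * p := by
    intro i hi
    by_cases h : ν.weight r i ≤ 4 * N i
    · simpa [h] using hdev i hi h
    · simpa [h] using hp
  have h1 : P.real {ω | ν.best ∈ T ∧ 2 < |(m ω ν.best : ℝ) - ν.scaledMean r ν.best|} ≤ 2 * p := by
    by_cases hb : ν.best ∈ T
    · simpa [hb] using hdev _ hb (hbest hb)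
    · simpa [hb] using hp
  have h2 := measureReal_weighted_markov_pred (P := P) (w := ν.weight r) (T := T)
    (fun i _ => hme i) (fun i _ => hw i) (by linarith) hpe
  have h3 := measureReal_weighted_markov_pred (P := P) (w := ν.weight r) (T := T ∩ ν.resolved r)
    (fun i _ => hme i) (fun i _ => hw i) (by linarith) fun i hi => hpe i (Finset.mem_inter.1 hi).1
  have hU := (measureReal_union_le _ _).trans (add_le_add h1 ((measureReal_union_le _ _).trans
    (add_le_add h2 h3)))
  refine (measureReal_mono (fun ω hω => ?_) (measure_ne_top _ _)).trans (hU.trans ?_)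
  · simp only [Set.mem_union, Set.mem_ofPred_eq] at hω ⊢
    by_contra h
    push Not at h
    obtain ⟨g1, g2, g3⟩ := h
    exact hω ⟨g1, g2, g3⟩
  · norm_num; linarith

end Typical

/-- The scale of the failure probabilities: a run is typical with probability at least
`1 - 4 * failScale A`. -/
def failScale (A : ℕ) : ℝ := 2 ^ 24 * Real.exp (-A)

theorem failScale_nonneg (A : ℕ) : 0 ≤ failScale A := by unfold failScale; positivity

theorem exp_neg_nat_le (n : ℕ) : Real.exp (-n) ≤ (1 / 2) ^ n := by
  rw [Real.exp_neg, one_div, inv_pow]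
  refine inv_anti₀ (by positivity) ?_
  rw [← Real.exp_one_pow]
  exact pow_le_pow_left₀ (by norm_num) (by linarith [Real.add_one_le_exp (1 : ℝ)]) n

theorem exp_neg_conf_le (A : ℕ) (c : Ctx K) :
    2 ^ 23 * Real.exp (-(c.conf A : ℝ)) ≤ levelFail (failScale A) c.r c.ℓ / 2 := by
  set n := Nat.clog 2 ((c.r + 1) * (c.r + 2)) with hn
  have h0 : (-(c.conf A : ℝ)) = -A + (-(n : ℝ) + -(c.ℓ : ℝ)) := by
    unfold Ctx.conf roundConf; push_cast; ring
  have h1 := exp_neg_nat_le c.ℓ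
  have h2 : Real.exp (-n) ≤ 1 / ((c.r + 1) * (c.r + 2)) := by
    refine (exp_neg_nat_le n).trans ?_
    rw [one_div, inv_pow, one_div]
    refine inv_anti₀ (by positivity) ?_
    have h3 : (c.r + 1) * (c.r + 2) ≤ 2 ^ n := Nat.le_pow_clog (by norm_num) _
    exact_mod_cast h3
  rw [h0, Real.exp_add, Real.exp_add]
  unfold levelFail failScale
  calc 2 ^ 23 * (Real.exp (-A) * (Real.exp (-n) * Real.exp (-c.ℓ)))
      ≤ 2 ^ 23 * (Real.exp (-A) * (1 / ((c.r + 1) * (c.r + 2)) * (1 / 2) ^ c.ℓ)) := by gcongr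
    _ = _ := by field_simp

theorem one_le_conf {A : ℕ} (hA : 1 ≤ A) (c : Ctx K) : 1 ≤ c.conf A := by
  unfold Ctx.conf roundConf; omega

theorem measureReal_not_pilotGood_pilotStat_le (ν : BoundedInstance K) {A : ℕ} (hA : 1 ≤ A)
    (c : Ctx K) :
    ν.rewardLaw.real {ω | ¬ PilotGood ν c.r c.T
      (c.pilotStat A (pairRewards (schedule (c.pilotAlloc A) c.j) ω))} ≤
      levelFail (failScale A) c.r c.ℓ / 2 := by
  have hL := one_le_conf hA c
  have hΛ : 1 ≤ 64 * c.conf A := by omega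
  have ha : ∀ i ∈ c.T, c.pilotAlloc A i = 2 ^ c.r * (64 * c.conf A) := fun i hi => if_pos hi
  have hexp : Real.exp (-((64 * c.conf A : ℕ) : ℝ)) ≤ Real.exp (-(c.conf A : ℝ)) := by
    refine Real.exp_le_exp.2 (neg_le_neg ?_)
    exact_mod_cast (by omega : c.conf A ≤ 64 * c.conf A)
  refine (measureReal_not_pilotGood_le ν c.r c.T (p := Real.exp (-(c.conf A : ℝ))) (fun i => ?_)
    (Real.exp_pos _).le (fun i hi => ?_) (fun i hi => ?_) (fun i hi => ?_) (fun i hi => ?_)).trans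
    (exp_neg_conf_le A c)
  · refine (measurable_pi_apply i).comp ((c.measurable_pilotStat A).comp ?_)
    exact measurable_pi_lambda _ fun k => by unfold pairRewards; fun_prop
  · exact (measureReal_weightEst_lt_le ν c.j (ha i hi) hΛ).trans hexp
  · exact (measureReal_lt_weightEst_le ν c.j (ha i hi) hΛ).trans hexp
  · exact (integral_weightEst_le ν c.j (ha i hi) hΛ).1
  · exact (integral_weightEst_le ν c.j (ha i hi) hΛ).2.trans
      (mul_le_mul_of_nonneg_right hexp (ν.weight_pos _ _).le)

theorem measureReal_not_mainGood_mainStat_le (ν : BoundedInstance K) {A : ℕ} (hA : 1 ≤ A)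
    (c : Ctx K) {N : Fin K → ℕ} (hN : PilotGood ν c.r c.T N) :
    ν.rewardLaw.real {ω | ¬ MainGood ν c.r c.T N
      (c.mainStat A N fun k => ω k (schedule (c.mainAlloc A N) c.j k))} ≤
      levelFail (failScale A) c.r c.ℓ / 2 := by
  refine (measureReal_not_mainGood_le ν c.r c.T (p := Real.exp (-(c.conf A : ℝ))) (fun i => ?_)
    (Real.exp_pos _).le hN.best (fun i hi hw => ?_)).trans (exp_neg_conf_le A c)
  · refine (measurable_pi_apply i).comp ((c.measurable_mainStat A N).comp ?_)
    exact measurable_pi_lambda _ fun k => by fun_prop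
  · exact measureReal_meanEst_le ν c.j (if_pos hi) (one_le_conf hA c) hw

/-! ### The run of the algorithm -/

theorem conf_mul_sum_weight_le {ν : BoundedInstance K} {c : Ctx K} (hI : CtxInv ν c) (A : ℕ) :
    c.conf A * ∑ i ∈ c.T, ν.weight c.r i ≤ ν.roundWeight c.r * levelCost A c.r c.ℓ := by
  have h := mul_le_mul_of_nonneg_left hI.weight_le (Nat.cast_nonneg (α := ℝ) (c.conf A))
  refine h.trans (le_of_eq ?_)
  unfold Ctx.conf levelCost
  push_cast
  ring

theorem one_le_sum_weight (ν : BoundedInstance K) (r : ℕ) {T : Finset (Fin K)}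
    (hT : T.Nonempty) : 1 ≤ ∑ i ∈ T, ν.weight r i := by
  obtain ⟨i, hi⟩ := hT
  have h1 : (1 : ℝ) ≤ 2 ^ r := one_le_pow₀ (by norm_num)
  exact (h1.trans (ν.two_pow_le_weight r i)).trans
    (Finset.single_le_sum (f := ν.weight r) (fun i _ => (ν.weight_pos r i).le) hi)

theorem one_le_conf_mul_sum_weight {ν : BoundedInstance K} {c : Ctx K} (hI : CtxInv ν c) {A : ℕ}
    (hA : 1 ≤ A) : 1 ≤ c.conf A * ∑ i ∈ c.T, ν.weight c.r i := by
  have h1 : (1 : ℝ) ≤ c.conf A := by exact_mod_cast one_le_conf hA c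
  nlinarith [one_le_sum_weight ν c.r hI.nonempty]

theorem len_pilot_le {ν : BoundedInstance K} {c : Ctx K} (hI : CtxInv ν c) {A : ℕ} (hA : 1 ≤ A) :
    ((machine A).len (.pilot c) : ℝ) ≤ 2048 * ν.roundWeight c.r * levelCost A c.r c.ℓ := by
  have h1 := conf_mul_sum_weight_le hI A
  have h2 := one_le_conf_mul_sum_weight hI hA
  have h3 : ((2 * ∑ i, c.pilotAlloc A i : ℕ) : ℝ) ≤
      128 * (c.conf A * ∑ i ∈ c.T, ν.weight c.r i) := by
    have h4 : ∑ i, c.pilotAlloc A i = ∑ i ∈ c.T, 2 ^ c.r * (64 * c.conf A) := by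
      unfold Ctx.pilotAlloc
      rw [← Finset.sum_filter, Finset.filter_univ_mem]
    rw [h4]
    push_cast
    rw [Finset.mul_sum, Finset.mul_sum, Finset.mul_sum]
    refine Finset.sum_le_sum fun i _ => ?_
    have := mul_le_mul_of_nonneg_left (ν.two_pow_le_weight c.r i)
      (Nat.cast_nonneg (α := ℝ) (c.conf A))
    linarith
  change ((max 1 (2 * ∑ i, c.pilotAlloc A i) : ℕ) : ℝ) ≤ _
  rw [Nat.cast_max]
  refine max_le ?_ ?_
  · push_cast; linarith
  · linarith

theorem len_main_le {ν : BoundedInstance K} {c : Ctx K} (hI : CtxInv ν c) {A : ℕ} (hA : 1 ≤ A)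
    {N : Fin K → ℕ} (hN : PilotGood ν c.r c.T N) :
    ((machine A).len (.main c N) : ℝ) ≤ 2048 * ν.roundWeight c.r * levelCost A c.r c.ℓ := by
  have h1 := conf_mul_sum_weight_le hI A
  have h2 := one_le_conf_mul_sum_weight hI hA
  have h3 : ((∑ i, c.mainAlloc A N i : ℕ) : ℝ) ≤
      1088 * (c.conf A * ∑ i ∈ c.T, ν.weight c.r i) := by
    have h4 : ∑ i, c.mainAlloc A N i = ∑ i ∈ c.T, N i * (64 * c.conf A) := by
      unfold Ctx.mainAlloc
      rw [← Finset.sum_filter, Finset.filter_univ_mem]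
    rw [h4, ← Finset.sum_mul]
    push_cast
    have := mul_le_mul_of_nonneg_right hN.mass_le (Nat.cast_nonneg (α := ℝ) (64 * c.conf A))
    push_cast at this
    linarith
  change ((max 1 (∑ i, c.mainAlloc A N i) : ℕ) : ℝ) ≤ _
  rw [Nat.cast_max]
  refine max_le ?_ ?_
  · push_cast; linarith
  · linarith

/-- The variables at the start: all arms are sampled; the estimate `-3` is below all means. -/
def Ctx.init (j₀ : Fin K) : Ctx K := ⟨false, 0, 0, Finset.univ, Finset.univ, -3, j₀⟩

theorem ctxInv_init (ν : BoundedInstance K) (j₀ : Fin K) : CtxInv ν (Ctx.init j₀) := by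
  have hres : ∑ i ∈ Finset.univ ∩ ν.resolved 0, ν.weight 0 i ≤
      ∑ i ∈ ν.resolved 0, ν.share 0 i := by
    rw [Finset.univ_inter]
    exact le_of_eq (Finset.sum_congr rfl fun i _ => (ν.share_of_le (Nat.zero_le _)).symm)
  have hθ := ν.scaledMean_nonneg 0 ν.best
  exact {
    best_mem := Finset.mem_univ _
    sub := subset_rfl
    nonempty := ⟨ν.best, Finset.mem_univ _⟩
    round_le := Nat.zero_le _
    weight_le := by
      simp only [Ctx.init, pow_zero, one_mul]
      exact ν.sum_weight_le_roundWeight (Nat.zero_le _) hres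
    resolved_le := hres
    θ_le := by simp only [Ctx.init]; push_cast; linarith
    candidate := fun _ h => by
      simp only [Ctx.init] at h
      push_cast at h
      linarith
    search := fun _ => Or.inl (Finset.mem_univ _)
    le_θ := fun h => by simp [Ctx.init] at h
    best_sampled := fun h => by simp [Ctx.init] at h
    first_level := fun h => by simp [Ctx.init] at h
    later_level := fun h => by simp [Ctx.init] at h }

theorem pot_nonneg {ν : BoundedInstance K} (A : ℕ) (s : State K) : 0 ≤ pot ν A s := by
  have h : ∀ c : Ctx K, 0 ≤ ν.roundWeight c.r * levelCost A c.r c.ℓ := fun c =>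
    mul_nonneg (ν.roundWeight_nonneg _) (levelCost_nonneg _ _ _)
  cases s with
  | done j => exact le_rfl
  | pilot c => simp only [pot]; linarith [le_ctxPot ν A c, h c]
  | main c N => simp only [pot]; linarith [le_ctxPot ν A c, h c]

theorem fail_nonneg {κ : ℝ} (hκ : 0 ≤ κ) (s : State K) : 0 ≤ fail κ s := by
  cases s with
  | done j => exact le_rfl
  | pilot c => simp only [fail]; linarith [le_ctxFail hκ c, levelFail_nonneg hκ c.r c.ℓ]
  | main c N => simp only [fail]; linarith [le_ctxFail hκ c, levelFail_nonneg hκ c.r c.ℓ]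

/-- A typical run recommends the best arm within the initial time potential. -/
theorem measureReal_not_succeeds_machine_le (hK : 2 ≤ K) (ν : BoundedInstance K) {A : ℕ}
    (hA : 1 ≤ A) (j₀ : Fin K) :
    ν.rewardLaw.real {ω | ¬ (machine A).Succeeds ν.best ⌊roundsCost ν A 0⌋₊
      (.pilot (Ctx.init j₀)) ω} ≤ 4 * failScale A := by
  have hκ := failScale_nonneg A
  have h := BlockMachine.measureReal_not_succeeds_le (machine A) ν ν.best (Inv ν) (pot ν A)
    (fail (failScale A)) (fun s _ => pot_nonneg A s) (fun s _ => fail_nonneg hκ s) ?_ ?_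
    (.pilot (Ctx.init j₀)) (ctxInv_init ν j₀)
  · have h1 : pot ν A (.pilot (Ctx.init j₀)) = roundsCost ν A 0 := by
      rw [roundsCost_eq ν A (Nat.zero_le _)]
      simp only [pot, ctxPot, Ctx.init, Bool.false_eq_true, if_false]
      ring
    have h2 : fail (failScale A) (.pilot (Ctx.init j₀)) = 4 * failScale A := by
      simp only [fail, ctxFail, Ctx.init, levelFail, Bool.false_eq_true, if_false]
      push_cast
      ring
    rwa [h1, h2] at h
  · intro s hs j hj
    cases s with
    | done i =>
      have h1 : i = j := Option.some.inj hj
      have h2 : i = ν.best := hs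
      rw [← h1, h2]
    | pilot c => exact absurd hj (by simp [machine])
    | main c N => exact absurd hj (by simp [machine])
  · intro s hs hd
    cases s with
    | done i => exact absurd hd (by simp [machine])
    | pilot c =>
      have hlf := levelFail_nonneg hκ c.r c.ℓ
      refine ⟨State.main c '' {N | PilotGood ν c.r c.T N}, levelFail (failScale A) c.r c.ℓ / 2,
        by linarith, ?_, ?_, ?_⟩
      · simp only [fail]
        linarith [le_ctxFail hκ c]
      · refine le_trans (measureReal_mono (fun ω hω => ?_) (measure_ne_top _ _))
          (measureReal_not_pilotGood_pilotStat_le ν hA c)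
        simp only [Set.mem_ofPred_eq] at hω ⊢
        exact fun hg => hω (Set.mem_image_of_mem _ hg)
      · rintro _ ⟨N, hN, rfl⟩
        refine ⟨⟨hs, hN⟩, ?_, ?_⟩
        · simp only [pot]
          linarith [len_pilot_le hs hA]
        · simp only [fail]
          linarith
    | main c N =>
      obtain ⟨hI, hN⟩ := hs
      have hlf := levelFail_nonneg hκ c.r c.ℓ
      refine ⟨{s | GoodNext ν A (failScale A) c s}, levelFail (failScale A) c.r c.ℓ / 2,
        by linarith, ?_, ?_, ?_⟩
      · simp only [fail]
        linarith [le_ctxFail hκ c]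
      · refine le_trans (measureReal_mono (fun ω hω => ?_) (measure_ne_top _ _))
          (measureReal_not_mainGood_mainStat_le ν hA c hN)
        simp only [Set.mem_ofPred_eq] at hω ⊢
        intro hM
        obtain ⟨Z, hZ⟩ := exists_levelGood hN hM
        exact hω (goodNext_next hK A hκ hI hZ)
      · intro s hs
        simp only [Set.mem_ofPred_eq] at hs
        obtain ⟨h1, h2, h3⟩ := hs
        refine ⟨h1, ?_, ?_⟩
        · simp only [pot] at h2 ⊢
          linarith [len_main_le hI hA hN]
        · simp only [fail] at h3 ⊢
          linarith

/-! ### The sample complexity -/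

theorem roundConf_mono (A : ℕ) {r s : ℕ} (h : r ≤ s) : roundConf A r ≤ roundConf A s := by
  unfold roundConf
  exact Nat.add_le_add_left (Nat.clog_mono_right 2 (by gcongr)) A

theorem roundConf_succ_le {A : ℕ} (hA : 2 ≤ A) (r : ℕ) :
    roundConf A (r + 1) ≤ 2 * roundConf A r := by
  unfold roundConf
  have h : Nat.clog 2 ((r + 1 + 1) * (r + 1 + 2)) ≤ 2 + Nat.clog 2 ((r + 1) * (r + 2)) := by
    refine Nat.clog_le_of_le_pow ?_
    rw [pow_add]
    refine le_trans ?_ (Nat.mul_le_mul_left (2 ^ 2) (Nat.le_pow_clog (by norm_num) _))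
    nlinarith
  omega

theorem roundConf_add_le {A : ℕ} (hA : 2 ≤ A) (r k : ℕ) :
    roundConf A (r + k) ≤ 2 ^ k * roundConf A r := by
  induction k with
  | zero => simp
  | succ k ih =>
    rw [← add_assoc, pow_succ]
    have := roundConf_succ_le hA (r + k)
    linarith

namespace BoundedInstance

theorem two_pow_mul_weight_le (ν : BoundedInstance K) (r k : ℕ) (i : Fin K) :
    2 ^ k * ν.weight r i ≤ ν.weight (r + k) i := by
  induction k with
  | zero => simp
  | succ k ih =>
    rw [← add_assoc, pow_succ]
    have := ν.two_mul_weight_le (r + k) i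
    linarith

/-- The cost of arm `i` before the round that resolves its gap. -/
theorem share_mul_roundConf_le_of_le (ν : BoundedInstance K) (A : ℕ) (i : Fin K) {s k : ℕ}
    (h : ν.hardRound i = s + k) : ν.share s i * roundConf A s ≤
      (1 / 2) ^ k * (ν.weight (ν.hardRound i) i * roundConf A (ν.hardRound i)) := by
  have h1 := ν.two_pow_mul_weight_le s k i
  have h2 : (roundConf A s : ℝ) ≤ roundConf A (s + k) := by
    exact_mod_cast roundConf_mono A (by omega)
  rw [ν.share_of_le (by omega), h, one_div, inv_pow]
  have h3 : ν.weight s i ≤ (2 ^ k)⁻¹ * ν.weight (s + k) i := by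
    rw [← div_eq_inv_mul, le_div_iff₀ (by positivity)]; linarith
  have h4 := (ν.weight_pos s i).le
  calc ν.weight s i * roundConf A s ≤ ((2 ^ k)⁻¹ * ν.weight (s + k) i) * roundConf A (s + k) :=
        mul_le_mul h3 h2 (Nat.cast_nonneg _) (h4.trans h3)
    _ = _ := by ring

/-- The cost of arm `i` from the round on that resolves its gap. -/
theorem share_mul_roundConf_le_of_ge (ν : BoundedInstance K) {A : ℕ} (hA : 2 ≤ A) (i : Fin K)
    (k : ℕ) : ν.share (ν.hardRound i + k) i * roundConf A (ν.hardRound i + k) ≤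
      (1 / 2) ^ k * (ν.weight (ν.hardRound i) i * roundConf A (ν.hardRound i)) := by
  have h2 : (roundConf A (ν.hardRound i + k) : ℝ) ≤ 2 ^ k * roundConf A (ν.hardRound i) := by
    exact_mod_cast roundConf_add_le hA _ k
  have h4 := (ν.weight_pos (ν.hardRound i) i).le
  unfold share
  rw [min_eq_right (by omega), Nat.add_sub_cancel_left]
  calc _ ≤ ν.weight (ν.hardRound i) i * (1 / 4) ^ k * (2 ^ k * roundConf A (ν.hardRound i)) := by
        gcongr
    _ = ((1 / 4) * 2) ^ k * (ν.weight (ν.hardRound i) i * roundConf A (ν.hardRound i)) := by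
        rw [mul_pow]; ring
    _ = _ := by norm_num

theorem sum_share_mul_roundConf_le (ν : BoundedInstance K) {A : ℕ} (hA : 2 ≤ A) (i : Fin K)
    (n : ℕ) : ∑ s ∈ Finset.range n, ν.share s i * roundConf A s ≤
      4 * (ν.weight (ν.hardRound i) i * roundConf A (ν.hardRound i)) := by
  set X := ν.weight (ν.hardRound i) i * roundConf A (ν.hardRound i) with hX
  have hX0 : 0 ≤ X := mul_nonneg (ν.weight_pos _ _).le (Nat.cast_nonneg _)
  have hgeom : ∀ n, ∑ k ∈ Finset.range n, (1 / 2 : ℝ) ^ k * X ≤ 2 * X := fun n => by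
    rw [← Finset.sum_mul]
    exact mul_le_mul_of_nonneg_right (sum_geometric_two_le n) hX0
  calc ∑ s ∈ Finset.range n, ν.share s i * roundConf A s
      ≤ ∑ s ∈ Finset.range (ν.hardRound i + n), ν.share s i * roundConf A s :=
        Finset.sum_le_sum_of_subset_of_nonneg (Finset.range_mono (by omega)) fun s _ _ =>
          mul_nonneg (ν.share_pos s i).le (Nat.cast_nonneg _)
    _ = ∑ s ∈ Finset.range (ν.hardRound i), ν.share s i * roundConf A s +
        ∑ k ∈ Finset.range n, ν.share (ν.hardRound i + k) i * roundConf A (ν.hardRound i + k) :=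
        Finset.sum_range_add _ _ _
    _ ≤ 2 * X + 2 * X := by
        refine add_le_add ?_ ?_
        · rw [← Finset.sum_range_reflect]
          refine (Finset.sum_le_sum fun k hk => ?_).trans (hgeom (ν.hardRound i))
          have hk := Finset.mem_range.1 hk
          refine (ν.share_mul_roundConf_le_of_le A i (k := k + 1) (by omega)).trans ?_
          refine mul_le_mul_of_nonneg_right ?_ hX0
          exact pow_le_pow_of_le_one (by norm_num) (by norm_num) (by omega)
        · exact (Finset.sum_le_sum fun k _ => ν.share_mul_roundConf_le_of_ge hA i k).trans (hgeom n)
    _ = _ := by ring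

theorem two_pow_hardRound_le (hK : 2 ≤ K) (ν : BoundedInstance K) (i : Fin K) :
    2 ^ ν.hardRound i ≤ 10 / ν.gap i := by
  have hg := ν.gap_pos hK i
  rw [le_div_iff₀ hg]
  cases h : ν.hardRound i with
  | zero => linarith [ν.gap_le_one hK i]
  | succ r =>
    have h1 : ¬ 5 ≤ ν.gap i * 2 ^ r := fun h2 => by
      have := (ν.hardRound_le_iff hK i r).2 h2
      omega
    rw [pow_succ]
    linarith

theorem weight_hardRound_le (hK : 2 ≤ K) (ν : BoundedInstance K) (i : Fin K) :
    ν.weight (ν.hardRound i) i ≤ 100 * (ν.var i / ν.gap i ^ 2 + 1 / ν.gap i) := by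
  have hg := ν.gap_pos hK i
  have h1 := ν.two_pow_hardRound_le hK i
  have h2 : (4 : ℝ) ^ ν.hardRound i ≤ (10 / ν.gap i) ^ 2 := by
    rw [show (4 : ℝ) = 2 ^ 2 by norm_num, ← pow_mul, mul_comm, pow_mul]
    gcongr
  have h3 := mul_le_mul_of_nonneg_left h2 (ν.var_nonneg i)
  have h4 : ν.var i * (10 / ν.gap i) ^ 2 = 100 * (ν.var i / ν.gap i ^ 2) := by
    rw [div_pow]; ring
  have h5 : 10 / ν.gap i = 10 * (1 / ν.gap i) := by ring
  have h6 : 0 < 1 / ν.gap i := by positivity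
  unfold weight
  linarith

theorem roundConf_hardRound_le (hK : 2 ≤ K) (ν : BoundedInstance K) (A : ℕ) (i : Fin K) :
    (roundConf A (ν.hardRound i) : ℝ) ≤
      A + 10 + 4 * Real.log (1 + Real.log (1 / ν.gap i)) := by
  have hx := ν.log_gap_nonneg hK i
  have hg := ν.gap_pos hK i
  set R := ν.hardRound i with hR
  set x := Real.log (1 / ν.gap i) with hxdef
  have hln2 := Real.log_two_gt_d9
  have hln2' := Real.log_two_lt_d9
  have h1 : (R : ℝ) ≤ 6 + 2 * x := by
    have h2 := Real.log_le_log (by positivity) (ν.two_pow_hardRound_le hK i)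
    rw [Real.log_pow, show 10 / ν.gap i = 10 * (1 / ν.gap i) by ring,
      Real.log_mul (by norm_num) (by positivity)] at h2
    have h3 : Real.log 10 ≤ 3 := by
      have h4 : Real.log 10 ≤ Real.log (2 ^ 4) := Real.log_le_log (by norm_num) (by norm_num)
      rw [Real.log_pow] at h4
      push_cast at h4
      linarith
    nlinarith [Nat.cast_nonneg (α := ℝ) R]
  have h5 : ((R : ℝ) + 1) * (R + 2) ≤ 2 ^ 6 * (1 + x) ^ 2 := by
    have h6 : (R : ℝ) + 2 ≤ 8 * (1 + x) := by linarith
    nlinarith [Nat.cast_nonneg (α := ℝ) R]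
  have h7 := Nat.pow_pred_clog_lt_self (b := 2) (by norm_num) (x := (R + 1) * (R + 2))
    (by nlinarith)
  set n := Nat.clog 2 ((R + 1) * (R + 2)) with hn
  have h8 : (2 : ℝ) ^ n.pred ≤ 2 ^ 6 * (1 + x) ^ 2 := by
    refine le_trans ?_ h5
    exact_mod_cast h7.le
  have h9 := Real.log_le_log (by positivity) h8
  rw [Real.log_mul (by norm_num) (by positivity), Real.log_pow, Real.log_pow, Real.log_pow] at h9
  push_cast at h9
  have h10 : (n : ℝ) ≤ n.pred + 1 := by
    exact_mod_cast (by rw [Nat.pred_eq_sub_one]; omega : n ≤ n.pred + 1)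
  have h11 : 0 ≤ Real.log (1 + x) := ν.loglog_gap_nonneg hK i
  have h12 : (n : ℝ) ≤ 10 + 4 * Real.log (1 + x) := by
    nlinarith [Nat.cast_nonneg (α := ℝ) n.pred]
  unfold roundConf
  push_cast
  linarith

end BoundedInstance

theorem roundsCost_le {A : ℕ} (hA : 2 ≤ A) (ν : BoundedInstance K) : roundsCost ν A 0 ≤
    131072 * ∑ i, ν.weight (ν.hardRound i) i * roundConf A (ν.hardRound i) := by
  unfold roundsCost
  rw [← Finset.range_eq_Ico]
  set n := ν.hardRound ν.best + 1 with hn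
  calc ∑ s ∈ Finset.range n, 8192 * ν.roundWeight s * tailCost A s 0
      ≤ ∑ s ∈ Finset.range n, 32768 * ∑ i, ν.share s i * roundConf A s := by
        refine Finset.sum_le_sum fun s _ => ?_
        have h1 : tailCost A s 0 ≤ 4 * roundConf A s := by
          have h2 : (1 : ℝ) ≤ roundConf A s := by
            have : 1 ≤ roundConf A s := by unfold roundConf; omega
            exact_mod_cast this
          unfold tailCost
          push_cast
          linarith
        rw [← Finset.sum_mul, ← BoundedInstance.roundWeight]
        have := mul_le_mul_of_nonneg_left h1 (ν.roundWeight_nonneg s)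
        linarith
    _ = 32768 * ∑ i, ∑ s ∈ Finset.range n, ν.share s i * roundConf A s := by
        rw [← Finset.mul_sum, Finset.sum_comm]
    _ ≤ 32768 * ∑ i, 4 * (ν.weight (ν.hardRound i) i * roundConf A (ν.hardRound i)) := by
        gcongr with i
        exact ν.sum_share_mul_roundConf_le hA i n
    _ = _ := by rw [← Finset.mul_sum]; ring

/-- The confidence parameter of the algorithm at level `δ`; the summand `20` pays for the constant in
`failScale`. -/
def confExponent (δ : ℝ) : ℕ := ⌈Real.log (1 / δ)⌉₊ + 20

theorem roundsCost_confExponent_le (hK : 2 ≤ K) (ν : BoundedInstance K) {δ : ℝ}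
    (hδ : δ ∈ Set.Ioo (0 : ℝ) 1) : roundsCost ν (confExponent δ) 0 ≤
    406323200 * ∑ i, (ν.var i / ν.gap i ^ 2 + 1 / ν.gap i) *
      (1 + Real.log (1 / δ) + Real.log (1 + Real.log (1 / ν.gap i))) := by
  have hlog : 0 ≤ Real.log (1 / δ) :=
    Real.log_nonneg (by rw [le_div_iff₀ hδ.1]; linarith [hδ.2])
  have hA : (confExponent δ : ℝ) ≤ Real.log (1 / δ) + 21 := by
    have := (Nat.ceil_lt_add_one hlog).le
    unfold confExponent
    push_cast
    linarith
  refine (roundsCost_le (by unfold confExponent; omega) ν).trans ?_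
  rw [Finset.mul_sum, Finset.mul_sum]
  refine Finset.sum_le_sum fun i _ => ?_
  have h1 := ν.weight_hardRound_le hK i
  have h2 := ν.roundConf_hardRound_le hK (confExponent δ) i
  have h3 := ν.loglog_gap_nonneg hK i
  have h4 : (roundConf (confExponent δ) (ν.hardRound i) : ℝ) ≤
      31 * (1 + Real.log (1 / δ) + Real.log (1 + Real.log (1 / ν.gap i))) := by linarith
  have h5 := mul_le_mul h1 h4 (Nat.cast_nonneg _) (by linarith [ν.one_le_hardness hK i])
  linarith

theorem four_mul_failScale_le {δ : ℝ} (hδ : δ ∈ Set.Ioo (0 : ℝ) 1) :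
    4 * failScale (confExponent δ) ≤ δ := by
  have h1 : Real.exp (-(confExponent δ : ℝ)) ≤ Real.exp (-20) * δ := by
    have h2 : -(confExponent δ : ℝ) ≤ -20 + Real.log δ := by
      have := Nat.le_ceil (Real.log (1 / δ))
      rw [one_div, Real.log_inv] at this
      unfold confExponent
      rw [one_div, Real.log_inv]
      push_cast
      linarith
    calc _ ≤ Real.exp (-20 + Real.log δ) := Real.exp_le_exp.2 h2
      _ = _ := by rw [Real.exp_add, Real.exp_log hδ.1]
  have h3 : Real.exp (-20) ≤ 1 / 2 ^ 26 := by
    rw [Real.exp_neg, ← one_div]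
    refine one_div_le_one_div_of_le (by positivity) ?_
    have h4 := Real.exp_one_gt_d9
    calc (2 : ℝ) ^ 26 ≤ (2.7 : ℝ) ^ 20 := by norm_num
      _ ≤ Real.exp 1 ^ 20 := by gcongr; linarith
      _ = Real.exp 20 := by rw [Real.exp_one_pow]; norm_num
  unfold failScale
  have h5 := mul_le_mul_of_nonneg_right h3 hδ.1.le
  linarith

/-- Variance-dependent best-arm identification. -/
def learner (j₀ : Fin K) (δ : ℝ) : FCAlgorithm K :=
  (machine (confExponent δ)).toFC (.pilot (Ctx.init j₀))

theorem isVDBestArmID_learner (hK : 2 ≤ K) (j₀ : Fin K) :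
    IsVDBestArmID 406323200 (learner j₀) := by
  intro ν δ hδ
  refine BlockMachine.guarantees (machine (confExponent δ)) ν _
    (n := ⌊roundsCost ν (confExponent δ) 0⌋₊) ?_ ?_
  · exact (Nat.floor_le (roundsCost_nonneg ν _ 0)).trans (roundsCost_confExponent_le hK ν hδ)
  · exact (measureReal_not_succeeds_machine_le hK ν (by unfold confExponent; omega) j₀).trans
      (four_mul_failScale_le hδ)

end BAI

end


theorem corollary5p3 :
    (∃ c : ℝ, 0 < c ∧ ∀ K : ℕ, 2 ≤ K →
      ∃ 𝒜 : ℝ → BAI.FCAlgorithm K, BAI.IsVDBestArmID c 𝒜) ∧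
    (∀ c : ℝ, 0 < c → ∃ C : ℝ, 0 < C ∧
      ∀ K : ℕ, 2 ≤ K → ∀ 𝒜 : ℝ → BAI.FCAlgorithm K, BAI.IsVDBestArmID c 𝒜 →
      ∀ (ν : BAI.BoundedInstance K) (A : ℝ), A = C * ν.complexity →
      ∀ B : ℕ, 2 * A * Real.log (4 * A) ≤ (B : ℝ) →
      ∀ j₀ : Fin K,
        ν.rewardLaw.real {ω | BAI.fc2fb 𝒜 B (Real.exp (-1)) 1 j₀ ω ≠ ν.best}
          ≤ 3 * Real.exp (-((B : ℝ) / (4 + 4 * A * Real.log B)))) := by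
  refine ⟨⟨406323200, by norm_num, fun K hK =>
    ⟨BAI.learner ⟨0, by omega⟩, BAI.isVDBestArmID_learner hK _⟩⟩, fun c hc =>
    ⟨4 * c + 10, by linarith, fun K hK 𝒜 h𝒜 ν A hA B hB j₀ => ?_⟩⟩
  obtain ⟨s, hs1, hs, hbud, hexp⟩ :=
    BAI.exists_stage hc (ν.two_le_complexity hK) hA hB
  refine (BAI.measureReal_fc2fb_ne_le h𝒜 hc hK ν B j₀ hs1 hs hbud).trans ?_
  gcongr
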